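/- **Conventions.** The distance in a connected graph is the shortest-path distance. A walk is a nonempty sequence of vertices in which consecutive vertices are adjacent; $|P|$ is its number of vertices. For walks $P=(p_1,\dots,p_n)$ and $Q=(q_1,\dots,q_m)$ in a connected graph with distance function $\mathrm{dist}$, the discrete Fréchet distance is $$D_{\mathcal F}(P,Q)=\min_F\max_{(i,j)\in F}\mathrm{dist}(p_i,q_j),$$ where $F$ ranges over the sequences of points of $[n]\times[m]$ that start in $(1,1)$, end in $(n,m)$ and in each step increase each coordinate by $0$ or $1$. Two vectors $a,b\in\{0,1\}^d$ are orthogonal if $\sum_i a_ib_i=0$. Algorithms are deterministic word-RAM programs (unit-cost arithmetic and bitwise operations on words of $O(\log s)$ bits, where $s$ is the size of the input). For $\gamma,\omega>0$ let $\mathrm{OV}_{\gamma,\omega}$ be the problem to decide, for two lists $A,B\subset\{0,1\}^d$ with $|A|=n$, $|B|=m=\lceil n^\gamma\rceil$ and $d=\lceil\omega\log_2 n\rceil$, whether some $a\in A$ and $b\in B$ are orthogonal. The Orthogonal Vectors Hypothesis for the exponent $\gamma$, $\mathrm{OVH}_\gamma$, says that for every $\delta>0$ there is $\omega>0$ such that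 $\mathrm{OV}_{\gamma,\omega}$ cannot be solved in $O((nm)^{1-\delta})$ time. The hypothesis $\mathrm{OVH}$, in which the exponent may depend on $\delta$, says that for every $\delta>0$ there are $\omega>0$ and $0<\gamma<1$ such that $\mathrm{OV}_{\gamma,\omega}$ cannot be solved in $O((nm)^{1-\delta})$ time. **Theorem.** There is a fixed (hence constant-size) finite connected planar graph $G$ with the following properties. 1. (Reduction.) Give every edge of $G$ the weight $1/10$. There are maps $f,g$ that assign to every nonempty list of vectors in $\{0,1\}^d$, $d\ge1$, a walk in $G$, and a constant $C$, such that $|f(A)|\le C\,|A|\,d$ and $|g(B)|\le C\,|B|\,d$ for all nonempty lists $A,B$ of vectors in $\{0,1\}^d$, and $$\text{some } a\in A,\ b\in B \text{ are orthogonal}\iff D_{\mathcal F}(f(A),g(B))\le 1.9 .$$ 2. (Hardness.) Give every edge of $G$ the weight $1$. Let $0<\gamma\le1$ and assume $\mathrm{OVH}_\gamma$. Then for every $\delta>0$ no algorithm computes $D_{\mathcal F}(P,Q)$ for all walks $P,Q$ in $G$ with $|P|=n$, $|Q|=m$ and $n=\lceil m^\gamma\rceil$ in $O((nm)^{1-\delta})$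 time, even though the algorithm may depend on $G$. 3. (The exponent may depend on $\delta$.) Assume $\mathrm{OVH}$. Then for every $\delta>0$ there is $0<\gamma<1$ such that no algorithm computes $D_{\mathcal F}(P,Q)$ for all walks $P,Q$ in the unit-weight graph $G$ with $|P|=n$, $|Q|=m$ and $n=\lceil m^\gamma\rceil$ in $O((nm)^{1-\delta})$ time. -/

import Mathlib

/-! ### Walks, planarity, and the discrete Fréchet distance in a graph -/

/-- A walk given by its nonempty sequence of vertices; consecutive vertices are adjacent and
vertices may repeat. Its number of vertices is the length of the list. -/
def IsVertexWalk {V : Type*} (G : SimpleGraph V) (P : List V) : Prop :=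
  P ≠ [] ∧ P.IsChain G.Adj

/-- A graph is planar if it can be drawn in the plane: vertices are distinct points, each edge is
a simple arc joining its two end points, the relative interior of an arc contains no vertex, and
the relative interiors of the arcs of distinct edges are disjoint. -/
def IsPlanarGraph {V : Type*} (G : SimpleGraph V) : Prop :=
  ∃ (pt : V → ℝ × ℝ) (arc : Sym2 V → ℝ → ℝ × ℝ),
    Function.Injective pt ∧
    ∀ e ∈ G.edgeSet,
      ContinuousOn (arc e) (Set.Icc 0 1) ∧
      Set.InjOn (arc e) (Set.Icc 0 1) ∧
      s(arc e 0, arc e 1) = e.map pt ∧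
      (∀ t ∈ Set.Ioo (0 : ℝ) 1, arc e t ∉ Set.range pt) ∧
      ∀ e' ∈ G.edgeSet, e ≠ e' →
        Disjoint (arc e '' Set.Ioo 0 1) (arc e' '' Set.Ioo 0 1)

/-- An `xy`-monotone discrete walk through the `n × m` lattice (positions counted from `0`),
from the first position `(0, 0)` to the last position `(n - 1, m - 1)`. In each step, each
coordinate stays or increases by one. -/
structure IsTraversal (n m : ℕ) (F : List (Fin n × Fin m)) : Prop where
  nonempty : F ≠ []
  start : ∀ p ∈ F.head?, (p.1 : ℕ) = 0 ∧ (p.2 : ℕ) = 0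
  finish : ∀ p ∈ F.getLast?, (p.1 : ℕ) + 1 = n ∧ (p.2 : ℕ) + 1 = m
  step : F.IsChain fun p q =>
    ((q.1 : ℕ) = p.1 ∨ (q.1 : ℕ) = p.1 + 1) ∧ ((q.2 : ℕ) = p.2 ∨ (q.2 : ℕ) = p.2 + 1)

/-- The cost of a traversal: the maximum of the distances between matched vertices, where every
edge of `G` has length `ℓ ≥ 0`, so that the distance of `u` and `v` is `ℓ * G.dist u v`. -/
noncomputable def traversalCost {V : Type*} (G : SimpleGraph V) (ℓ : ℝ) (P Q : List V)
    (F : List (Fin P.length × Fin Q.length)) : ℝ :=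
  (F.map fun p => ℓ * (G.dist (P.get p.1) (Q.get p.2) : ℝ)).foldr max 0

/-- The (strong) discrete Fréchet distance of `P` and `Q` in the connected graph `G`, all of whose
edges have length `ℓ`: the minimum cost of a traversal (the set of costs is finite). -/
noncomputable def discreteFrechet {V : Type*} (G : SimpleGraph V) (ℓ : ℝ) (P Q : List V) : ℝ :=
  sInf {c : ℝ | ∃ F : List (Fin P.length × Fin Q.length),
    IsTraversal P.length Q.length F ∧ c = traversalCost G ℓ P Q F}

/-! ### The word RAM -/

/-- The unit-cost operations on words. -/
inductive WordOp
  | add | sub | mul | div | mod | and | or | xor | shl | shr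

/-- Truncated subtraction; division and remainder by `0` follow the conventions of `ℕ`. -/
def WordOp.eval : WordOp → ℕ → ℕ → ℕ
  | .add, x, y => x + y
  | .sub, x, y => x - y
  | .mul, x, y => x * y
  | .div, x, y => x / y
  | .mod, x, y => x % y
  | .and, x, y => x &&& y
  | .or, x, y => x ||| y
  | .xor, x, y => x ^^^ y
  | .shl, x, y => x <<< y
  | .shr, x, y => x >>> y

/-- Programs of a deterministic word RAM. A program is a finite object, so it uses only finitely
many of the registers and of the random access arrays, which are both named by natural numbers. -/
inductive RamProg
  | skip : RamProg
  /-- `reg x := c` -/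
  | const (x c : ℕ) : RamProg
  /-- `reg x := reg y ∘ reg z` -/
  | op (o : WordOp) (x y z : ℕ) : RamProg
  /-- `reg x := mem a [reg y]` -/
  | load (x a y : ℕ) : RamProg
  /-- `mem a [reg y] := reg x` -/
  | store (a y x : ℕ) : RamProg
  | seq (p q : RamProg) : RamProg
  /-- `if reg x ≠ 0 then p else q` -/
  | ite (x : ℕ) (p q : RamProg) : RamProg
  /-- `while reg x ≠ 0 do p` -/
  | loop (x : ℕ) (p : RamProg) : RamProg

/-- The contents of the registers, and of the cells of the arrays (array name, then index). -/
structure RamState where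
  reg : ℕ → ℕ
  mem : ℕ → ℕ → ℕ

def RamState.setReg (s : RamState) (x v : ℕ) : RamState :=
  { s with reg := Function.update s.reg x v }

def RamState.setMem (s : RamState) (a i v : ℕ) : RamState :=
  { s with mem := Function.update s.mem a (Function.update (s.mem a) i v) }

/-- `RamExec W p s t s'`: started in state `s`, the program `p` halts in state `s'` after exactly
`t` steps, and every value that it computes on the way is a word, that is, smaller than `W`.
Every assignment, every access to memory and every test of a register costs one step. -/
inductive RamExec (W : ℕ) : RamProg → RamState → ℕ → RamState → Prop
  | skip (s : RamState) : RamExec W .skip s 1 s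
  | const (s : RamState) (x c : ℕ) (h : c < W) : RamExec W (.const x c) s 1 (s.setReg x c)
  | op (s : RamState) (o : WordOp) (x y z : ℕ) (h : o.eval (s.reg y) (s.reg z) < W) :
      RamExec W (.op o x y z) s 1 (s.setReg x (o.eval (s.reg y) (s.reg z)))
  | load (s : RamState) (x a y : ℕ) (h : s.mem a (s.reg y) < W) :
      RamExec W (.load x a y) s 1 (s.setReg x (s.mem a (s.reg y)))
  | store (s : RamState) (a y x : ℕ) (hy : s.reg y < W) (hx : s.reg x < W) :
      RamExec W (.store a y x) s 1 (s.setMem a (s.reg y) (s.reg x))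
  | seq {p q : RamProg} {s s' s'' : RamState} {t t' : ℕ}
      (hp : RamExec W p s t s') (hq : RamExec W q s' t' s'') :
      RamExec W (.seq p q) s (t + t') s''
  | iteTrue {x : ℕ} {p : RamProg} (q : RamProg) {s s' : RamState} {t : ℕ}
      (hx : s.reg x ≠ 0) (hp : RamExec W p s t s') : RamExec W (.ite x p q) s (t + 1) s'
  | iteFalse {x : ℕ} (p : RamProg) {q : RamProg} {s s' : RamState} {t : ℕ}
      (hx : s.reg x = 0) (hq : RamExec W q s t s') : RamExec W (.ite x p q) s (t + 1) s'
  | loopDone {x : ℕ} (p : RamProg) {s : RamState} (hx : s.reg x = 0) :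
      RamExec W (.loop x p) s 1 s
  | loopStep {x : ℕ} {p : RamProg} {s s' s'' : RamState} {t t' : ℕ} (hx : s.reg x ≠ 0)
      (hp : RamExec W p s t s') (hl : RamExec W (.loop x p) s' t' s'') :
      RamExec W (.loop x p) s (t + 1 + t') s''

/-- The initial state: the listed values are in the first registers, the two listed arrays are in
the first two arrays, and everything else is `0`. -/
def ramInput (regs arr₀ arr₁ : List ℕ) : RamState where
  reg x := regs.getD x 0
  mem a i := if a = 0 then arr₀.getD i 0 else if a = 1 then arr₁.getD i 0 else 0

/-! ### Orthogonal vectors -/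

def OrthogonalBool {d : ℕ} (a b : Fin d → Bool) : Prop :=
  ∑ i, (a i).toNat * (b i).toNat = 0

def HasOrthogonalPair {d : ℕ} (A B : List (Fin d → Bool)) : Prop :=
  ∃ a ∈ A, ∃ b ∈ B, OrthogonalBool a b

/-- The vectors of a list written one after the other, one coordinate per cell. -/
def vectorCells {d : ℕ} (A : List (Fin d → Bool)) : List ℕ :=
  A.flatMap fun a => List.ofFn fun i => (a i).toNat

/-- Some word RAM program, with words of `O(log n)` bits, solves the Orthogonal Vectors problem for
`n` vectors `A` and `m = ⌈n ^ γ⌉` vectors `B` of dimension `d = ⌈ω * log₂ n⌉` in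
`O((n * m) ^ (1 - δ))` steps. The answer is left in register `0`. -/
def OrthogonalVectorsSolvable (γ ω δ : ℝ) : Prop :=
  ∃ (p : RamProg) (k : ℕ) (C : ℝ), ∀ (n m d : ℕ),
    1 ≤ n → m = ⌈(n : ℝ) ^ γ⌉₊ → d = ⌈ω * Real.logb 2 n⌉₊ →
    ∀ A B : List (Fin d → Bool), A.length = n → B.length = m →
      ∃ (t : ℕ) (s : RamState),
        RamExec ((n + m + d + 2) ^ k) p (ramInput [n, m, d] (vectorCells A) (vectorCells B)) t s ∧
        (t : ℝ) ≤ C * ((n : ℝ) * m) ^ (1 - δ) ∧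
        (HasOrthogonalPair A B → s.reg 0 = 1) ∧
        (¬ HasOrthogonalPair A B → s.reg 0 = 0)

/-- The Orthogonal Vectors Hypothesis for the fixed size relation `m = n ^ γ`. -/
def OVHAt (γ : ℝ) : Prop :=
  ∀ δ : ℝ, 0 < δ → ∃ ω : ℝ, 0 < ω ∧ ¬ OrthogonalVectorsSolvable γ ω δ

/-- The Orthogonal Vectors Hypothesis in the form in which the exponent `γ` of the size relation
may depend on `δ`. -/
def OVH : Prop :=
  ∀ δ : ℝ, 0 < δ → ∃ ω γ : ℝ, 0 < ω ∧ 0 < γ ∧ γ < 1 ∧ ¬ OrthogonalVectorsSolvable γ ω δ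

/-! ### Computing the discrete Fréchet distance of walks in a fixed graph -/

/-- Some word RAM program, with words of `O(log (n + m))` bits, computes the discrete Fréchet
distance of all walks `P`, `Q` in the unit-weight graph `G` that have `n = ⌈m ^ γ⌉` and `m`
vertices, in `O((n * m) ^ (1 - δ))` steps. The program may depend on `G`; the vertices of `G` are
numbered, and the distance, which is a natural number, is left in register `0`. -/
def FrechetSolvable {N : ℕ} (G : SimpleGraph (Fin N)) (γ δ : ℝ) : Prop :=
  ∃ (p : RamProg) (k : ℕ) (C : ℝ), ∀ (n m : ℕ),
    1 ≤ m → n = ⌈(m : ℝ) ^ γ⌉₊ →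
    ∀ P Q : List (Fin N), IsVertexWalk G P → IsVertexWalk G Q → P.length = n → Q.length = m →
      ∃ (t : ℕ) (s : RamState),
        RamExec ((n + m + 2) ^ k) p
          (ramInput [n, m] (P.map fun v => (v : ℕ)) (Q.map fun v => (v : ℕ))) t s ∧
        (t : ℝ) ≤ C * ((n : ℝ) * m) ^ (1 - δ) ∧
        (s.reg 0 : ℝ) = discreteFrechet G 1 P Q

/-! ### The graph: a cycle of length 40 with three pendant paths -/

/-! On a cycle of length 40 two vertices are at distance at most 19 exactly when they are not
antipodal. Let one walk move along the arc from 5 to 14 and another along the arc from 29 to 35. At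
threshold 19, which is 1.9 for edges of weight 1/10, the second walk can pass the antipode of the
first only if both take a step at the same time. Every coordinate of a vector makes each walk cross
to one side, show its bit and cross back, so these forced joint crossings synchronise the two walks.
A bit one is shown at the pendant vertex 40 in the first walk and at 41 in the second. These two are
at distance 21, while all other pairs of bit vertices are near. Hence two vectors can be passed
together exactly if they are orthogonal. The longer pendant paths select the pair of vectors. Among
the vertices of the first walk, the tip 49 is near only 14 and the tip 45 is near only 5. The second
walk visits 49 before its first vector and 45 after its last one, so in between the first walk has
to get from 14 down to 5, through a vector. The vertex 48, between consecutive vectors of the second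
walk, is near only 5, 13 and 14, so the second walk cannot change its vector while the first is
passing coordinates. An orthogonal pair gives an explicit coupling, in `coupling_of_orthogonal`.
Conversely, if no pair is orthogonal, then the invariant `Confined` holds along every coupling: the
first walk stays in one vector and has made at most as many crossings as the second, and if the
numbers agree, then no coordinate passed so far is one in both vectors. Its preservation,
`Confined.step`, rests on the finite check `stepCheck_eq_true`. For hardness, the walks are given as
many vertices as there are vectors, so the required relation between the two lengths holds by
itself. The vectors are then split into `O(d)` groups on each side, each of which fits into a walk,
and the assumed algorithm is run on all pairs of groups. The factor `d ^ 2` is polylogarithmic and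
costs half of the exponent `δ`. Each run gets a fresh window of memory through `RamProg.relocate`,
so nothing has to be erased. Writing the walks takes linear time, which is affordable if `(1 + γ) *
(1 - δ) ≥ 1`. For fixed `γ` this is achieved by decreasing `δ`. If `γ` depends on `δ`, the remaining
case is excluded without any hypothesis by `not_frechetSolvable`: an algorithm in sublinear time
cannot read its input. -/

/-- Every vertex has one outgoing edge: along the cycle `0, …, 39`, or down its pendant path. -/
def gadgetNext (v : ℕ) : ℕ :=
  if v < 39 then v + 1 else if v = 39 then 0 else if v = 40 then 10 else if v = 41 then 31
  else if v = 46 then 29 else v - 1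

/-- The vertex of the cycle at which the pendant path of `v` is attached. -/
def gadgetBase (v : ℕ) : ℕ :=
  if v < 40 then v else if v = 40 then 10 else if v ≤ 45 then 31 else 29

/-- The distance of `v` from the cycle. -/
def gadgetHeight (v : ℕ) : ℕ :=
  if v < 40 then 0 else if v = 40 then 1 else if v ≤ 45 then v - 40 else v - 45

/-- The distance of two vertices, in closed form. -/
def gadgetDist (u v : ℕ) : ℕ :=
  if gadgetBase u = gadgetBase v then
    (gadgetHeight u - gadgetHeight v) + (gadgetHeight v - gadgetHeight u)
  else
    min ((gadgetBase u - gadgetBase v) + (gadgetBase v - gadgetBase u))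
      (40 - ((gadgetBase u - gadgetBase v) + (gadgetBase v - gadgetBase u))) +
      gadgetHeight u + gadgetHeight v

theorem gadgetNext_lt {v : ℕ} (h : v < 50) : gadgetNext v < 50 := by
  unfold gadgetNext; split_ifs <;> omega

theorem gadgetNext_ne (v : ℕ) : gadgetNext v ≠ v := by
  unfold gadgetNext; split_ifs <;> omega

def gadgetGraph : SimpleGraph (Fin 50) where
  Adj u v := gadgetNext u = v ∨ gadgetNext v = u
  symm := ⟨fun _ _ h => h.symm⟩
  loopless := ⟨fun v h => by
    rcases h with h | h <;> exact gadgetNext_ne _ h⟩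

instance : DecidableRel gadgetGraph.Adj := fun u v =>
  inferInstanceAs (Decidable (gadgetNext u = v ∨ gadgetNext v = u))

/-- For the lower bound: a function that changes by at most one along each edge is at most the
length of any walk. -/
theorem gadgetDist_next : ∀ v < 50, ∀ w < 50,
    gadgetDist v w ≤ gadgetDist (gadgetNext v) w + 1 ∧
    gadgetDist (gadgetNext v) w ≤ gadgetDist v w + 1 := by
  decide +kernel

/-- For the upper bound: going to a closer neighbour again and again yields a walk of the right
length. The candidates include all neighbours; 39 precedes 0 on the cycle, and 40, 41 and 46 start
the pendant paths at 10, 31 and 29. -/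
theorem gadgetDist_closer : ∀ u < 50, ∀ v < 50, u ≠ v →
    ∃ w ∈ [gadgetNext u, u - 1, u + 1, 39, 40, 41, 46], w < 50 ∧
      (gadgetNext u = w ∨ gadgetNext w = u) ∧ gadgetDist w v + 1 = gadgetDist u v := by
  decide +kernel

theorem gadgetDist_self (v : ℕ) : gadgetDist v v = 0 := by
  simp [gadgetDist]

theorem gadgetDist_le_of_adj {u v : Fin 50} (h : gadgetGraph.Adj u v) (w : Fin 50) :
    gadgetDist u w ≤ gadgetDist v w + 1 := by
  rcases h with h | h
  · rw [← h]; exact (gadgetDist_next u u.2 w w.2).1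
  · rw [← h]; exact (gadgetDist_next v v.2 w w.2).2

theorem gadgetDist_le_length {u v : Fin 50} (p : gadgetGraph.Walk u v) :
    gadgetDist u v ≤ p.length := by
  induction p with
  | nil => simp [gadgetDist_self]
  | cons h p ih =>
    rw [SimpleGraph.Walk.length_cons]
    exact (gadgetDist_le_of_adj h _).trans (by omega)

theorem exists_walk_length_eq_gadgetDist (v : Fin 50) : ∀ (k : ℕ) (u : Fin 50),
    gadgetDist u v = k → ∃ p : gadgetGraph.Walk u v, p.length = k := by
  intro k
  induction k with
  | zero =>
    intro u hu
    by_cases h : u = v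
    · subst h; exact ⟨.nil, rfl⟩
    · obtain ⟨w, -, -, -, h4⟩ := gadgetDist_closer u u.2 v v.2 (fun h' => h (Fin.ext h'))
      omega
  | succ k ih =>
    intro u hu
    by_cases h : u = v
    · subst h; rw [gadgetDist_self] at hu; omega
    · obtain ⟨w, -, h2, h3, h4⟩ := gadgetDist_closer u u.2 v v.2 (fun h' => h (Fin.ext h'))
      obtain ⟨p, hp⟩ := ih ⟨w, h2⟩ (by simpa using by omega)
      exact ⟨.cons (show gadgetGraph.Adj u ⟨w, h2⟩ from h3) p, by simp [hp]⟩

theorem gadgetGraph_connected : gadgetGraph.Connected where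
  preconnected u v := (exists_walk_length_eq_gadgetDist v _ u rfl).elim fun p _ => ⟨p⟩
  nonempty := ⟨0⟩

theorem gadgetGraph_dist (u v : Fin 50) : gadgetGraph.dist u v = gadgetDist u v := by
  obtain ⟨p, hp⟩ := exists_walk_length_eq_gadgetDist v _ u rfl
  obtain ⟨q, hq⟩ := (gadgetGraph_connected.preconnected u v).exists_walk_length_eq_dist
  exact le_antisymm (hp ▸ SimpleGraph.dist_le p) (hq ▸ gadgetDist_le_length q)

/-! ### Planarity -/

/-- The arc of the edge from `v` to `gadgetNext v`: the cycle runs along the horizontal axis and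
is closed by a parabola below it, and the pendant paths are vertical. -/
noncomputable def gadgetArc (v : ℕ) (t : ℝ) : ℝ × ℝ :=
  if v < 39 then ((v : ℝ) + t, 0)
  else if v = 39 then (39 * (1 - t), -(t * (1 - t)))
  else ((gadgetBase v : ℝ), (gadgetHeight v : ℝ) - t)

noncomputable def gadgetPoint (v : ℕ) : ℝ × ℝ := ((gadgetBase v : ℝ), (gadgetHeight v : ℝ))

theorem gadgetPoint_inj : ∀ u < 50, ∀ v < 50,
    gadgetBase u = gadgetBase v → gadgetHeight u = gadgetHeight v → u = v := by
  decide +kernel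

theorem gadgetArc_zero {v : ℕ} (hv : v < 50) : gadgetArc v 0 = gadgetPoint v := by
  unfold gadgetArc gadgetPoint
  split_ifs with h1 h2
  · have : v < 40 := by omega
    simp [gadgetBase, gadgetHeight, this]
  · subst h2; simp [gadgetBase, gadgetHeight]
  · simp

theorem gadgetNext_base : ∀ v < 50, 40 ≤ v →
    gadgetBase (gadgetNext v) = gadgetBase v ∧
      gadgetHeight v = gadgetHeight (gadgetNext v) + 1 := by
  decide +kernel

theorem gadgetArc_one {v : ℕ} (hv : v < 50) : gadgetArc v 1 = gadgetPoint (gadgetNext v) := by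
  unfold gadgetArc gadgetPoint
  split_ifs with h1 h2
  · have h : v + 1 < 40 := by omega
    simp [gadgetNext, gadgetBase, gadgetHeight, h1, h]
  · subst h2; simp [gadgetBase, gadgetHeight, gadgetNext]
  · obtain ⟨h3, h4⟩ := gadgetNext_base v hv (by omega)
    simp [h3, h4]

theorem continuous_gadgetArc (v : ℕ) : Continuous (gadgetArc v) := by
  unfold gadgetArc
  split_ifs <;> fun_prop

theorem gadgetArc_injective (v : ℕ) : Function.Injective (gadgetArc v) := by
  intro s t h
  unfold gadgetArc at h
  split_ifs at h <;> simp only [Prod.mk.injEq] at h <;> linarith [h.1, h.2]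

/-- Inner points of straight arcs have a coordinate that is not an integer, and those of the
parabola lie below all vertices. -/
theorem gadgetArc_ne_gadgetPoint {v w : ℕ} {t : ℝ} (ht : t ∈ Set.Ioo (0 : ℝ) 1) :
    gadgetArc v t ≠ gadgetPoint w := by
  obtain ⟨h0, h1⟩ := ht
  have key : ∀ a b : ℕ, (a : ℝ) + t ≠ b := by
    intro a b h
    have h2 : (a : ℝ) < b := by linarith
    have h3 : (b : ℝ) < a + 1 := by linarith
    norm_cast at h2 h3; omega
  intro h
  unfold gadgetArc gadgetPoint at h
  split_ifs at h with h2 h3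
  · exact key _ _ (Prod.mk.inj h).1
  · have h4 := (Prod.mk.inj h).2
    have h5 : (0 : ℝ) ≤ gadgetHeight w := Nat.cast_nonneg _
    nlinarith
  · have h4 := (Prod.mk.inj h).2
    exact key (gadgetHeight w) (gadgetHeight v) (by linarith)

theorem gadgetArc_disjoint {v w : ℕ} (hv : v < 50) (hw : w < 50) (hvw : v ≠ w) {s t : ℝ}
    (hs : s ∈ Set.Ioo (0 : ℝ) 1) (ht : t ∈ Set.Ioo (0 : ℝ) 1) : gadgetArc v s ≠ gadgetArc w t := by
  obtain ⟨s0, s1⟩ := hs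
  obtain ⟨t0, t1⟩ := ht
  have key : ∀ a b : ℕ, (a : ℝ) + s = b + t → a = b := by
    intro a b h
    have h2 : (a : ℝ) < b + 1 := by linarith
    have h3 : (b : ℝ) < a + 1 := by linarith
    norm_cast at h2 h3; omega
  have key' : ∀ a b : ℕ, (a : ℝ) - s = b - t → a = b := by
    intro a b h
    have h2 : (a : ℝ) < b + 1 := by linarith
    have h3 : (b : ℝ) < a + 1 := by linarith
    norm_cast at h2 h3; omega
  have height : ∀ u < 50, 40 ≤ u → (1 : ℝ) ≤ gadgetHeight u := by
    intro u hu h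
    have := (gadgetNext_base u hu h).2
    exact_mod_cast (by omega : 1 ≤ gadgetHeight u)
  have hs' : 0 < s * (1 - s) := mul_pos s0 (by linarith)
  have ht' : 0 < t * (1 - t) := mul_pos t0 (by linarith)
  intro h
  unfold gadgetArc at h
  -- The nine cases pair three kinds of arcs. Different kinds are separated by their second
  -- coordinate: zero on the axis, negative on the parabola, positive on pendant edges. Within a
  -- kind, the integer parts identify the edge.
  split_ifs at h <;> simp only [Prod.mk.injEq] at h <;> obtain ⟨h1, h2⟩ := h
  · exact hvw (key _ _ h1)
  · linarith
  · linarith [height w hw (by omega)]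
  · linarith
  · omega
  · linarith [height w hw (by omega)]
  · linarith [height v hv (by omega)]
  · linarith [height v hv (by omega)]
  · exact hvw (gadgetPoint_inj v hv w hw (by exact_mod_cast h1) (key' _ _ h2))

theorem gadgetGraph_planar : IsPlanarGraph gadgetGraph := by
  classical
  have hedge : ∀ e ∈ gadgetGraph.edgeSet, ∃ v : Fin 50,
      e = s(v, ⟨gadgetNext v, gadgetNext_lt v.2⟩) := by
    intro e
    induction e with
    | h u v =>
      rintro (h | h)
      · exact ⟨u, by congr 2; exact Fin.ext h.symm⟩
      · exact ⟨v, by rw [Sym2.eq_swap]; congr 2; exact Fin.ext h.symm⟩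
  choose! tail htail using hedge
  refine ⟨fun v => gadgetPoint v, fun e => gadgetArc (tail e), ?_, ?_⟩
  · intro u v h
    have h1 := (Prod.mk.inj h).1
    have h2 := (Prod.mk.inj h).2
    exact Fin.ext (gadgetPoint_inj u u.2 v v.2 (by exact_mod_cast h1) (by exact_mod_cast h2))
  · intro e he
    refine ⟨(continuous_gadgetArc _).continuousOn, (gadgetArc_injective _).injOn, ?_, ?_, ?_⟩
    · conv_rhs => rw [htail e he]
      beta_reduce
      rw [gadgetArc_zero (tail e).2, gadgetArc_one (tail e).2]; rfl
    · rintro t ht ⟨w, hw⟩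
      exact gadgetArc_ne_gadgetPoint ht hw.symm
    · intro e' he' hne
      rw [Set.disjoint_left]
      rintro _ ⟨s, hs, rfl⟩ ⟨t, ht, h⟩
      refine gadgetArc_disjoint (tail e).2 (tail e').2 (fun hv => hne ?_) hs ht h.symm
      rw [htail e he, htail e' he', Fin.ext hv]

/-! ### Couplings of two lists -/

/-- `Coupling R P Q`: the lists can be traversed together, from their heads to their ends, such
that matched elements are always related by `R`. -/
inductive Coupling {α β : Type*} (R : α → β → Prop) : List α → List β → Prop
  | single {a b} (h : R a b) : Coupling R [a] [b]
  | left {a b P Q} (h : R a b) (hc : Coupling R P (b :: Q)) : Coupling R (a :: P) (b :: Q)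
  | right {a b P Q} (h : R a b) (hc : Coupling R (a :: P) Q) : Coupling R (a :: P) (b :: Q)
  | both {a b P Q} (h : R a b) (hc : Coupling R P Q) : Coupling R (a :: P) (b :: Q)

namespace Coupling

variable {α β α' β' : Type*} {R : α → β → Prop}

theorem ne_nil_left {P : List α} {Q : List β} (h : Coupling R P Q) : P ≠ [] := by
  cases h <;> simp

theorem ne_nil_right {P : List α} {Q : List β} (h : Coupling R P Q) : Q ≠ [] := by
  cases h <;> simp

/-- The last pair of one coupling and the first pair of the other are joined by a step of both
lists. -/
theorem append {P P' : List α} {Q Q' : List β} (h : Coupling R P Q) (h' : Coupling R P' Q') :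
    Coupling R (P ++ P') (Q ++ Q') := by
  induction h with
  | single h => exact .both h h'
  | left h _ ih => exact .left h ih
  | right h _ ih => exact .right h ih
  | both h _ ih => exact .both h ih

theorem singleton_left {a : α} {Q : List β} (hQ : Q ≠ []) (h : ∀ b ∈ Q, R a b) :
    Coupling R [a] Q := by
  induction Q with
  | nil => exact absurd rfl hQ
  | cons b Q ih =>
    rcases eq_or_ne Q [] with rfl | hne
    · exact .single (h b (by simp))
    · exact .right (h b (by simp)) (ih hne fun c hc => h c (by simp [hc]))

theorem singleton_right {b : β} {P : List α} (hP : P ≠ []) (h : ∀ a ∈ P, R a b) :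
    Coupling R P [b] := by
  induction P with
  | nil => exact absurd rfl hP
  | cons a P ih =>
    rcases eq_or_ne P [] with rfl | hne
    · exact .single (h a (by simp))
    · exact .left (h a (by simp)) (ih hne fun c hc => h c (by simp [hc]))

/-- First the right list advances to `b`, then the left list to its end, then the right list. -/
theorem of_elbow {a : α} {b : β} {P : List α} {Q Q' : List β} (hQ : ∀ c ∈ Q, R a c)
    (hb : ∀ c ∈ a :: P, R c b) (hQ' : ∀ e ∈ (a :: P).getLast?, ∀ c ∈ Q', R e c) :
    Coupling R (a :: P) (Q ++ b :: Q') := by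
  induction Q with
  | cons c Q ih =>
    exact .right (hQ c (by simp)) (ih fun x hx => hQ x (by simp [hx]))
  | nil =>
    clear hQ
    induction P generalizing a with
    | nil =>
      refine singleton_left (by simp) ?_
      intro c hc
      rcases List.mem_cons.1 hc with rfl | hc
      · exact hb a (by simp)
      · exact hQ' a (by simp) c hc
    | cons p P ih =>
      refine .left (hb a (by simp)) (ih (fun c hc => hb c (by simp at hc ⊢; tauto)) ?_)
      intro e he
      exact hQ' e (by rwa [List.getLast?_cons_cons])

/-- This pulls a coupling of vertices back to positions, which remember their place in the encoding.
-/
theorem of_map {f : α' → α} {g : β' → β} {P' : List α'} {Q' : List β'}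
    (h : Coupling R (P'.map f) (Q'.map g)) : Coupling (fun x y => R (f x) (g y)) P' Q' := by
  generalize hP : P'.map f = P at h
  generalize hQ : Q'.map g = Q at h
  induction h generalizing P' Q' with
  | single h =>
    obtain ⟨x, P', rfl, rfl, hP'⟩ := List.map_eq_cons_iff.1 hP
    obtain ⟨y, Q', rfl, rfl, hQ'⟩ := List.map_eq_cons_iff.1 hQ
    rw [List.map_eq_nil_iff] at hP' hQ'
    subst hP' hQ'
    exact .single h
  | left h _ ih =>
    obtain ⟨x, P', rfl, rfl, hP'⟩ := List.map_eq_cons_iff.1 hP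
    obtain ⟨y, Q', rfl, rfl, hQ'⟩ := List.map_eq_cons_iff.1 hQ
    exact .left h (ih hP' hQ)
  | right h _ ih =>
    obtain ⟨x, P', rfl, rfl, hP'⟩ := List.map_eq_cons_iff.1 hP
    obtain ⟨y, Q', rfl, rfl, hQ'⟩ := List.map_eq_cons_iff.1 hQ
    exact .right h (ih hP hQ')
  | both h _ ih =>
    obtain ⟨x, P', rfl, rfl, hP'⟩ := List.map_eq_cons_iff.1 hP
    obtain ⟨y, Q', rfl, rfl, hQ'⟩ := List.map_eq_cons_iff.1 hQ
    exact .both h (ih hP' hQ')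

/-- The steps of a traversal. -/
def Step {n m : ℕ} (p q : Fin n × Fin m) : Prop :=
  ((q.1 : ℕ) = p.1 ∨ (q.1 : ℕ) = p.1 + 1) ∧ ((q.2 : ℕ) = p.2 ∨ (q.2 : ℕ) = p.2 + 1)

/-- A coupling recurses on suffixes, so the path has to be built from an arbitrary pair of indices,
with the suffixes expressed by `drop`. -/
theorem exists_path {P : List α} {Q : List β} {P₀ : List α} {Q₀ : List β}
    (h : Coupling R P₀ Q₀) : ∀ (i : Fin P.length) (j : Fin Q.length),
    P₀ = P.drop i → Q₀ = Q.drop j → ∃ F : List (Fin P.length × Fin Q.length),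
      ((i, j) :: F).IsChain Step ∧
      (∀ p ∈ ((i, j) :: F).getLast?, (p.1 : ℕ) + 1 = P.length ∧ (p.2 : ℕ) + 1 = Q.length) ∧
      ∀ p ∈ (i, j) :: F, R (P.get p.1) (Q.get p.2) := by
  have consP : ∀ (i : Fin P.length) a L, a :: L = P.drop i → P.get i = a ∧ L = P.drop (i + 1) := by
    intro i a L h
    rw [List.drop_eq_getElem_cons i.2] at h
    simp only [List.cons.injEq] at h
    exact ⟨h.1.symm, h.2⟩
  have consQ : ∀ (i : Fin Q.length) a L, a :: L = Q.drop i → Q.get i = a ∧ L = Q.drop (i + 1) := by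
    intro i a L h
    rw [List.drop_eq_getElem_cons i.2] at h
    simp only [List.cons.injEq] at h
    exact ⟨h.1.symm, h.2⟩
  induction h with
  | single h =>
    intro i j hP hQ
    obtain ⟨h1, h2⟩ := consP i _ _ hP
    obtain ⟨h3, h4⟩ := consQ j _ _ hQ
    have h5 := List.drop_eq_nil_iff.1 h2.symm
    have h6 := List.drop_eq_nil_iff.1 h4.symm
    refine ⟨[], by simp, ?_, ?_⟩
    · simp; omega
    · intro p hp
      obtain rfl := List.mem_singleton.1 hp
      simpa only [h1, h3] using h
  | left h hc ih =>
    intro i j hP hQ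
    obtain ⟨h1, h2⟩ := consP i _ _ hP
    obtain ⟨h3, h4⟩ := consQ j _ _ hQ
    have hne := hc.ne_nil_left
    have hi : (i : ℕ) + 1 < P.length := by
      by_contra hcon
      exact hne (h2.trans (List.drop_eq_nil_iff.2 (by omega)))
    obtain ⟨F, hF1, hF2, hF3⟩ := ih ⟨i + 1, hi⟩ j h2 hQ
    refine ⟨_ :: F, List.isChain_cons_cons.2 ⟨by simp [Step], hF1⟩, ?_, ?_⟩
    · rwa [List.getLast?_cons_cons]
    · rw [List.forall_mem_cons]
      exact ⟨by simpa only [h1, h3] using h, hF3⟩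
  | right h hc ih =>
    intro i j hP hQ
    obtain ⟨h1, h2⟩ := consP i _ _ hP
    obtain ⟨h3, h4⟩ := consQ j _ _ hQ
    have hne := hc.ne_nil_right
    have hj : (j : ℕ) + 1 < Q.length := by
      by_contra hcon
      exact hne (h4.trans (List.drop_eq_nil_iff.2 (by omega)))
    obtain ⟨F, hF1, hF2, hF3⟩ := ih i ⟨j + 1, hj⟩ hP h4
    refine ⟨_ :: F, List.isChain_cons_cons.2 ⟨by simp [Step], hF1⟩, ?_, ?_⟩
    · rwa [List.getLast?_cons_cons]
    · rw [List.forall_mem_cons]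
      exact ⟨by simpa only [h1, h3] using h, hF3⟩
  | both h hc ih =>
    intro i j hP hQ
    obtain ⟨h1, h2⟩ := consP i _ _ hP
    obtain ⟨h3, h4⟩ := consQ j _ _ hQ
    have hne := hc.ne_nil_left
    have hne' := hc.ne_nil_right
    have hi : (i : ℕ) + 1 < P.length := by
      by_contra hcon
      exact hne (h2.trans (List.drop_eq_nil_iff.2 (by omega)))
    have hj : (j : ℕ) + 1 < Q.length := by
      by_contra hcon
      exact hne' (h4.trans (List.drop_eq_nil_iff.2 (by omega)))
    obtain ⟨F, hF1, hF2, hF3⟩ := ih ⟨i + 1, hi⟩ ⟨j + 1, hj⟩ h2 h4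
    refine ⟨_ :: F, List.isChain_cons_cons.2 ⟨by simp [Step], hF1⟩, ?_, ?_⟩
    · rwa [List.getLast?_cons_cons]
    · rw [List.forall_mem_cons]
      exact ⟨by simpa only [h1, h3] using h, hF3⟩

theorem of_path {P : List α} {Q : List β} (F : List (Fin P.length × Fin Q.length)) :
    ∀ (i : Fin P.length) (j : Fin Q.length), ((i, j) :: F).IsChain Step →
      (∀ p ∈ ((i, j) :: F).getLast?, (p.1 : ℕ) + 1 = P.length ∧ (p.2 : ℕ) + 1 = Q.length) →
      (∀ p ∈ (i, j) :: F, R (P.get p.1) (Q.get p.2)) →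
      Coupling R (P.drop i) (Q.drop j) := by
  induction F with
  | nil =>
    intro i j _ h2 h3
    obtain ⟨h4, h5⟩ := h2 (i, j) (by simp)
    have h6 := h3 (i, j) (by simp)
    rw [List.drop_eq_getElem_cons i.2, List.drop_eq_getElem_cons j.2,
      List.drop_eq_nil_of_le (by simpa using h4.ge), List.drop_eq_nil_of_le (by simpa using h5.ge)]
    exact .single h6
  | cons p F ih =>
    intro i j h1 h2 h3
    obtain ⟨k, l⟩ := p
    obtain ⟨⟨hi, hj⟩, hch⟩ := List.isChain_cons_cons.1 h1
    have h6 : R P[i] Q[j] := h3 (i, j) (by simp)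
    have := ih k l hch (by rwa [List.getLast?_cons_cons] at h2)
      (fun p hp => h3 p (List.mem_cons_of_mem _ hp))
    simp only at hi hj
    rw [List.drop_eq_getElem_cons i.2, List.drop_eq_getElem_cons j.2]
    rcases hi with hi | hi <;> rcases hj with hj | hj <;> rw [hi, hj] at this
    -- A traversal may repeat a pair; such a step adds nothing to the coupling.
    · rwa [List.drop_eq_getElem_cons i.2, List.drop_eq_getElem_cons j.2] at this
    · rw [List.drop_eq_getElem_cons i.2] at this
      exact .right h6 this
    · rw [List.drop_eq_getElem_cons j.2] at this
      exact .left h6 this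
    · exact .both h6 this

theorem iff_exists_isTraversal {P : List α} {Q : List β} :
    Coupling R P Q ↔ ∃ F : List (Fin P.length × Fin Q.length),
      IsTraversal P.length Q.length F ∧ ∀ p ∈ F, R (P.get p.1) (Q.get p.2) := by
  constructor
  · intro h
    have hP := List.length_pos_iff.2 h.ne_nil_left
    have hQ := List.length_pos_iff.2 h.ne_nil_right
    obtain ⟨F, hF1, hF2, hF3⟩ := h.exists_path (P := P) (Q := Q) ⟨0, hP⟩ ⟨0, hQ⟩ rfl rfl
    exact ⟨_, ⟨by simp, by simp, hF2, hF1⟩, hF3⟩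
  · rintro ⟨F, ⟨h1, h2, h3, h4⟩, h5⟩
    obtain _ | ⟨⟨i, j⟩, F⟩ := F
    · exact absurd rfl h1
    · obtain ⟨hi, hj⟩ := h2 (i, j) (by simp)
      have := of_path F i j h4 h3 h5
      simp only at hi hj
      rwa [hi, hj] at this

end Coupling

/-! ### The minimum over traversals as a coupling -/

theorem List.foldr_max_le_iff {l : List ℝ} {c : ℝ} (hc : 0 ≤ c) :
    l.foldr max 0 ≤ c ↔ ∀ x ∈ l, x ≤ c := by
  induction l with
  | nil => simpa using hc
  | cons a l ih => simp [ih]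

theorem List.foldr_max_mem (l : List ℝ) : l.foldr max 0 ∈ 0 :: l := by
  induction l with
  | nil => simp
  | cons a l ih =>
    rw [List.foldr_cons]
    rcases max_choice a (l.foldr max 0) with h | h <;> rw [h]
    · simp
    · simp only [List.mem_cons] at ih ⊢; tauto

theorem traversalCost_le_iff {V : Type*} {G : SimpleGraph V} {ℓ : ℝ} {P Q : List V}
    {F : List (Fin P.length × Fin Q.length)} {c : ℝ} (hc : 0 ≤ c) :
    traversalCost G ℓ P Q F ≤ c ↔ ∀ p ∈ F, ℓ * (G.dist (P.get p.1) (Q.get p.2) : ℝ) ≤ c := by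
  rw [traversalCost, List.foldr_max_le_iff hc, List.forall_mem_map]

/-- Costs are distances between vertices, so there are finitely many of them and the infimum is
attained. -/
theorem discreteFrechet_le_iff {V : Type*} [Finite V] {G : SimpleGraph V} {ℓ : ℝ}
    {P Q : List V} (hP : P ≠ []) (hQ : Q ≠ []) {c : ℝ} (hc : 0 ≤ c) :
    discreteFrechet G ℓ P Q ≤ c ↔ Coupling (fun u v => ℓ * (G.dist u v : ℝ) ≤ c) P Q := by
  set S := {c : ℝ | ∃ F : List (Fin P.length × Fin Q.length),
    IsTraversal P.length Q.length F ∧ c = traversalCost G ℓ P Q F} with hS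
  have hfin : S.Finite := by
    -- The extra `0` is the initial value of the maximum in the cost.
    refine ((Set.finite_range fun p : V × V => ℓ * (G.dist p.1 p.2 : ℝ)).insert 0).subset ?_
    rintro _ ⟨F, -, rfl⟩
    have := List.foldr_max_mem (F.map fun p => ℓ * (G.dist (P.get p.1) (Q.get p.2) : ℝ))
    simp only [List.mem_cons, List.mem_map] at this
    rcases this with h | ⟨p, -, h⟩
    · exact Or.inl h
    · exact Or.inr ⟨(P.get p.1, Q.get p.2), h⟩
  have hne : S.Nonempty := by
    obtain ⟨a, P', rfl⟩ := List.exists_cons_of_ne_nil hP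
    obtain ⟨b, Q', rfl⟩ := List.exists_cons_of_ne_nil hQ
    have : Coupling (fun _ _ => True) (a :: P') ([] ++ b :: Q') :=
      Coupling.of_elbow (by simp) (by simp) (by simp)
    obtain ⟨F, hF, -⟩ := Coupling.iff_exists_isTraversal.1 this
    exact ⟨_, F, hF, rfl⟩
  rw [Coupling.iff_exists_isTraversal]
  constructor
  · intro h
    obtain ⟨F, hF, hF'⟩ := hne.csInf_mem hfin
    exact ⟨F, hF, (traversalCost_le_iff hc).1 (hF' ▸ h)⟩
  · rintro ⟨F, hF, hF'⟩
    exact (csInf_le hfin.bddBelow ⟨F, hF, rfl⟩).trans ((traversalCost_le_iff hc).2 hF')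

/-- Being matchable at hop distance at most `19`. -/
def Near (u v : Fin 50) : Prop := gadgetDist u v ≤ 19

instance : DecidableRel Near := fun u v => inferInstanceAs (Decidable (gadgetDist u v ≤ 19))

theorem discreteFrechet_gadgetGraph_le_iff {ℓ : ℝ} (hℓ : 0 < ℓ) {P Q : List (Fin 50)} (hP : P ≠ [])
    (hQ : Q ≠ []) (k : ℕ) :
    discreteFrechet gadgetGraph ℓ P Q ≤ ℓ * k ↔
      Coupling (fun u v : Fin 50 => gadgetDist u v ≤ k) P Q := by
  rw [discreteFrechet_le_iff hP hQ (by positivity)]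
  simp only [gadgetGraph_dist, mul_le_mul_iff_right₀ hℓ, Nat.cast_le]

/-! ### Walks that encode lists of bit vectors -/

/-- `x, y, x, y, …`, of the given length. -/
def alternating {α : Type*} (x y : α) : ℕ → List α
  | 0 => []
  | r + 1 => x :: alternating y x r

theorem length_alternating {α : Type*} (x y : α) (r : ℕ) : (alternating x y r).length = r := by
  induction r generalizing x y with
  | zero => rfl
  | succ r ih => simp [alternating, ih]

theorem mem_alternating {α : Type*} {x y z : α} {r : ℕ} (h : z ∈ alternating x y r) :
    z = x ∨ z = y := by
  induction r generalizing x y with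
  | zero => simp [alternating] at h
  | succ r ih =>
    rcases List.mem_cons.1 h with h | h
    · exact Or.inl h
    · exact (ih h).symm

theorem map_alternating {α β : Type*} (f : α → β) (x y : α) (r : ℕ) :
    (alternating x y r).map f = alternating (f x) (f y) r := by
  induction r generalizing x y with
  | zero => rfl
  | succ r ih => simp [alternating, ih]

/-- The pieces from which the walk of a list of vectors is put together. -/
structure WalkGadget (α : Type*) where
  init : List α
  pre : List α
  blk : Bool → List α
  post : List α
  fin : List α
  pad₀ : α
  pad₁ : α

namespace WalkGadget

variable {α β : Type*}

def map (f : α → β) (T : WalkGadget α) : WalkGadget β where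
  init := T.init.map f
  pre := T.pre.map f
  blk x := (T.blk x).map f
  post := T.post.map f
  fin := T.fin.map f
  pad₀ := f T.pad₀
  pad₁ := f T.pad₁

def vec (T : WalkGadget α) (a : List Bool) : List α :=
  T.pre ++ a.flatMap T.blk ++ T.post

/-- The walk of a list of vectors, followed by `r` padding vertices. -/
def walk (T : WalkGadget α) (A : List (List Bool)) (r : ℕ) : List α :=
  T.init ++ A.flatMap T.vec ++ T.fin ++ alternating T.pad₀ T.pad₁ r

theorem map_vec (f : α → β) (T : WalkGadget α) (a : List Bool) :
    (T.vec a).map f = (T.map f).vec a := by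
  simp only [vec, map, List.map_append, List.map_flatMap]

theorem map_walk (f : α → β) (T : WalkGadget α) (A : List (List Bool)) (r : ℕ) :
    (T.walk A r).map f = (T.map f).walk A r := by
  simp only [walk, List.map_append, List.map_flatMap, map_vec, map_alternating]
  simp only [map]

end WalkGadget

/-- The positions of the first walk within its pieces. -/
def codes₁ : WalkGadget ℕ where
  init := []
  pre := [0, 1, 2, 3, 4, 5, 6, 7, 8, 9, 10, 11, 12]
  blk x := if x then [19, 20, 21, 22, 23, 24] else [13, 14, 15, 16, 17, 18]
  post := [25, 26, 27, 28, 29]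
  fin := [30]
  pad₀ := 31
  pad₁ := 32

/-- A vertex may occur several times in the pieces: 10 has the codes 5, 13, 15, 19, 21 and 25.
Soundness depends on which occurrence is meant. -/
def vertex₁ (c : ℕ) : Fin 50 :=
  [5, 6, 7, 8, 9, 10, 11, 12, 13, 14, 13, 12, 11, 10, 9, 10, 11, 12, 11, 10, 40, 10, 11, 12, 11,
    10, 9, 8, 7, 6, 5, 6, 5].getD c 0

/-- The positions of the second walk within its pieces. -/
def codes₂ : WalkGadget ℕ where
  init := [0, 1, 2, 3, 4, 5, 6, 7, 8, 9, 10]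
  pre := [11, 12, 13, 14, 15]
  blk x := if x then [22, 23, 24, 25, 26, 27] else [16, 17, 18, 19, 20, 21]
  post := [28, 29, 30, 31, 32]
  fin := [33, 34, 35, 36, 37, 38, 39, 40, 41, 42, 43, 44, 45, 46, 47, 48, 49, 50, 51, 52]
  pad₀ := 53
  pad₁ := 54

def vertex₂ (c : ℕ) : Fin 50 :=
  [35, 34, 33, 32, 31, 30, 29, 46, 47, 48, 49, 48, 47, 46, 29, 30, 31, 32, 31, 30, 29, 30, 31, 41,
    31, 30, 29, 30, 31, 30, 29, 46, 47, 48, 47, 46, 29, 30, 31, 41, 42, 43, 44, 45, 44, 43, 42, 41,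
    31, 32, 33, 34, 35, 34, 35].getD c 0

/-- A vector starts with a climb from 5 to 14, where the walk can wait for its partner, and ends
with a descent towards 5. A block shows its bit at 9 or 40 and then climbs to 12, which is far from
32 and 41, so that the partner cannot skip a bit meanwhile. -/
def gadget₁ : WalkGadget (Fin 50) where
  init := []
  pre := [5, 6, 7, 8, 9, 10, 11, 12, 13, 14, 13, 12, 11]
  blk x := if x then [10, 40, 10, 11, 12, 11] else [10, 9, 10, 11, 12, 11]
  post := [10, 9, 8, 7, 6]
  fin := [5]
  pad₀ := 6
  pad₁ := 5

/-- The tip 49 in `init` forces the first walk to 14, and the tip 45 in `fin` forces it to 5.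
Between vectors the walk goes only as far as 48, which is still near 5, so a first walk that is done
can let the other vectors pass. A block shows its bit at 32 or 41 and then returns to 29, which is
far from 9 and 40. -/
def gadget₂ : WalkGadget (Fin 50) where
  init := [35, 34, 33, 32, 31, 30, 29, 46, 47, 48, 49]
  pre := [48, 47, 46, 29, 30]
  blk x := if x then [31, 41, 31, 30, 29, 30] else [31, 32, 31, 30, 29, 30]
  post := [31, 30, 29, 46, 47]
  fin := [48, 47, 46, 29, 30, 31, 41, 42, 43, 44, 45, 44, 43, 42, 41, 31, 32, 33, 34, 35]
  pad₀ := 34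
  pad₁ := 35

theorem codes₁_map : codes₁.map vertex₁ = gadget₁ := by
  have : ∀ x, (codes₁.blk x).map vertex₁ = gadget₁.blk x := by decide
  simp only [WalkGadget.map, this]; rfl

theorem codes₂_map : codes₂.map vertex₂ = gadget₂ := by
  have : ∀ x, (codes₂.blk x).map vertex₂ = gadget₂.blk x := by decide
  simp only [WalkGadget.map, this]; rfl

/-! ### The encodings are walks of known length -/

theorem List.isChain_flatMap_append {ι α : Type*} {R : α → α → Prop} {f : ι → List α} {L : List ι}
    {rest : List α} (hrest : rest.IsChain R) (hf : ∀ a ∈ L, (f a).IsChain R)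
    (hfr : ∀ a ∈ L, ∀ x ∈ (f a).getLast?, ∀ y ∈ rest.head?, R x y)
    (hff : ∀ a ∈ L, ∀ b ∈ L, ∀ x ∈ (f a).getLast?, ∀ y ∈ (f b).head?, R x y)
    (hne : ∀ a ∈ L, f a ≠ []) : (L.flatMap f ++ rest).IsChain R := by
  induction L with
  | nil => simpa using hrest
  | cons a L ih =>
    simp only [List.forall_mem_cons] at hf hfr hne hff
    rw [List.flatMap_cons, List.append_assoc, List.isChain_append]
    refine ⟨hf.1, ih hf.2 hfr.2 (fun b hb => (hff.2 b hb).2) hne.2, ?_⟩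
    intro x hx y hy
    cases L with
    | nil => exact hfr.1 x hx y (by simpa using hy)
    | cons b L =>
      refine hff.1.2 b (by simp) x hx y ?_
      obtain ⟨c, l, hl⟩ := List.exists_cons_of_ne_nil (hne.2 b (by simp))
      simpa [hl] using hy

theorem alternating_isChain {α : Type*} {R : α → α → Prop} {x y : α} (hxy : R x y) (hyx : R y x)
    (r : ℕ) : (alternating x y r).IsChain R := by
  induction r generalizing x y with
  | zero => simp [alternating]
  | succ r ih =>
    refine List.isChain_cons.2 ⟨?_, ih hyx hxy⟩
    cases r <;> simp [alternating, hxy]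

theorem alternating_head? {α : Type*} {x y z : α} {r : ℕ} (h : z ∈ (alternating x y r).head?) :
    z = x := by
  cases r <;> simp [alternating] at h; exact h.symm

theorem isVertexWalk_gadget₁ (A : List (List Bool)) (r : ℕ) :
    IsVertexWalk gadgetGraph (gadget₁.walk A r) := by
  constructor
  · simp [WalkGadget.walk, gadget₁]
  have hvec : ∀ a, (gadget₁.vec a).head? = some 5 ∧ (gadget₁.vec a).getLast? = some 6 := by
    intro a
    rw [WalkGadget.vec, List.getLast?_append]
    simp [gadget₁]
  simp only [WalkGadget.walk, List.append_assoc]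
  show ((A.flatMap gadget₁.vec) ++ _).IsChain _
  apply List.isChain_flatMap_append
  · refine List.isChain_append.2 ⟨by simp [gadget₁], alternating_isChain (by decide) (by decide) r, ?_⟩
    intro x hx y hy
    rw [alternating_head? hy]
    simp [gadget₁] at hx; subst hx; decide
  · intro a _
    simp only [WalkGadget.vec, List.append_assoc]
    refine List.isChain_append.2 ⟨by decide, ?_, ?_⟩
    · apply List.isChain_flatMap_append
      · decide
      · intro b hb; clear hb; revert b; decide
      · intro b hb; clear hb; revert b; decide
      · intro b hb c hc; clear hb hc; revert b c; decide
      · intro b hb; clear hb; revert b; decide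
    · intro x hx y hy
      have : y = 10 := by
        cases a with
        | nil => simpa [gadget₁] using hy.symm
        | cons b a => cases b <;> simpa [gadget₁] using hy.symm
      subst this
      simp [gadget₁] at hx; subst hx; decide
  · intro a _ x hx y hy
    rw [(hvec a).2] at hx
    simp [gadget₁] at hx hy; subst hx hy; decide
  · intro a _ b _ x hx y hy
    rw [(hvec a).2] at hx
    rw [(hvec b).1] at hy
    simp at hx hy; subst hx hy; decide
  · intro a _; simp [WalkGadget.vec, gadget₁]

theorem isVertexWalk_gadget₂ (A : List (List Bool)) (r : ℕ) :
    IsVertexWalk gadgetGraph (gadget₂.walk A r) := by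
  constructor
  · simp [WalkGadget.walk, gadget₂]
  have hvec : ∀ a, (gadget₂.vec a).head? = some 48 ∧ (gadget₂.vec a).getLast? = some 47 := by
    intro a
    rw [WalkGadget.vec, List.getLast?_append]
    simp [gadget₂]
  simp only [WalkGadget.walk, List.append_assoc]
  refine List.isChain_append.2 ⟨by decide, ?_, ?_⟩
  · apply List.isChain_flatMap_append
    · refine List.isChain_append.2
        ⟨by decide, alternating_isChain (by decide) (by decide) r, ?_⟩
      intro x hx y hy
      rw [alternating_head? hy]
      simp [gadget₂] at hx; subst hx; decide
    · intro a _
      simp only [WalkGadget.vec, List.append_assoc]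
      refine List.isChain_append.2 ⟨by decide, ?_, ?_⟩
      · apply List.isChain_flatMap_append
        · decide
        · intro b hb; clear hb; revert b; decide
        · intro b hb; clear hb; revert b; decide
        · intro b hb c hc; clear hb hc; revert b c; decide
        · intro b hb; clear hb; revert b; decide
      · intro x hx y hy
        have : y = 31 := by
          cases a with
          | nil => simpa [gadget₂] using hy.symm
          | cons b a => cases b <;> simpa [gadget₂] using hy.symm
        subst this
        simp [gadget₂] at hx; subst hx; decide
    · intro a _ x hx y hy
      rw [(hvec a).2] at hx
      simp [gadget₂] at hx hy; subst hx hy; decide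
    · intro a _ b _ x hx y hy
      rw [(hvec a).2] at hx
      rw [(hvec b).1] at hy
      simp at hx hy; subst hx hy; decide
    · intro a _; simp [WalkGadget.vec, gadget₂]
  · intro x hx y hy
    have : y = 48 := by
      cases A with
      | nil => simpa [gadget₂] using hy.symm
      | cons a A => simpa [WalkGadget.vec, gadget₂] using hy.symm
    subst this
    simp [gadget₂] at hx; subst hx; decide

theorem WalkGadget.length_walk {α : Type*} (T : WalkGadget α) {s l d : ℕ}
    (hs : ∀ x, (T.blk x).length = s) (hl : T.pre.length + T.post.length = l)
    {A : List (List Bool)} (hA : ∀ a ∈ A, a.length = d) (r : ℕ) :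
    (T.walk A r).length = T.init.length + T.fin.length + A.length * (s * d + l) + r := by
  have hvec : ∀ a ∈ A, (T.vec a).length = s * d + l := by
    intro a ha
    simp only [WalkGadget.vec, List.length_append, List.length_flatMap, hs]
    rw [List.map_const', List.sum_replicate, hA a ha, smul_eq_mul, mul_comm]; omega
  simp only [WalkGadget.walk, List.length_append, List.length_flatMap, length_alternating]
  rw [List.map_congr_left hvec, List.map_const', List.sum_replicate, smul_eq_mul]; omega

theorem length_walk_gadget₁ {d : ℕ} {A : List (List Bool)} (hA : ∀ a ∈ A, a.length = d) (r : ℕ) :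
    (gadget₁.walk A r).length = 1 + A.length * (6 * d + 18) + r :=
  gadget₁.length_walk (by decide) rfl hA r

theorem length_walk_gadget₂ {d : ℕ} {A : List (List Bool)} (hA : ∀ a ∈ A, a.length = d) (r : ℕ) :
    (gadget₂.walk A r).length = 31 + A.length * (6 * d + 10) + r :=
  gadget₂.length_walk (by decide) rfl hA r

/-! ### Orthogonal pairs give couplings -/

/-- Orthogonality of bit vectors that are given as lists. -/
def ListOrthogonal (a b : List Bool) : Prop :=
  ∀ i, ¬ (a.getD i false = true ∧ b.getD i false = true)

/-- The walks go through the blocks in lockstep. Only two ones are an obstacle, since then 40 meets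
41. -/
theorem coupling_blocks {P Q : List (Fin 50)} (h : Coupling Near P Q) :
    ∀ {a b : List Bool}, a.length = b.length → ListOrthogonal a b →
      Coupling Near (a.flatMap gadget₁.blk ++ P) (b.flatMap gadget₂.blk ++ Q) := by
  intro a
  induction a with
  | nil =>
    intro b hb _
    obtain rfl : b = [] := List.length_eq_zero_iff.1 hb.symm
    simpa using h
  | cons x a ih =>
    intro b hb ho
    obtain _ | ⟨y, b⟩ := b
    · simp at hb
    have h1 := ih (b := b) (by simpa using hb) (fun i => ho (i + 1))
    have h2 := ho 0
    rw [List.flatMap_cons, List.flatMap_cons, List.append_assoc, List.append_assoc]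
    refine Coupling.append ?_ h1
    cases x <;> cases y
    · exact .both (by decide) (.both (by decide) (.both (by decide) (.both (by decide)
        (.both (by decide) (.single (by decide))))))
    · exact .both (by decide) (.both (by decide) (.both (by decide) (.both (by decide)
        (.both (by decide) (.single (by decide))))))
    · exact .both (by decide) (.both (by decide) (.both (by decide) (.both (by decide)
        (.both (by decide) (.single (by decide))))))
    · simp at h2

theorem mem_vec_gadget₁ {a : List Bool} {v : Fin 50} (h : v ∈ gadget₁.vec a) :
    v ∈ ([5, 6, 7, 8, 9, 10, 11, 12, 13, 14, 40] : List (Fin 50)) := by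
  simp only [WalkGadget.vec, List.mem_append, List.mem_flatMap] at h
  rcases h with (h | ⟨x, -, h⟩) | h
  · revert h; revert v; decide
  · revert h; revert v x; decide
  · revert h; revert v; decide

theorem mem_vec_gadget₂ {a : List Bool} {v : Fin 50} (h : v ∈ gadget₂.vec a) :
    v ∈ ([29, 30, 31, 32, 41, 46, 47, 48] : List (Fin 50)) := by
  simp only [WalkGadget.vec, List.mem_append, List.mem_flatMap] at h
  rcases h with (h | ⟨x, -, h⟩) | h
  · revert h; revert v; decide
  · revert h; revert v x; decide
  · revert h; revert v; decide

/-- The second walk waits at 35 until the first has reached `a`; the first then waits at 14 until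
the second has reached `b`. They pass the two vectors in lockstep. The first walk descends to 5 and
waits there until the second is back at 35. -/
theorem coupling_of_orthogonal {A B : List (List Bool)} {a b : List Bool} (ha : a ∈ A) (hb : b ∈ B)
    (hab : a.length = b.length) (ho : ListOrthogonal a b) (r s : ℕ) :
    Coupling Near (gadget₁.walk A r) (gadget₂.walk B s) := by
  obtain ⟨A₁, A₂, rfl⟩ := List.append_of_mem ha
  obtain ⟨B₁, B₂, rfl⟩ := List.append_of_mem hb
  -- Whether or not more vectors follow, the rest of the first walk starts at 5.
  obtain ⟨rest, hrest, hmem, hlast⟩ : ∃ rest,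
      A₂.flatMap gadget₁.vec ++ ([5] ++ alternating 6 5 r) = 5 :: rest ∧
      (∀ v ∈ 5 :: rest, v ∈ ([5, 6, 7, 8, 9, 10, 11, 12, 13, 14, 40] : List (Fin 50))) ∧
      ∀ v ∈ (5 :: rest).getLast?, v = 5 ∨ v = 6 := by
    obtain ⟨rest, hrest⟩ : ∃ rest,
        A₂.flatMap gadget₁.vec ++ ([5] ++ alternating 6 5 r) = 5 :: rest := by
      cases A₂ <;> simp [WalkGadget.vec, gadget₁]
    refine ⟨rest, hrest, ?_, ?_⟩
    · intro v hv
      rw [← hrest, List.mem_append, List.mem_append, List.mem_flatMap] at hv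
      rcases hv with ⟨a, -, hv⟩ | hv | hv
      · exact mem_vec_gadget₁ hv
      · revert hv; revert v; decide
      · rcases mem_alternating hv with rfl | rfl <;> decide
    · intro v hv
      rw [← hrest, List.getLast?_append, List.getLast?_append] at hv
      rcases h : (alternating (6 : Fin 50) 5 r).getLast? with _ | w
      · rw [h] at hv; simp at hv; exact Or.inl hv.symm
      · rw [h] at hv; simp at hv
        subst hv
        exact (mem_alternating (List.mem_of_getLast? h)).symm
  have hP : gadget₁.walk (A₁ ++ a :: A₂) r =
      (A₁.flatMap gadget₁.vec ++ [5, 6, 7, 8, 9, 10, 11]) ++ ([12] ++ ([13] ++ ([14] ++ ([13, 12] ++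
        ([11] ++ (a.flatMap gadget₁.blk ++ ([10, 9, 8, 7, 6] ++ 5 :: rest))))))) := by
    rw [← hrest]
    simp [WalkGadget.walk, WalkGadget.vec, gadget₁]
  have hQ : gadget₂.walk (B₁ ++ b :: B₂) s =
      [35] ++ ([34, 33] ++ ([32] ++ (([31, 30, 29, 46, 47, 48, 49] ++ (B₁.flatMap gadget₂.vec ++
        [48, 47, 46])) ++ ([29] ++ ([30] ++ (b.flatMap gadget₂.blk ++ ([31] ++
        (([30, 29, 46, 47] ++ (B₂.flatMap gadget₂.vec ++ [48, 47, 46, 29, 30, 31, 41, 42, 43, 44,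
          45, 44, 43, 42, 41, 31, 32, 33, 34])) ++ 35 :: alternating 34 35 s)))))))) := by
    simp [WalkGadget.walk, WalkGadget.vec, gadget₂]
  rw [hP, hQ]
  refine .append ?_ (.append ?_ (.append ?_ (.append ?_ (.append ?_ (.append ?_
    (coupling_blocks (.append ?_ ?_) hab ho))))))
  -- The antipode of 35 is 15, which the first walk never visits.
  · refine .singleton_right (by simp) ?_
    intro v hv
    rw [List.mem_append, List.mem_flatMap] at hv
    rcases hv with ⟨a, -, hv⟩ | hv
    · have := mem_vec_gadget₁ hv
      revert this; clear hv; revert v; decide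
    · revert hv; revert v; decide
  · exact .singleton_left (by decide) (by decide)
  · exact .single (by decide)
  -- At 14 the first walk is near everything the second one visits here, including the tip 49.
  · refine .singleton_left (by simp) ?_
    intro v hv
    rw [List.mem_append, List.mem_append, List.mem_flatMap] at hv
    rcases hv with hv | ⟨a, -, hv⟩ | hv
    · revert hv; revert v; decide
    · have := mem_vec_gadget₂ hv
      revert this; clear hv; revert v; decide
    · revert hv; revert v; decide
  · exact .singleton_right (by decide) (by decide)
  · exact .single (by decide)
  · exact .singleton_right (by decide) (by decide)
  -- At 5 it is near all that remains of the second walk, including 48 and the tip 45. Once the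
  -- second walk is at 35, the first can run to its end.
  · refine .of_elbow ?_ ?_ ?_
    · intro v hv
      rw [List.mem_append, List.mem_append, List.mem_flatMap] at hv
      rcases hv with hv | ⟨a, -, hv⟩ | hv
      · revert hv; revert v; decide
      · have := mem_vec_gadget₂ hv
        revert this; clear hv; revert v; decide
      · revert hv; revert v; decide
    · intro v hv
      have := hmem v hv
      revert this; clear hv; revert v; decide
    · intro v hv w hw
      rcases hlast v hv with rfl | rfl <;> rcases mem_alternating hw with rfl | rfl <;> decide

/-! ### Couplings give orthogonal pairs -/

/-- A position of a walk: its code, the vector to which it belongs, and the number of coordinates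
of the vector that have been completed. -/
structure WalkPos where
  code : ℕ
  vec : List Bool
  idx : ℕ

namespace WalkGadget

def bitPositions (K : WalkGadget ℕ) (a : List Bool) : ℕ → List Bool → List WalkPos
  | k, [] => K.post.map fun c => ⟨c, a, k⟩
  | k, x :: l => (K.blk x).map (fun c => ⟨c, a, k⟩) ++ bitPositions K a (k + 1) l

def vecPositions (K : WalkGadget ℕ) (a : List Bool) : List WalkPos :=
  K.pre.map (fun c => ⟨c, a, 0⟩) ++ K.bitPositions a 0 a

def positions (K : WalkGadget ℕ) (A : List (List Bool)) (r : ℕ) : List WalkPos :=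
  K.init.map (fun c => ⟨c, [], 0⟩) ++ (A.flatMap K.vecPositions ++
    (K.fin.map (fun c => ⟨c, [], 0⟩) ++ (alternating K.pad₀ K.pad₁ r).map fun c => ⟨c, [], 0⟩))

theorem map_code_bitPositions (K : WalkGadget ℕ) (a l : List Bool) (k : ℕ) :
    (K.bitPositions a k l).map WalkPos.code = l.flatMap K.blk ++ K.post := by
  induction l generalizing k with
  | nil => simp [bitPositions, Function.comp_def]
  | cons x l ih => simp [bitPositions, ih, Function.comp_def]

theorem map_code_positions (K : WalkGadget ℕ) (A : List (List Bool)) (r : ℕ) :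
    (K.positions A r).map WalkPos.code = K.walk A r := by
  have : ∀ a, (K.vecPositions a).map WalkPos.code = K.vec a := by
    intro a
    rw [vecPositions, List.map_append, map_code_bitPositions]
    simp [vec, Function.comp_def]
  simp [positions, walk, List.map_flatMap, this, Function.comp_def]

end WalkGadget

/-- The code at which a block starts, if there is a coordinate left, or else the code `post`. -/
def blockEntry (base post : ℕ) (a : List Bool) (k : ℕ) : ℕ :=
  if k < a.length then (if a.getD k false then base + 6 else base) else post

theorem drop_eq_cons {α : Type*} {a l : List α} {x d : α} {k : ℕ} (h : x :: l = a.drop k) :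
    k < a.length ∧ a.getD k d = x ∧ l = a.drop (k + 1) := by
  have hk : k < a.length := by
    by_contra hk
    rw [List.drop_eq_nil_of_le (by omega)] at h
    simp at h
  rw [List.drop_eq_getElem_cons hk, List.cons.injEq] at h
  exact ⟨hk, by rw [List.getD_eq_getElem _ _ hk]; exact h.1.symm, h.2⟩

/-- Only the codes 9 to 25 matter: this is the stretch to which the first walk will be confined. -/
def Next₁ (p q : WalkPos) : Prop :=
  9 ≤ p.code → p.code ≤ 25 → q.vec = p.vec ∧
    if p.code = 12 then q.idx = p.idx ∧ q.code = blockEntry 13 25 p.vec p.idx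
    else if p.code = 18 ∨ p.code = 24 then
      q.idx = p.idx + 1 ∧ q.code = blockEntry 13 25 p.vec (p.idx + 1)
    else q.idx = p.idx ∧ q.code = p.code + 1

def Valid₁ (A : List (List Bool)) (p : WalkPos) : Prop :=
  (p.code ≤ 29 → p.vec ∈ A) ∧ (p.code ≤ 12 → p.idx = 0) ∧
  (13 ≤ p.code → p.code ≤ 18 → p.idx < p.vec.length ∧ p.vec.getD p.idx false = false) ∧
  (19 ≤ p.code → p.code ≤ 24 → p.idx < p.vec.length ∧ p.vec.getD p.idx false = true) ∧
  (25 ≤ p.code → p.code ≤ 29 → p.idx = p.vec.length)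

/-- After the codes 10 and 32 the walk may enter a new vector, so only the following code is
recorded there. -/
def Next₂ (p q : WalkPos) : Prop :=
  10 ≤ p.code → p.code ≤ 42 →
    if p.code = 10 then q.code = 11
    else if p.code = 32 then q.code = 11 ∨ q.code = 33
    else q.vec = p.vec ∧
      if p.code = 15 then q.idx = p.idx ∧ q.code = blockEntry 16 28 p.vec p.idx
      else if p.code = 21 ∨ p.code = 27 then
        q.idx = p.idx + 1 ∧ q.code = blockEntry 16 28 p.vec (p.idx + 1)
      else q.idx = p.idx ∧ q.code = p.code + 1

/-- The condition on the initial codes ensures that the walk cannot avoid code 10, the tip 49. -/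
def Next₂Init (p q : WalkPos) : Prop := Next₂ p q ∧ (p.code ≤ 9 → q.code = p.code + 1)

def Valid₂ (B : List (List Bool)) (p : WalkPos) : Prop :=
  (11 ≤ p.code → p.code ≤ 32 → p.vec ∈ B) ∧
  (p.code ≤ 15 ∨ 33 ≤ p.code → p.idx = 0) ∧ (33 ≤ p.code → p.vec = []) ∧
  (16 ≤ p.code → p.code ≤ 21 → p.idx < p.vec.length ∧ p.vec.getD p.idx false = false) ∧
  (22 ≤ p.code → p.code ≤ 27 → p.idx < p.vec.length ∧ p.vec.getD p.idx false = true) ∧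
  (28 ≤ p.code → p.code ≤ 32 → p.idx = p.vec.length)

theorem head?_bitPositions {K : WalkGadget ℕ} {base post : ℕ}
    (hK : ∀ x, (K.blk x).head? = some (if x then base + 6 else base))
    (hpost : K.post.head? = some post) {a l : List Bool} {k : ℕ} (h : l = a.drop k) :
    (K.bitPositions a k l).head? = some ⟨blockEntry base post a k, a, k⟩ := by
  cases l with
  | nil =>
    have := List.drop_eq_nil_iff.1 h.symm
    rw [WalkGadget.bitPositions, List.head?_map, hpost, blockEntry, if_neg (by omega)]; rfl
  | cons x l =>
    obtain ⟨h1, h2, -⟩ := drop_eq_cons (d := false) h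
    rw [WalkGadget.bitPositions, List.head?_append, List.head?_map, hK, blockEntry, if_pos h1, h2]
    rfl

theorem getLast?_bitPositions {K : WalkGadget ℕ} {c : ℕ} (hpost : K.post.getLast? = some c)
    {a l : List Bool} {k : ℕ} :
    (K.bitPositions a k l).getLast? = some ⟨c, a, k + l.length⟩ := by
  induction l generalizing k with
  | nil => simp [WalkGadget.bitPositions, hpost]
  | cons x l ih =>
    rw [WalkGadget.bitPositions, List.getLast?_append, ih, List.length_cons, add_comm l.length,
      ← add_assoc]; rfl

theorem isChain_bitPositions₁ {a : List Bool} : ∀ {l : List Bool} {k : ℕ}, l = a.drop k →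
    (codes₁.bitPositions a k l).IsChain Next₁ := by
  intro l
  induction l with
  | nil => intro k _; simp [WalkGadget.bitPositions, codes₁, Next₁]
  | cons x l ih =>
    intro k h
    obtain ⟨h1, h2, h3⟩ := drop_eq_cons (d := false) h
    refine List.isChain_append.2 ⟨?_, ih h3, ?_⟩
    · cases x <;> simp [codes₁, Next₁]
    · intro p hp q hq
      rw [head?_bitPositions (base := 13) (post := 25) (by decide) rfl h3] at hq
      cases x <;> simp [codes₁] at hp hq <;> subst hp hq <;> simp [Next₁]

theorem isChain_vecPositions₁ (a : List Bool) : (codes₁.vecPositions a).IsChain Next₁ := by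
  refine List.isChain_append.2 ⟨by simp [codes₁, Next₁], isChain_bitPositions₁ (by simp), ?_⟩
  intro p hp q hq
  rw [head?_bitPositions (base := 13) (post := 25) (by decide) rfl (by simp)] at hq
  simp [codes₁] at hp hq; subst hp hq; simp [Next₁]

theorem isChain_positions₁ (A : List (List Bool)) (r : ℕ) :
    (codes₁.positions A r).IsChain Next₁ := by
  have hlast : ∀ a ∈ A, ∀ p ∈ (codes₁.vecPositions a).getLast?, ∀ q, Next₁ p q := by
    intro a _ p hp q
    rw [WalkGadget.vecPositions, List.getLast?_append,
      getLast?_bitPositions (c := 29) rfl] at hp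
    simp at hp; subst hp; simp [Next₁]
  refine List.isChain_flatMap_append ?_ (fun a _ => isChain_vecPositions₁ a)
    (fun a ha p hp q _ => hlast a ha p hp q) (fun a ha _ _ p hp q _ => hlast a ha p hp q) ?_
  · refine List.isChain_append.2 ⟨by simp [codes₁], ?_, ?_⟩
    · rw [map_alternating]
      exact alternating_isChain (by simp [codes₁, Next₁]) (by simp [codes₁, Next₁]) r
    · intro p hp q _
      simp [codes₁] at hp; subst hp; simp [Next₁]
  · intro a _; simp [WalkGadget.vecPositions, codes₁]

theorem isChain_bitPositions₂ {a : List Bool} : ∀ {l : List Bool} {k : ℕ}, l = a.drop k →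
    (codes₂.bitPositions a k l).IsChain Next₂Init := by
  intro l
  induction l with
  | nil => intro k _; simp [WalkGadget.bitPositions, codes₂, Next₂, Next₂Init]
  | cons x l ih =>
    intro k h
    obtain ⟨h1, h2, h3⟩ := drop_eq_cons (d := false) h
    refine List.isChain_append.2 ⟨?_, ih h3, ?_⟩
    · cases x <;> simp [codes₂, Next₂, Next₂Init]
    · intro p hp q hq
      rw [head?_bitPositions (base := 16) (post := 28) (by decide) rfl h3] at hq
      cases x <;> simp [codes₂] at hp hq <;> subst hp hq <;> simp [Next₂, Next₂Init]

theorem isChain_vecPositions₂ (a : List Bool) : (codes₂.vecPositions a).IsChain Next₂Init := by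
  refine List.isChain_append.2
    ⟨by simp [codes₂, Next₂, Next₂Init], isChain_bitPositions₂ (by simp), ?_⟩
  intro p hp q hq
  rw [head?_bitPositions (base := 16) (post := 28) (by decide) rfl (by simp)] at hq
  simp [codes₂] at hp hq; subst hp hq; simp [Next₂, Next₂Init]

theorem isChain_positions₂ {B : List (List Bool)} (hB : B ≠ []) (r : ℕ) :
    (codes₂.positions B r).IsChain Next₂Init := by
  have hlast : ∀ a ∈ B, ∀ p ∈ (codes₂.vecPositions a).getLast?, ∀ q : WalkPos,
      q.code = 11 ∨ q.code = 33 → Next₂Init p q := by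
    intro a _ p hp q hq
    rw [WalkGadget.vecPositions, List.getLast?_append,
      getLast?_bitPositions (c := 32) rfl] at hp
    simp at hp; subst hp; simpa [Next₂, Next₂Init] using hq
  have hhead : ∀ a, ∀ q ∈ (codes₂.vecPositions a).head?, q.code = 11 := by
    intro a q hq
    simp [WalkGadget.vecPositions, codes₂] at hq; subst hq; rfl
  refine List.isChain_append.2 ⟨by simp [codes₂, Next₂, Next₂Init], ?_, ?_⟩
  · refine List.isChain_flatMap_append ?_ (fun a _ => isChain_vecPositions₂ a) ?_
      (fun a ha b _ p hp q hq => hlast a ha p hp q (Or.inl (hhead b q hq))) ?_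
    · refine List.isChain_append.2 ⟨by simp [codes₂, Next₂, Next₂Init], ?_, ?_⟩
      · rw [map_alternating]
        exact alternating_isChain (by simp [codes₂, Next₂, Next₂Init])
          (by simp [codes₂, Next₂, Next₂Init]) r
      · intro p hp q _
        simp [codes₂] at hp; subst hp; simp [Next₂, Next₂Init]
    · intro a ha p hp q hq
      refine hlast a ha p hp q (Or.inr ?_)
      simp [codes₂] at hq; subst hq; rfl
    · intro a _; simp [WalkGadget.vecPositions, codes₂]
  · intro p hp q hq
    obtain ⟨b, B, rfl⟩ := List.exists_cons_of_ne_nil hB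
    have hq' : q.code = 11 := by
      refine hhead b q ?_
      rw [List.flatMap_cons, List.append_assoc, List.head?_append] at hq
      rcases h : (codes₂.vecPositions b).head? with _ | w
      · simp [WalkGadget.vecPositions, codes₂] at h
      · rw [h] at hq; simpa using hq
    simp [codes₂] at hp; subst hp; simp [Next₂, Next₂Init, hq']

theorem valid_bitPositions₁ {A : List (List Bool)} {a : List Bool} (ha : a ∈ A) :
    ∀ {l : List Bool} {k : ℕ}, l = a.drop k → k ≤ a.length →
      ∀ p ∈ codes₁.bitPositions a k l, Valid₁ A p := by
  intro l
  induction l with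
  | nil =>
    intro k h hk p hp
    have := List.drop_eq_nil_iff.1 h.symm
    obtain ⟨c, hc, rfl⟩ := List.mem_map.1 hp
    have hc' : 25 ≤ c := (by decide : ∀ c ∈ codes₁.post, 25 ≤ c) c hc
    refine ⟨fun _ => ha, ?_, ?_, ?_, ?_⟩ <;> intros <;> simp only at * <;> omega
  | cons x l ih =>
    intro k h hk p hp
    obtain ⟨h1, h2, h3⟩ := drop_eq_cons (d := false) h
    rcases List.mem_append.1 hp with hp | hp
    · obtain ⟨c, hc, rfl⟩ := List.mem_map.1 hp
      have hc' : if x then 19 ≤ c ∧ c ≤ 24 else 13 ≤ c ∧ c ≤ 18 :=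
        (by decide : ∀ x, ∀ c ∈ codes₁.blk x,
          if x then 19 ≤ c ∧ c ≤ 24 else 13 ≤ c ∧ c ≤ 18) x c hc
      cases x <;> simp at hc' <;> refine ⟨fun _ => ha, ?_, ?_, ?_, ?_⟩ <;> intros <;>
        simp only at * <;> first | exact ⟨h1, h2⟩ | omega
    · exact ih h3 h1 p hp

theorem valid_positions₁ (A : List (List Bool)) (r : ℕ) :
    ∀ p ∈ codes₁.positions A r, Valid₁ A p := by
  have hbig : ∀ c : ℕ, 30 ≤ c → Valid₁ A ⟨c, [], 0⟩ := by
    intro c hc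
    refine ⟨?_, ?_, ?_, ?_, ?_⟩ <;> intros <;> simp only at * <;> omega
  intro p hp
  simp only [WalkGadget.positions, List.mem_append, List.mem_map, List.mem_flatMap] at hp
  rcases hp with ⟨c, hc, -⟩ | ⟨a, ha, hp⟩ | ⟨c, hc, rfl⟩ | ⟨c, hc, rfl⟩
  · simp [codes₁] at hc
  · rcases List.mem_append.1 hp with hp | hp
    · obtain ⟨c, hc, rfl⟩ := List.mem_map.1 hp
      have hc' : c ≤ 12 := (by decide : ∀ c ∈ codes₁.pre, c ≤ 12) c hc
      refine ⟨fun _ => ha, ?_, ?_, ?_, ?_⟩ <;> intros <;> simp only at * <;> omega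
    · exact valid_bitPositions₁ ha (by simp) (Nat.zero_le _) p hp
  · exact hbig c (by simp [codes₁] at hc; omega)
  · exact hbig c (by rcases mem_alternating hc with rfl | rfl <;> decide)

theorem valid_bitPositions₂ {B : List (List Bool)} {a : List Bool} (ha : a ∈ B) :
    ∀ {l : List Bool} {k : ℕ}, l = a.drop k → k ≤ a.length →
      ∀ p ∈ codes₂.bitPositions a k l, Valid₂ B p := by
  intro l
  induction l with
  | nil =>
    intro k h hk p hp
    have := List.drop_eq_nil_iff.1 h.symm
    obtain ⟨c, hc, rfl⟩ := List.mem_map.1 hp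
    have hc' : 28 ≤ c ∧ c ≤ 32 := (by decide : ∀ c ∈ codes₂.post, 28 ≤ c ∧ c ≤ 32) c hc
    refine ⟨fun _ _ => ha, ?_, ?_, ?_, ?_, ?_⟩ <;> intros <;> simp only at * <;> omega
  | cons x l ih =>
    intro k h hk p hp
    obtain ⟨h1, h2, h3⟩ := drop_eq_cons (d := false) h
    rcases List.mem_append.1 hp with hp | hp
    · obtain ⟨c, hc, rfl⟩ := List.mem_map.1 hp
      have hc' : if x then 22 ≤ c ∧ c ≤ 27 else 16 ≤ c ∧ c ≤ 21 :=
        (by decide : ∀ x, ∀ c ∈ codes₂.blk x,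
          if x then 22 ≤ c ∧ c ≤ 27 else 16 ≤ c ∧ c ≤ 21) x c hc
      cases x <;> simp at hc' <;> refine ⟨fun _ _ => ha, ?_, ?_, ?_, ?_, ?_⟩ <;> intros <;>
        simp only at * <;> first | exact ⟨h1, h2⟩ | omega
    · exact ih h3 h1 p hp

theorem valid_positions₂ (B : List (List Bool)) (r : ℕ) :
    ∀ p ∈ codes₂.positions B r, Valid₂ B p := by
  have hbig : ∀ c : ℕ, c ≤ 10 ∨ 33 ≤ c → Valid₂ B ⟨c, [], 0⟩ := by
    intro c hc
    refine ⟨?_, fun _ => rfl, fun _ => rfl, ?_, ?_, ?_⟩ <;> intros <;> simp only at * <;> omega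
  intro p hp
  simp only [WalkGadget.positions, List.mem_append, List.mem_map, List.mem_flatMap] at hp
  rcases hp with ⟨c, hc, rfl⟩ | ⟨a, ha, hp⟩ | ⟨c, hc, rfl⟩ | ⟨c, hc, rfl⟩
  · exact hbig c (by simp [codes₂] at hc; omega)
  · rcases List.mem_append.1 hp with hp | hp
    · obtain ⟨c, hc, rfl⟩ := List.mem_map.1 hp
      have hc' : 11 ≤ c ∧ c ≤ 15 := (by decide : ∀ c ∈ codes₂.pre, 11 ≤ c ∧ c ≤ 15) c hc
      refine ⟨fun _ _ => ha, ?_, ?_, ?_, ?_, ?_⟩ <;> intros <;> simp only at * <;>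
        first | rfl | omega
    · exact valid_bitPositions₂ ha (by simp) (Nat.zero_le _) p hp
  · exact hbig c (by simp [codes₂] at hc; omega)
  · exact hbig c (by rcases mem_alternating hc with rfl | rfl <;> decide)

/-! ### Counting crossings, and the local check -/

/-- Whether the first position lies before the second one along the cycle. -/
def isBefore (c₁ c₂ : ℕ) : Bool :=
  gadgetBase (vertex₁ c₁) + 20 < gadgetBase (vertex₂ c₂)

def isNear (c₁ c₂ : ℕ) : Bool := gadgetDist (vertex₁ c₁) (vertex₂ c₂) ≤ 19

/-- Added to the index of the coordinate, the number of changes to `isBefore` that the walk has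
gone through in the vector. -/
def blockShift (o : ℕ) (lt : Bool) : ℕ :=
  if lt then (if o = 5 then 1 else 0) else if o ≤ 1 then 0 else 1

def shift₁ (lt : Bool) (c : ℕ) : ℕ :=
  if c ≤ 12 then 0 else if c ≤ 24 then blockShift ((c - 13) % 6) lt else 0

/-- The final piece of a vector begins like another block: from code 29 on, a position on the far
side has crossed back once more. -/
def shift₂ (lt : Bool) (c : ℕ) : ℕ :=
  if c ≤ 15 then 0 else if c ≤ 27 then blockShift ((c - 16) % 6) lt
  else if c = 28 ∨ 33 ≤ c ∨ lt then 0 else 1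

/-- Whether the bit of the current block has been visited. -/
def visited (c : ℕ) : ℕ := if 13 ≤ c ∧ c ≤ 24 ∧ 1 ≤ (c - 13) % 6 then 1 else 0

def succCodes₁ (c : ℕ) : List (ℕ × ℕ) :=
  if c = 12 then [(13, 0), (19, 0), (25, 0)]
  else if c = 18 ∨ c = 24 then [(13, 1), (19, 1), (25, 1)] else [(c + 1, 0)]

def succCodes₂ (c : ℕ) : List (ℕ × ℕ) :=
  if c = 15 then [(16, 0), (22, 0), (28, 0)]
  else if c = 21 ∨ c = 27 then [(16, 1), (22, 1), (28, 1)]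
  else if c = 32 then [(11, 0), (33, 0)] else [(c + 1, 0)]

/-- The local properties of joint steps of the two walks. -/
def stepCheck (c₁ c₂ : ℕ) (p q : ℕ × ℕ) : Bool :=
  let lt := isBefore c₁ c₂
  let lt' := isBefore p.1 q.1
  q.1 ≤ 42 && (p.1 ≤ 10 || (
    c₂ != 10 && (c₂ != 32 || q.1 == 32) && (p.1 ≤ 25 || lt') && p.1 ≤ 26 &&
    (12 < c₁ || (shift₁ lt' p.1 == 0 && p.2 == 0 && visited p.1 == 0)) &&
    (c₁ ≤ 12 || decide (shift₂ lt c₂ + p.2 + shift₁ lt' p.1 ≤ q.2 + shift₂ lt' q.1 + shift₁ lt c₁)) &&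
    (c₁ ≤ 12 || decide (visited p.1 + p.2 ≤ visited c₁) || (c₁ == 13 && p.1 == 14) ||
      (c₁ == 19 && p.1 == 20 && q.1 == 17 && lt' && p.2 == 0))))

/-- Nearness, sides and shifts depend only on the codes, so the invariance can be checked on
finitely many pairs of codes: 9 to 25 in the first walk and 10 to 42 in the second. Far pairs cannot
occur, and the case of code 25 on the side `isBefore` is excluded by `Confined`. -/
theorem stepCheck_eq_true : ∀ c₁ ∈ List.range' 9 17, ∀ c₂ ∈ List.range' 10 33,
    ∀ p ∈ (c₁, 0) :: succCodes₁ c₁, ∀ q ∈ (c₂, 0) :: succCodes₂ c₂,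
    (!isNear c₁ c₂ || (c₁ == 25 && isBefore c₁ c₂) || !isNear p.1 q.1 ||
      stepCheck c₁ c₂ p q) = true := by
  decide +kernel

/-- What holds at all reachable pairs of positions if no pair of vectors is orthogonal: once the
second walk has entered its first vector, the first walk is confined to one vector, in which it
is not ahead of the second walk. -/
def Confined (p q : WalkPos) : Prop :=
  q.code ≤ 9 ∨ (9 ≤ p.code ∧ p.code ≤ 25 ∧ 10 ≤ q.code ∧ q.code ≤ 42 ∧
    ¬ (p.code = 25 ∧ isBefore p.code q.code = true) ∧
    p.idx + shift₁ (isBefore p.code q.code) p.code ≤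
      q.idx + shift₂ (isBefore p.code q.code) q.code ∧
    (p.idx + shift₁ (isBefore p.code q.code) p.code =
      q.idx + shift₂ (isBefore p.code q.code) q.code →
      ∀ i < p.idx + visited p.code, ¬ (p.vec.getD i false = true ∧ q.vec.getD i false = true)))

theorem blockEntry_mem {base post : ℕ} (a : List Bool) (k : ℕ) :
    blockEntry base post a k = base ∨ blockEntry base post a k = base + 6 ∨
      blockEntry base post a k = post := by
  unfold blockEntry; split_ifs <;> simp

theorem Next₁.mem_succCodes {p q : WalkPos} (h : Next₁ p q) (h1 : 9 ≤ p.code) (h2 : p.code ≤ 25) :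
    q.vec = p.vec ∧ ∃ Δ, (q.code, Δ) ∈ succCodes₁ p.code ∧ q.idx = p.idx + Δ := by
  obtain ⟨h3, h4⟩ := h h1 h2
  refine ⟨h3, ?_⟩
  unfold succCodes₁
  split_ifs at h4 ⊢ with h5 h6
  · refine ⟨0, ?_, h4.1⟩
    rcases blockEntry_mem (base := 13) (post := 25) p.vec p.idx with h | h | h <;>
      simp [h4.2, h]
  · refine ⟨1, ?_, h4.1⟩
    rcases blockEntry_mem (base := 13) (post := 25) p.vec (p.idx + 1) with h | h | h <;>
      simp [h4.2, h]
  · exact ⟨0, by simp [h4.2], h4.1⟩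

theorem Next₂.mem_succCodes {p q : WalkPos} (h : Next₂ p q) (h1 : 10 ≤ p.code)
    (h2 : p.code ≤ 42) : ∃ Δ, (q.code, Δ) ∈ succCodes₂ p.code ∧
      (p.code ≠ 10 → p.code ≠ 32 → q.vec = p.vec ∧ q.idx = p.idx + Δ) := by
  have h3 := h h1 h2
  unfold succCodes₂
  by_cases h10 : p.code = 10
  · rw [if_pos h10] at h3
    exact ⟨0, by simp [h3, h10], fun h => absurd h10 h⟩
  rw [if_neg h10] at h3
  by_cases h32 : p.code = 32
  · rw [if_pos h32] at h3
    exact ⟨0, by simp [h3, h32], fun _ h => absurd h32 h⟩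
  rw [if_neg h32] at h3
  obtain ⟨h3, h4⟩ := h3
  split_ifs at h4 ⊢ with h5 h6
  · refine ⟨0, ?_, fun _ _ => ⟨h3, h4.1⟩⟩
    rcases blockEntry_mem (base := 16) (post := 28) p.vec p.idx with h | h | h <;>
      simp [h4.2, h]
  · refine ⟨1, ?_, fun _ _ => ⟨h3, h4.1⟩⟩
    rcases blockEntry_mem (base := 16) (post := 28) p.vec (p.idx + 1) with h | h | h <;>
      simp [h4.2, h]
  · exact ⟨0, by simp [h4.2], fun _ _ => ⟨h3, h4.1⟩⟩

theorem blockShift_le (o : ℕ) (lt : Bool) : blockShift o lt ≤ 1 := by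
  unfold blockShift; split_ifs <;> omega

/-- Code 10 is the tip 49. It is near no vertex of the first walk except 14, which occurs only as
code 9. -/
theorem isNear_ten : ∀ c < 33, isNear c 10 = true → c = 9 := by decide +kernel

/-! ### The confinement invariant -/

section

variable {A B : List (List Bool)} {d : ℕ}

/-- A position after the last coordinate cannot be reached before the second walk. -/
theorem exists_orthogonal_of_end {p q : WalkPos} (hd : 0 < d) (hA : ∀ a ∈ A, a.length = d)
    (hB : ∀ b ∈ B, b.length = d) (hp : Valid₁ A p) (hq : Valid₂ B q) (h1 : 25 ≤ p.code)
    (h2 : p.code ≤ 29)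
    (hle : p.idx + shift₁ true p.code ≤ q.idx + shift₂ true q.code)
    (hpre : p.idx + shift₁ true p.code = q.idx + shift₂ true q.code →
      ∀ i < p.idx + visited p.code, ¬ (p.vec.getD i false = true ∧ q.vec.getD i false = true)) :
    ∃ a ∈ A, ∃ b ∈ B, ListOrthogonal a b := by
  obtain ⟨p1, -, -, -, p5⟩ := hp
  obtain ⟨q1, q2, -, q4, q5, q6⟩ := hq
  have hpA := p1 h2
  have hidx : p.idx = d := (p5 h1 h2).trans (hA _ hpA)
  have e1 : shift₁ true p.code = 0 := by
    unfold shift₁; rw [if_neg (by omega), if_neg (by omega)]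
  -- Outside its vectors the second walk has count `0`, less than the `d` crossings that the first
  -- has made.
  have hcode : 11 ≤ q.code ∧ q.code ≤ 32 := by
    by_contra hcon
    have e2 : shift₂ true q.code = 0 := by
      unfold shift₂; split_ifs <;> omega
    have := q2 (by omega)
    omega
  have hqB := q1 hcode.1 hcode.2
  have hqd := hB _ hqB
  -- On this side the count of the second walk is at most `d`, so the two counts agree and no
  -- coordinate has been missed.
  have hle' : q.idx + shift₂ true q.code ≤ d := by
    unfold shift₂
    split_ifs with c1 c2 c3
    · have := q2 (by omega); omega
    · have := blockShift_le ((q.code - 16) % 6) true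
      rcases le_or_gt q.code 21 with h | h
      · have := (q4 (by omega) h).1; omega
      · have := (q5 (by omega) (by omega)).1; omega
    · have := q6 (by omega) hcode.2; omega
    · simp at c3
  refine ⟨_, hpA, _, hqB, fun i => ?_⟩
  by_cases hi : i < d
  · exact hpre (by omega) i (by omega)
  · rw [List.getD_eq_default _ _ (by have := hA _ hpA; omega)]; simp

/-- While the first walk is at 13 or 14, the second can run through coordinates or change its
vector, so only an inequality between the counts survives. Afterwards both walks are bound to their
vectors and cross together. A first walk that lags behind cannot reach the end of its vector, and
one that does not lag would prove orthogonality there. -/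
theorem Confined.step {p q p' q' : WalkPos} (hd : 0 < d) (hA : ∀ a ∈ A, a.length = d)
    (hB : ∀ b ∈ B, b.length = d) (hno : ¬ ∃ a ∈ A, ∃ b ∈ B, ListOrthogonal a b)
    (hp : Valid₁ A p) (hq : Valid₂ B q) (hp' : Valid₁ A p') (hq' : Valid₂ B q')
    (hpc : p'.code < 33)
    (hpp : p' = p ∨ Next₁ p p') (hqq : q' = q ∨ Next₂Init q q')
    (hn : isNear p.code q.code = true) (hn' : isNear p'.code q'.code = true)
    (h : Confined p q) : Confined p' q' := by
  rcases h with h | ⟨h1, h2, h3, h4, h5, h6, h7⟩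
  · rcases hqq with rfl | hqq
    · exact Or.inl h
    · have hc := hqq.2 h
      rcases Nat.lt_or_ge q.code 9 with h' | h'
      · exact Or.inl (by omega)
      · have hc' : q'.code = 10 := by omega
        have hp9 : p'.code = 9 := isNear_ten _ hpc (hc' ▸ hn')
        have hidx := hp'.2.1 (by omega)
        refine Or.inr ⟨by omega, by omega, by omega, by omega, by omega, ?_, ?_⟩
        · simp [hp9, hidx, shift₁]
        · intro _ i hi; simp [hp9, hidx, visited] at hi
  obtain ⟨hvec, Δ, hmem, hidx⟩ : p'.vec = p.vec ∧ ∃ Δ,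
      (p'.code, Δ) ∈ (p.code, 0) :: succCodes₁ p.code ∧ p'.idx = p.idx + Δ := by
    rcases hpp with rfl | hpp
    · exact ⟨rfl, 0, by simp, rfl⟩
    · obtain ⟨k1, Δ, k2, k3⟩ := hpp.mem_succCodes h1 h2
      exact ⟨k1, Δ, List.mem_cons_of_mem _ k2, k3⟩
  -- The vector of the second walk carries over except when it leaves code 10 or code 32.
  obtain ⟨Δ', hmem', hq2⟩ : ∃ Δ, (q'.code, Δ) ∈ (q.code, 0) :: succCodes₂ q.code ∧
      (q.code ≠ 10 → q.code ≠ 32 ∨ q'.code = 32 → q'.vec = q.vec ∧ q'.idx = q.idx + Δ) := by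
    rcases hqq with rfl | hqq
    · exact ⟨0, by simp, fun _ _ => ⟨rfl, rfl⟩⟩
    · obtain ⟨Δ, k1, k2⟩ := hqq.1.mem_succCodes h3 h4
      refine ⟨Δ, List.mem_cons_of_mem _ k1, fun k3 k4 => k2 k3 ?_⟩
      rcases k4 with k4 | k4
      · exact k4
      · rintro k5
        rw [k4, k5] at k1
        simp [succCodes₂] at k1
  have hcheck := stepCheck_eq_true p.code (List.mem_range'_1.2 ⟨h1, by omega⟩)
    q.code (List.mem_range'_1.2 ⟨h3, by omega⟩) _ hmem _ hmem'
  have hcheck : stepCheck p.code q.code (p'.code, Δ) (q'.code, Δ') = true := by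
    simp only [hn, hn', Bool.not_true, Bool.false_or, Bool.or_false, Bool.or_eq_true,
      Bool.and_eq_true, beq_iff_eq] at hcheck
    exact hcheck.resolve_left h5
  clear hmem
  have hcode' : 10 ≤ q'.code := by
    clear hcheck hq2
    unfold succCodes₂ at hmem'
    split_ifs at hmem' <;> simp at hmem' <;> omega
  have hcode : 9 ≤ p'.code := by
    rcases hpp with rfl | hpp
    · exact h1
    · have := (hpp h1 h2).2
      split_ifs at this
      · rcases blockEntry_mem (base := 13) (post := 25) p.vec p.idx with h | h | h <;> omega
      · rcases blockEntry_mem (base := 13) (post := 25) p.vec (p.idx + 1) with h | h | h <;> omega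
      · omega
  simp only [stepCheck, Bool.and_eq_true, Bool.or_eq_true, decide_eq_true_eq, beq_iff_eq,
    bne_iff_ne] at hcheck
  obtain ⟨hq42, hcheck⟩ := hcheck
  set lt := isBefore p.code q.code with hlt
  set lt' := isBefore p'.code q'.code with hlt'
  rcases hcheck with hsmall | ⟨⟨⟨⟨⟨⟨hc10, hc32⟩, hend⟩, h26⟩, hc12⟩, hshift⟩, hvis⟩
  -- The first walk is still at 13 or 14, so its count is `0`, whatever the second walk does.
  · have hz := hp'.2.1 (by omega)
    have e1 : shift₁ lt' p'.code = 0 := by unfold shift₁; rw [if_pos (by omega)]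
    have e2 : visited p'.code = 0 := by unfold visited; rw [if_neg (by omega)]
    refine Or.inr ⟨hcode, by omega, hcode', hq42, by omega, ?_, ?_⟩
    · rw [← hlt']; omega
    · intro _ i hi; omega
  obtain ⟨hqv, hqi⟩ := hq2 hc10 hc32
  have main : p'.idx + shift₁ lt' p'.code ≤ q'.idx + shift₂ lt' q'.code ∧
      (p'.idx + shift₁ lt' p'.code = q'.idx + shift₂ lt' q'.code →
        ∀ i < p'.idx + visited p'.code,
          ¬ (p'.vec.getD i false = true ∧ q'.vec.getD i false = true)) := by
    rcases Nat.lt_or_ge 12 p.code with h12 | h12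
    · replace hshift := hshift.resolve_left (by omega)
      refine ⟨by omega, fun heq i hi => ?_⟩
      rw [hvec, hqv]
      by_cases hi' : i < p.idx + visited p.code
      · exact h7 (by omega) i hi'
      rcases hvis with ((hv | hv) | hv) | ⟨⟨⟨⟨hv1, hv2⟩, hv3⟩, hv4⟩, hv5⟩
      · omega
      · omega
      -- The bit just visited by the first walk is zero.
      · have hi2 : i = p.idx := by
          have : visited p'.code ≤ 1 := by unfold visited; split_ifs <;> omega
          have : Δ = 0 := by
            rcases hpp with rfl | hpp
            · omega
            · have := (hpp h1 h2).2
              rw [if_neg (by omega), if_neg (by omega)] at this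
              omega
          omega
        rw [hi2, (hp.2.2.1 (by omega) (by omega)).2]; simp
      -- The first walk has arrived at 40, so the second is at 32 in a zero block; equal counts say
      -- that both blocks belong to the same coordinate.
      · have hi2 : i = p.idx := by
          have : visited p'.code ≤ 1 := by unfold visited; split_ifs <;> omega
          omega
        rw [hv2, hv3, hv4] at heq
        have e1 : shift₁ true 20 = 0 := by decide
        have e2 : shift₂ true 17 = 0 := by decide
        rw [e1, e2] at heq
        rw [hi2, ← hqv, show p.idx = q'.idx by omega, (hq'.2.2.2.1 (by omega) (by omega)).2]
        simp
    · obtain ⟨⟨e1, e2⟩, e3⟩ := hc12.resolve_left (by omega)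
      have := hp.2.1 h12
      exact ⟨by omega, fun _ i hi => by omega⟩
  -- In this position all coordinates have been passed, which would yield an orthogonal pair.
  have hfin : ¬ (25 ≤ p'.code ∧ lt' = true) := by
    rintro ⟨k1, k2⟩
    rw [k2] at main
    exact hno (exists_orthogonal_of_end hd hA hB hp' hq' k1 (by omega) main.1 main.2)
  refine Or.inr ⟨hcode, ?_, hcode', hq42, ?_, main.1, main.2⟩
  · rcases hend with hend | hend
    · exact hend
    · by_contra hcon
      exact hfin ⟨by omega, hend⟩
  · exact fun hcon => hfin ⟨by omega, hcon.2⟩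

/-- The invariant is carried along the coupling. It bounds the code of the second walk by 42, so the
final codes, from 43 on, are never reached. -/
theorem not_coupling_of_confined (hd : 0 < d) (hA : ∀ a ∈ A, a.length = d)
    (hB : ∀ b ∈ B, b.length = d) (hno : ¬ ∃ a ∈ A, ∃ b ∈ B, ListOrthogonal a b)
    {P Q : List WalkPos} (h : Coupling (fun p q => isNear p.code q.code = true) P Q) :
    P.IsChain Next₁ → Q.IsChain Next₂Init → (∀ p ∈ P, Valid₁ A p ∧ p.code < 33) →
      (∀ q ∈ Q, Valid₂ B q) → (∀ q ∈ Q.getLast?, 43 ≤ q.code) →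
      (∀ p ∈ P.head?, ∀ q ∈ Q.head?, Confined p q) → False := by
  induction h with
  | @single a b h =>
    intro _ _ _ _ hl hc
    have h1 : 43 ≤ b.code := hl b (by simp)
    rcases hc _ rfl _ rfl with h2 | h2 <;> omega
  | @left a b P Q h hc ih =>
    intro h1 h2 h3 h4 h5 h6
    refine ih (List.isChain_cons.1 h1).2 h2 (fun p hp => h3 p (by simp [hp])) h4 h5 ?_
    intro p hp q hq
    obtain rfl : b = q := by simpa using hq
    have hpP : p ∈ P := List.mem_of_mem_head? hp
    have hn : isNear p.code b.code = true := by
      cases hc <;> simp at hp <;> subst hp <;> assumption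
    exact (h6 a (by simp) b (by simp)).step hd hA hB hno (h3 a (by simp)).1 (h4 b (by simp))
      (h3 p (by simp [hpP])).1 (h4 b (by simp)) (h3 p (by simp [hpP])).2
      (Or.inr ((List.isChain_cons.1 h1).1 p hp)) (Or.inl rfl) h hn
  | @right a b P Q h hc ih =>
    intro h1 h2 h3 h4 h5 h6
    have hl : ∀ q ∈ Q.getLast?, 43 ≤ q.code := by
      obtain ⟨c, Q, rfl⟩ := List.exists_cons_of_ne_nil hc.ne_nil_right
      rwa [List.getLast?_cons_cons] at h5
    refine ih h1 (List.isChain_cons.1 h2).2 h3 (fun q hq => h4 q (by simp [hq])) hl ?_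
    intro p hp q hq
    obtain rfl : a = p := by simpa using hp
    have hqQ : q ∈ Q := List.mem_of_mem_head? hq
    have hn : isNear a.code q.code = true := by
      cases hc <;> simp at hq <;> subst hq <;> assumption
    exact (h6 a (by simp) b (by simp)).step hd hA hB hno (h3 a (by simp)).1 (h4 b (by simp))
      (h3 a (by simp)).1 (h4 q (by simp [hqQ])) (h3 a (by simp)).2
      (Or.inl rfl) (Or.inr ((List.isChain_cons.1 h2).1 q hq)) h hn
  | @both a b P Q h hc ih =>
    intro h1 h2 h3 h4 h5 h6
    have hl : ∀ q ∈ Q.getLast?, 43 ≤ q.code := by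
      obtain ⟨c, Q, rfl⟩ := List.exists_cons_of_ne_nil hc.ne_nil_right
      rwa [List.getLast?_cons_cons] at h5
    refine ih (List.isChain_cons.1 h1).2 (List.isChain_cons.1 h2).2
      (fun p hp => h3 p (by simp [hp])) (fun q hq => h4 q (by simp [hq])) hl ?_
    intro p hp q hq
    have hpP : p ∈ P := List.mem_of_mem_head? hp
    have hqQ : q ∈ Q := List.mem_of_mem_head? hq
    have hn : isNear p.code q.code = true := by
      cases hc <;> simp at hp hq <;> subst hp hq <;> assumption
    exact (h6 a (by simp) b (by simp)).step hd hA hB hno (h3 a (by simp)).1 (h4 b (by simp))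
      (h3 p (by simp [hpP])).1 (h4 q (by simp [hqQ])) (h3 p (by simp [hpP])).2
      (Or.inr ((List.isChain_cons.1 h1).1 p hp)) (Or.inr ((List.isChain_cons.1 h2).1 q hq)) h hn

end

theorem mem_walk_codes₁ {A : List (List Bool)} {r c : ℕ} (h : c ∈ codes₁.walk A r) : c < 33 := by
  simp only [WalkGadget.walk, WalkGadget.vec, List.mem_append, List.mem_flatMap] at h
  rcases h with ((h | ⟨a, -, (h | ⟨x, -, h⟩) | h⟩) | h) | h
  · simp [codes₁] at h
  · exact (by decide : ∀ c ∈ codes₁.pre, c < 33) c h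
  · exact (by decide : ∀ x, ∀ c ∈ codes₁.blk x, c < 33) x c h
  · exact (by decide : ∀ c ∈ codes₁.post, c < 33) c h
  · exact (by decide : ∀ c ∈ codes₁.fin, c < 33) c h
  · rcases mem_alternating h with rfl | rfl <;> decide

/-- The two walks can be coupled at distance `19` if and only if some pair is orthogonal. -/
theorem coupling_gadget_iff {A B : List (List Bool)} {d : ℕ} (hA : ∀ a ∈ A, a.length = d)
    (hB : ∀ b ∈ B, b.length = d) (hA₀ : A ≠ []) (hB₀ : B ≠ []) (r s : ℕ) :
    Coupling Near (gadget₁.walk A r) (gadget₂.walk B s) ↔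
      ∃ a ∈ A, ∃ b ∈ B, ListOrthogonal a b := by
  constructor
  · intro h
    -- In dimension zero every pair is orthogonal, but counts of crossings carry no information.
    rcases Nat.eq_zero_or_pos d with rfl | hd
    · obtain ⟨a, ha⟩ := List.exists_mem_of_ne_nil A hA₀
      obtain ⟨b, hb⟩ := List.exists_mem_of_ne_nil B hB₀
      refine ⟨a, ha, b, hb, fun i => ?_⟩
      simp [List.length_eq_zero_iff.1 (hA a ha)]
    by_contra hno
    rw [← codes₁_map, ← codes₂_map, ← WalkGadget.map_walk, ← WalkGadget.map_walk,
      ← WalkGadget.map_code_positions, ← WalkGadget.map_code_positions] at h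
    refine not_coupling_of_confined hd hA hB hno (P := codes₁.positions A r)
      (Q := codes₂.positions B s) ?_ (isChain_positions₁ A r) (isChain_positions₂ hB₀ s) ?_
      (valid_positions₂ B s) ?_ ?_
    · have := h.of_map.of_map
      simpa [Near, isNear] using this
    · intro p hp
      refine ⟨valid_positions₁ A r p hp, mem_walk_codes₁ (A := A) (r := r) ?_⟩
      rw [← WalkGadget.map_code_positions]
      exact List.mem_map_of_mem hp
    · intro q hq
      simp only [WalkGadget.positions, List.getLast?_append, List.getLast?_map] at hq
      rcases h : (alternating codes₂.pad₀ codes₂.pad₁ s).getLast? with _ | w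
      · rw [h] at hq; simp [codes₂] at hq; subst hq; simp
      · rw [h] at hq; simp at hq; subst hq
        rcases mem_alternating (List.mem_of_getLast? h) with rfl | rfl <;> decide
    · intro p _ q hq
      simp [WalkGadget.positions, codes₂] at hq
      subst hq
      exact Or.inl (by simp)
  · rintro ⟨a, ha, b, hb, ho⟩
    exact coupling_of_orthogonal ha hb ((hA a ha).trans (hB b hb).symm) ho r s

/-! ### The reduction -/

theorem orthogonalBool_iff {d : ℕ} (a b : Fin d → Bool) :
    OrthogonalBool a b ↔ ListOrthogonal (List.ofFn a) (List.ofFn b) := by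
  unfold OrthogonalBool ListOrthogonal
  rw [Finset.sum_eq_zero_iff]
  constructor
  · intro h i
    by_cases hi : i < d
    · have := h ⟨i, hi⟩ (Finset.mem_univ _)
      rw [List.getD_eq_getElem _ _ (by simpa), List.getD_eq_getElem _ _ (by simpa),
        List.getElem_ofFn, List.getElem_ofFn]
      revert this
      cases a ⟨i, hi⟩ <;> cases b ⟨i, hi⟩ <;> simp
    · rw [List.getD_eq_default _ _ (by simpa using hi)]; simp
  · intro h i _
    have := h i
    rw [List.getD_eq_getElem _ _ (by simp), List.getD_eq_getElem _ _ (by simp),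
      List.getElem_ofFn, List.getElem_ofFn] at this
    revert this
    simp only [Fin.eta]
    cases a i <;> cases b i <;> simp

/-- The vectors of a list, as lists of bits. -/
def bitLists {d : ℕ} (A : List (Fin d → Bool)) : List (List Bool) := A.map List.ofFn

theorem length_of_mem_bitLists {d : ℕ} {A : List (Fin d → Bool)} :
    ∀ a ∈ bitLists A, a.length = d := by
  intro a ha
  obtain ⟨a, -, rfl⟩ := List.mem_map.1 ha
  simp

theorem hasOrthogonalPair_iff {d : ℕ} {A B : List (Fin d → Bool)} :
    HasOrthogonalPair A B ↔ ∃ a ∈ bitLists A, ∃ b ∈ bitLists B, ListOrthogonal a b := by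
  simp [HasOrthogonalPair, bitLists, orthogonalBool_iff]

theorem discreteFrechet_gadget_le_iff {A B : List (List Bool)} {d : ℕ}
    (hA : ∀ a ∈ A, a.length = d) (hB : ∀ b ∈ B, b.length = d) (hA₀ : A ≠ []) (hB₀ : B ≠ [])
    (r s : ℕ) {ℓ : ℝ} (hℓ : 0 < ℓ) :
    discreteFrechet gadgetGraph ℓ (gadget₁.walk A r) (gadget₂.walk B s) ≤ ℓ * 19 ↔
      ∃ a ∈ A, ∃ b ∈ B, ListOrthogonal a b := by
  rw [← coupling_gadget_iff hA hB hA₀ hB₀ r s]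
  exact discreteFrechet_gadgetGraph_le_iff hℓ (isVertexWalk_gadget₁ A r).1
    (isVertexWalk_gadget₂ B s).1 19

theorem exists_reduction : ∃ (f g : (d : ℕ) → List (Fin d → Bool) → List (Fin 50)) (C : ℕ),
    ∀ d : ℕ, 1 ≤ d → ∀ A B : List (Fin d → Bool), A ≠ [] → B ≠ [] →
      IsVertexWalk gadgetGraph (f d A) ∧ IsVertexWalk gadgetGraph (g d B) ∧
      (f d A).length ≤ C * (A.length * d) ∧ (g d B).length ≤ C * (B.length * d) ∧
      (HasOrthogonalPair A B ↔ discreteFrechet gadgetGraph (1 / 10) (f d A) (g d B) ≤ 1.9) := by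
  -- For nonempty lists and `d ≥ 1`, the longer bound is `31 + 6 + 10 = 47` vertices for each
  -- coordinate. No padding is needed.
  refine ⟨fun d A => gadget₁.walk (bitLists A) 0, fun d B => gadget₂.walk (bitLists B) 0, 50, ?_⟩
  intro d hd A B hA hB
  refine ⟨isVertexWalk_gadget₁ _ _, isVertexWalk_gadget₂ _ _, ?_, ?_, ?_⟩
  · rw [length_walk_gadget₁ length_of_mem_bitLists, bitLists, List.length_map]
    have := List.length_pos_iff.2 hA
    nlinarith
  · rw [length_walk_gadget₂ length_of_mem_bitLists, bitLists, List.length_map]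
    have := List.length_pos_iff.2 hB
    nlinarith
  · rw [hasOrthogonalPair_iff, ← discreteFrechet_gadget_le_iff length_of_mem_bitLists
      length_of_mem_bitLists (by simpa [bitLists]) (by simpa [bitLists]) 0 0
      (by norm_num : (0 : ℝ) < 1 / 10)]
    norm_num

/-! ### Running programs -/

/-- Started in `s`, the program halts after at most `T` steps, in a state that satisfies `Q`. -/
def Runs (W : ℕ) (p : RamProg) (s : RamState) (T : ℕ) (Q : RamState → Prop) : Prop :=
  ∃ t s', RamExec W p s t s' ∧ t ≤ T ∧ Q s'

namespace Runs

variable {W : ℕ} {p q : RamProg} {s : RamState} {T T' : ℕ} {Q Q' : RamState → Prop}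

theorem mono (h : Runs W p s T Q) (hT : T ≤ T') (hQ : ∀ s, Q s → Q' s) : Runs W p s T' Q' := by
  obtain ⟨t, s', h1, h2, h3⟩ := h
  exact ⟨t, s', h1, h2.trans hT, hQ _ h3⟩

theorem skip (h : Q s) : Runs W .skip s 1 Q := ⟨1, s, .skip s, le_rfl, h⟩

theorem const {x c : ℕ} (hc : c < W) (h : Q (s.setReg x c)) : Runs W (.const x c) s 1 Q :=
  ⟨1, _, .const s x c hc, le_rfl, h⟩

theorem op {o : WordOp} {x y z : ℕ} (hv : o.eval (s.reg y) (s.reg z) < W)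
    (h : Q (s.setReg x (o.eval (s.reg y) (s.reg z)))) : Runs W (.op o x y z) s 1 Q :=
  ⟨1, _, .op s o x y z hv, le_rfl, h⟩

theorem load {x a y : ℕ} (hv : s.mem a (s.reg y) < W)
    (h : Q (s.setReg x (s.mem a (s.reg y)))) : Runs W (.load x a y) s 1 Q :=
  ⟨1, _, .load s x a y hv, le_rfl, h⟩

theorem store {a y x : ℕ} (hy : s.reg y < W) (hx : s.reg x < W)
    (h : Q (s.setMem a (s.reg y) (s.reg x))) : Runs W (.store a y x) s 1 Q :=
  ⟨1, _, .store s a y x hy hx, le_rfl, h⟩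

theorem seq (h : Runs W p s T Q) (h' : ∀ s', Q s' → Runs W q s' T' Q') :
    Runs W (.seq p q) s (T + T') Q' := by
  obtain ⟨t, s', h1, h2, h3⟩ := h
  obtain ⟨t', s'', h4, h5, h6⟩ := h' s' h3
  exact ⟨_, _, .seq h1 h4, by omega, h6⟩

theorem const_seq {x c : ℕ} (hc : c < W) (h : Runs W q (s.setReg x c) T Q) :
    Runs W (.seq (.const x c) q) s (1 + T) Q :=
  (Runs.const (Q := fun s' => s' = s.setReg x c) hc rfl).seq fun _ hs => hs ▸ h

theorem op_seq {o : WordOp} {x y z : ℕ} {v : ℕ} (he : o.eval (s.reg y) (s.reg z) = v) (hv : v < W)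
    (h : Runs W q (s.setReg x v) T Q) : Runs W (.seq (.op o x y z) q) s (1 + T) Q :=
  (Runs.op (Q := fun s' => s' = s.setReg x v) (he ▸ hv) (by rw [he])).seq fun _ hs => hs ▸ h

theorem load_seq {x a y : ℕ} {v : ℕ} (he : s.mem a (s.reg y) = v) (hv : v < W)
    (h : Runs W q (s.setReg x v) T Q) : Runs W (.seq (.load x a y) q) s (1 + T) Q :=
  (Runs.load (Q := fun s' => s' = s.setReg x v) (he ▸ hv) (by rw [he])).seq fun _ hs => hs ▸ h

theorem store_seq {a y x : ℕ} (hy : s.reg y < W) (hx : s.reg x < W)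
    (h : Runs W q (s.setMem a (s.reg y) (s.reg x)) T Q) :
    Runs W (.seq (.store a y x) q) s (1 + T) Q :=
  (Runs.store (Q := fun s' => s' = s.setMem a (s.reg y) (s.reg x)) hy hx rfl).seq
    fun _ hs => hs ▸ h

theorem ite {x : ℕ} (h : s.reg x ≠ 0 → Runs W p s T Q) (h' : s.reg x = 0 → Runs W q s T Q) :
    Runs W (.ite x p q) s (T + 1) Q := by
  by_cases hx : s.reg x = 0
  · obtain ⟨t, s', h1, h2, h3⟩ := h' hx
    exact ⟨_, _, .iteFalse p hx h1, by omega, h3⟩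
  · obtain ⟨t, s', h1, h2, h3⟩ := h hx
    exact ⟨_, _, .iteTrue q hx h1, by omega, h3⟩

theorem loop_done {x : ℕ} (hx : s.reg x = 0) (h : Q s) : Runs W (.loop x p) s 1 Q :=
  ⟨_, _, .loopDone p hx, le_rfl, h⟩

theorem loop_step {x : ℕ} (hx : s.reg x ≠ 0) (h : Runs W p s T Q)
    (h' : ∀ s', Q s' → Runs W (.loop x p) s' T' Q') : Runs W (.loop x p) s (T + 1 + T') Q' := by
  obtain ⟨t, s', h1, h2, h3⟩ := h
  obtain ⟨t', s'', h4, h5, h6⟩ := h' s' h3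
  exact ⟨_, _, .loopStep hx h1 h4, by omega, h6⟩

end Runs

theorem RamState.setReg_reg (s : RamState) (x v y : ℕ) :
    (s.setReg x v).reg y = if y = x then v else s.reg y := by
  simp [RamState.setReg, Function.update_apply]

theorem RamState.setReg_mem (s : RamState) (x v : ℕ) : (s.setReg x v).mem = s.mem := rfl

theorem RamState.setMem_reg (s : RamState) (a i v : ℕ) : (s.setMem a i v).reg = s.reg := rfl

theorem RamState.setMem_mem (s : RamState) (a i v : ℕ) :
    (s.setMem a i v).mem = Function.update s.mem a (Function.update (s.mem a) i v) := rfl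

theorem RamExec.mono {W W' : ℕ} (hW : W ≤ W') {p : RamProg} {s s' : RamState} {t : ℕ}
    (h : RamExec W p s t s') : RamExec W' p s t s' := by
  induction h with
  | skip s => exact .skip s
  | const s x c h => exact .const s x c (h.trans_le hW)
  | op s o x y z h => exact .op s o x y z (h.trans_le hW)
  | load s x a y h => exact .load s x a y (h.trans_le hW)
  | store s a y x hy hx => exact .store s a y x (hy.trans_le hW) (hx.trans_le hW)
  | seq _ _ h1 h2 => exact .seq h1 h2
  | iteTrue q hx _ h => exact .iteTrue q hx h
  | iteFalse p hx _ h => exact .iteFalse p hx h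
  | loopDone p hx => exact .loopDone p hx
  | loopStep hx _ _ h1 h2 => exact .loopStep hx h1 h2

/-! ### Relocation of programs -/

namespace RamProg

/-- The program uses only registers with numbers smaller than `b`. -/
def RegsBelow (b : ℕ) : RamProg → Prop
  | skip => True
  | const x _ => x < b
  | op _ x y z => x < b ∧ y < b ∧ z < b
  | load x _ y => x < b ∧ y < b
  | store _ y x => x < b ∧ y < b
  | seq p q => RegsBelow b p ∧ RegsBelow b q
  | ite x p q => x < b ∧ RegsBelow b p ∧ RegsBelow b q
  | loop x p => x < b ∧ RegsBelow b p

theorem RegsBelow.mono {b c : ℕ} (h : b ≤ c) {p : RamProg} (hp : RegsBelow b p) :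
    RegsBelow c p := by
  induction p with
  | skip => trivial
  | const x v => exact lt_of_lt_of_le hp h
  | op o x y z => exact ⟨hp.1.trans_le h, hp.2.1.trans_le h, hp.2.2.trans_le h⟩
  | load x a y => exact ⟨hp.1.trans_le h, hp.2.trans_le h⟩
  | store a y x => exact ⟨hp.1.trans_le h, hp.2.trans_le h⟩
  | seq p q ihp ihq => exact ⟨ihp hp.1, ihq hp.2⟩
  | ite x p q ihp ihq => exact ⟨hp.1.trans_le h, ihp hp.2.1, ihq hp.2.2⟩
  | loop x p ihp => exact ⟨hp.1.trans_le h, ihp hp.2⟩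

theorem exists_regsBelow (p : RamProg) : ∃ b, RegsBelow b p := by
  induction p with
  | skip => exact ⟨0, trivial⟩
  | const x v => exact ⟨x + 1, Nat.lt_succ_self x⟩
  | op o x y z => exact ⟨x + y + z + 1, by omega, by omega, by omega⟩
  | load x a y => exact ⟨x + y + 1, by omega, by omega⟩
  | store a y x => exact ⟨x + y + 1, by omega, by omega⟩
  | seq p q ihp ihq =>
    obtain ⟨b, hb⟩ := ihp
    obtain ⟨c, hc⟩ := ihq
    exact ⟨b + c, hb.mono (by omega), hc.mono (by omega)⟩
  | ite x p q ihp ihq =>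
    obtain ⟨b, hb⟩ := ihp
    obtain ⟨c, hc⟩ := ihq
    exact ⟨x + 1 + b + c, by omega, hb.mono (by omega), hc.mono (by omega)⟩
  | loop x p ihp =>
    obtain ⟨b, hb⟩ := ihp
    exact ⟨x + 1 + b, by omega, hb.mono (by omega)⟩

/-- The program with its registers moved up by `25`, its arrays moved up by `2`, and all its
indices into arrays moved up by the contents of register `9`; register `24` is scratch. -/
def relocate : RamProg → RamProg
  | skip => skip
  | const x c => const (x + 25) c
  | op o x y z => op o (x + 25) (y + 25) (z + 25)
  | load x a y => seq (op .add 24 9 (y + 25)) (load (x + 25) (a + 2) 24)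
  | store a y x => seq (op .add 24 9 (y + 25)) (store (a + 2) 24 (x + 25))
  | seq p q => seq (relocate p) (relocate q)
  | ite x p q => ite (x + 25) (relocate p) (relocate q)
  | loop x p => loop (x + 25) (relocate p)

end RamProg

/-- The state `S` contains the state `s`, moved to the position in register `9`. -/
def Contains (b W₀ : ℕ) (s S : RamState) : Prop :=
  (∀ x < b, S.reg (x + 25) = s.reg x) ∧
    ∀ a, ∀ i < W₀, S.mem (a + 2) (S.reg 9 + i) = s.mem a i

/-- What a relocated program does not change. -/
def SameOutside (W₀ : ℕ) (S S' : RamState) : Prop :=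
  (∀ x < 24, S'.reg x = S.reg x) ∧ S'.mem 0 = S.mem 0 ∧ S'.mem 1 = S.mem 1 ∧
    ∀ a i, S.reg 9 + W₀ ≤ i → S'.mem (a + 2) i = S.mem (a + 2) i

theorem SameOutside.refl (W₀ : ℕ) (S : RamState) : SameOutside W₀ S S :=
  ⟨fun _ _ => rfl, rfl, rfl, fun _ _ _ => rfl⟩

theorem SameOutside.trans {W₀ : ℕ} {S S' S'' : RamState} (h : SameOutside W₀ S S')
    (h' : SameOutside W₀ S' S'') : SameOutside W₀ S S'' := by
  obtain ⟨h1, h2, h3, h4⟩ := h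
  obtain ⟨k1, k2, k3, k4⟩ := h'
  refine ⟨fun x hx => (k1 x hx).trans (h1 x hx), k2.trans h2, k3.trans h3, fun a i hi => ?_⟩
  rw [k4 a i (by rw [h1 9 (by omega)]; exact hi), h4 a i hi]

theorem Contains.setReg {b W₀ : ℕ} {s S : RamState} (h : Contains b W₀ s S) (x v : ℕ) :
    Contains b W₀ (s.setReg x v) (S.setReg (x + 25) v) := by
  refine ⟨fun y hy => ?_, ?_⟩
  · simp only [RamState.setReg_reg, h.1 y hy, Nat.add_right_cancel_iff]
  · simp only [RamState.setReg_reg, RamState.setReg_mem, if_neg (show ¬ 9 = x + 25 by omega)]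
    exact h.2

theorem Contains.setTmp {b W₀ : ℕ} {s S : RamState} (h : Contains b W₀ s S) (v : ℕ) :
    Contains b W₀ s (S.setReg 24 v) := by
  refine ⟨fun y hy => ?_, ?_⟩
  · rw [RamState.setReg_reg, if_neg (by omega)]; exact h.1 y hy
  · simp only [RamState.setReg_reg, RamState.setReg_mem]
    exact h.2

theorem sameOutside_setReg {W₀ : ℕ} {S : RamState} {x v : ℕ} (hx : 24 ≤ x) :
    SameOutside W₀ S (S.setReg x v) := by
  refine ⟨fun y hy => ?_, rfl, rfl, fun _ _ _ => rfl⟩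
  rw [RamState.setReg_reg, if_neg (by omega)]

/-- The time doubles because each access to memory first adds the offset. Registers stay below `W₀`,
so all accesses fall into the window of `W₀` cells that starts at the offset. -/
theorem runs_relocate {W W₀ b : ℕ} {p : RamProg} {s s' : RamState} {t : ℕ}
    (h : RamExec W₀ p s t s') : RamProg.RegsBelow b p → (∀ x, s.reg x < W₀) →
    ∀ S : RamState, Contains b W₀ s S → S.reg 9 + W₀ ≤ W →
      (∀ x, s'.reg x < W₀) ∧
      Runs W p.relocate S (2 * t) fun S' => Contains b W₀ s' S' ∧ SameOutside W₀ S S' := by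
  have hset : ∀ {s : RamState} {x v : ℕ}, (∀ x, s.reg x < W₀) → v < W₀ →
      ∀ y, (s.setReg x v).reg y < W₀ := by
    intro s x v hs hv y
    rw [RamState.setReg_reg]
    split_ifs
    · exact hv
    · exact hs y
  induction h with
  | skip s =>
    intro _ hs S hS _
    exact ⟨hs, (Runs.skip ⟨hS, .refl _ _⟩).mono (by omega) fun _ h => h⟩
  | const s x c h =>
    intro _ hs S hS hW
    exact ⟨hset hs h, (Runs.const (by omega) ⟨hS.setReg x c, sameOutside_setReg (by omega)⟩).mono
      (by omega) fun _ h => h⟩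
  | op s o x y z h =>
    rintro ⟨hx, hy, hz⟩ hs S hS hW
    have e : o.eval (S.reg (y + 25)) (S.reg (z + 25)) = o.eval (s.reg y) (s.reg z) := by
      rw [hS.1 y hy, hS.1 z hz]
    refine ⟨hset hs h, (Runs.op (by omega) ?_).mono (show 1 ≤ 2 * 1 by omega) fun _ h => h⟩
    rw [e]
    exact ⟨hS.setReg x _, sameOutside_setReg (by omega)⟩
  | load s x a y h =>
    rintro ⟨hx, hy⟩ hs S hS hW
    refine ⟨hset hs h, ?_⟩
    have hy' := hs y
    change Runs W (.seq (.op .add 24 9 (y + 25)) (.load (x + 25) (a + 2) 24)) S (1 + 1) _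
    refine Runs.op_seq (v := S.reg 9 + s.reg y) (by rw [hS.1 y hy]; rfl) (by omega) ?_
    have e : (S.setReg 24 (S.reg 9 + s.reg y)).mem (a + 2)
        ((S.setReg 24 (S.reg 9 + s.reg y)).reg 24) = s.mem a (s.reg y) := by
      rw [RamState.setReg_reg, if_pos rfl]
      exact hS.2 a _ hy'
    refine Runs.load (by rw [e]; omega) ?_
    rw [e]
    exact ⟨(hS.setTmp _).setReg x _,
      (sameOutside_setReg (by omega)).trans (sameOutside_setReg (by omega))⟩
  | store s a y x hy hx =>
    rintro ⟨hxb, hyb⟩ hs S hS hW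
    refine ⟨hs, ?_⟩
    change Runs W (.seq (.op .add 24 9 (y + 25)) (.store (a + 2) 24 (x + 25))) S (1 + 1) _
    have hy' := hs y
    refine Runs.op_seq (v := S.reg 9 + s.reg y) (by rw [hS.1 y hyb]; rfl) (by omega) ?_
    have e : (S.setReg 24 (S.reg 9 + s.reg y)).reg (x + 25) = s.reg x := by
      rw [RamState.setReg_reg, if_neg (by omega), hS.1 x hxb]
    refine Runs.store (by rw [RamState.setReg_reg, if_pos rfl]; omega) (by omega) ?_
    rw [e, RamState.setReg_reg, if_pos rfl]
    refine ⟨⟨(hS.setTmp (S.reg 9 + s.reg y)).1, ?_⟩, ?_⟩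
    · intro a' i hi
      have e9 : ((S.setReg 24 (S.reg 9 + s.reg y)).setMem (a + 2) (S.reg 9 + s.reg y)
          (s.reg x)).reg 9 = S.reg 9 := by
        rw [RamState.setMem_reg, RamState.setReg_reg, if_neg (by omega)]
      rw [e9]
      simp only [RamState.setMem_mem, RamState.setReg_mem, Function.update_apply,
        Nat.add_right_cancel_iff]
      by_cases ha : a' = a
      · subst ha
        simp only [if_true, Function.update_apply, Nat.add_left_cancel_iff]
        rw [hS.2 a' i hi]
      · rw [if_neg ha, if_neg ha, hS.2 a' i hi]
    · refine (sameOutside_setReg (by omega)).trans ⟨fun _ _ => rfl, ?_, ?_, ?_⟩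
      · rw [RamState.setMem_mem, Function.update_of_ne (by omega)]
      · rw [RamState.setMem_mem, Function.update_of_ne (by omega)]
      · intro a' i hi
        rw [RamState.setReg_reg, if_neg (by omega)] at hi
        rw [RamState.setMem_mem]
        by_cases ha : a' = a
        · subst ha
          rw [Function.update_self, Function.update_of_ne (by omega)]
        · rw [Function.update_of_ne (by omega)]
  | seq hp hq ihp ihq =>
    rintro ⟨hpb, hqb⟩ hs S hS hW
    obtain ⟨hs', h1⟩ := ihp hpb hs S hS hW
    obtain ⟨t1, S', k1, k2, k3, k4⟩ := h1
    obtain ⟨hs'', h2⟩ := ihq hqb hs' S' k3 (by rwa [k4.1 9 (by omega)])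
    refine ⟨hs'', ?_⟩
    refine Runs.mono (Runs.seq ⟨t1, S', k1, k2, rfl⟩ ?_) (by rw [mul_add]) fun _ h => h
    rintro _ rfl
    exact h2.mono le_rfl fun S'' h => ⟨h.1, k4.trans h.2⟩
  | iteTrue q hx _ ih =>
    rintro ⟨hxb, hpb, hqb⟩ hs S hS hW
    obtain ⟨hs', h1⟩ := ih hpb hs S hS hW
    refine ⟨hs', (Runs.ite (fun _ => h1) fun h => absurd ?_ hx).mono (by omega) fun _ h => h⟩
    rw [← hS.1 _ hxb]; exact h
  | iteFalse p hx _ ih =>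
    rintro ⟨hxb, hpb, hqb⟩ hs S hS hW
    obtain ⟨hs', h1⟩ := ih hqb hs S hS hW
    refine ⟨hs', (Runs.ite (fun h => absurd ?_ h) fun _ => h1).mono (by omega) fun _ h => h⟩
    rw [hS.1 _ hxb]; exact hx
  | loopDone p hx =>
    rintro ⟨hxb, hpb⟩ hs S hS hW
    exact ⟨hs, (Runs.loop_done (by rw [hS.1 _ hxb]; exact hx) ⟨hS, .refl _ _⟩).mono
      (by omega) fun _ h => h⟩
  | @loopStep x p s s' s'' t t' hx hp hl ihp ihl =>
    rintro ⟨hxb, hpb⟩ hs S hS hW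
    obtain ⟨hs', h1⟩ := ihp hpb hs S hS hW
    obtain ⟨t1, S', k1, k2, k3, k4⟩ := h1
    obtain ⟨hs'', h2⟩ := ihl ⟨hxb, hpb⟩ hs' S' k3 (by rwa [k4.1 9 (by omega)])
    refine ⟨hs'', ?_⟩
    refine Runs.mono (Runs.loop_step (T' := 2 * t') (by rw [hS.1 _ hxb]; exact hx)
      ⟨t1, S', k1, k2, rfl⟩ ?_) (by omega) fun _ h => h
    rintro _ rfl
    exact h2.mono le_rfl fun S'' h => ⟨h.1, k4.trans h.2⟩

/-! ### Writing walks -/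

/-- The contents of an array after the list has been written to it from cell `p` on. -/
def writeList (m : ℕ → ℕ) (p : ℕ) (l : List ℕ) (i : ℕ) : ℕ :=
  if p ≤ i then l[i - p]?.getD (m i) else m i

theorem writeList_nil (m : ℕ → ℕ) (p : ℕ) : writeList m p [] = m := by
  funext i; simp [writeList]

theorem writeList_append (m : ℕ → ℕ) (p : ℕ) (l l' : List ℕ) :
    writeList (writeList m p l) (p + l.length) l' = writeList m p (l ++ l') := by
  funext i
  unfold writeList
  by_cases h1 : p ≤ i
  · by_cases h2 : p + l.length ≤ i
    · rw [if_pos h2, if_pos h1, if_pos h1, List.getElem?_append_right (by omega),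
        List.getElem?_eq_none (by omega : l.length ≤ i - p)]
      rw [show i - p - l.length = i - (p + l.length) by omega]; rfl
    · rw [if_neg h2, if_pos h1, if_pos h1, List.getElem?_append_left (by omega)]
  · rw [if_neg (by omega), if_neg h1, if_neg h1]

theorem writeList_singleton (m : ℕ → ℕ) (p v : ℕ) :
    Function.update m p v = writeList m p [v] := by
  funext i
  unfold writeList
  rcases lt_trichotomy i p with h | rfl | h
  · rw [Function.update_of_ne (by omega), if_neg (by omega)]
  · simp
  · rw [Function.update_of_ne (by omega), if_pos (by omega), List.getElem?_eq_none (by simp; omega)]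
    rfl

/-- The state `s'` arises from `s` by writing `l` to the array `dst`, from the cell in register
`17` on; this register is advanced, and otherwise only the registers in `C` are changed. -/
structure Emits (dst : ℕ) (C : List ℕ) (l : List ℕ) (s s' : RamState) : Prop where
  ptr : s'.reg 17 = s.reg 17 + l.length
  reg : ∀ x ∉ C, x ≠ 17 → s'.reg x = s.reg x
  mem : s'.mem = Function.update s.mem dst (writeList (s.mem dst) (s.reg 17) l)

namespace Emits

variable {dst : ℕ} {C C' : List ℕ} {l l' : List ℕ} {s s' s'' : RamState}

theorem refl (hreg : ∀ x ∉ C, x ≠ 17 → s'.reg x = s.reg x) (h17 : s'.reg 17 = s.reg 17)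
    (hm : s'.mem = s.mem) : Emits dst C [] s s' :=
  ⟨by simpa using h17, hreg, by rw [writeList_nil, Function.update_eq_self, hm]⟩

theorem trans (h : Emits dst C l s s') (h' : Emits dst C l' s' s'') :
    Emits dst C (l ++ l') s s'' where
  ptr := by rw [h'.ptr, h.ptr, List.length_append, add_assoc]
  reg x hx hx' := (h'.reg x hx hx').trans (h.reg x hx hx')
  mem := by
    rw [h'.mem, h.mem, h.ptr, Function.update_self, writeList_append, Function.update_idem]

theorem mono (h : Emits dst C l s s') (hC : ∀ x ∈ C, x ∈ C') : Emits dst C' l s s' :=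
  ⟨h.ptr, fun x hx => h.reg x fun hx' => hx (hC x hx'), h.mem⟩

theorem mem_of_ne (h : Emits dst C l s s') {a : ℕ} (ha : a ≠ dst) : s'.mem a = s.mem a := by
  rw [h.mem, Function.update_of_ne ha]

end Emits

/-- Write a fixed list. -/
def emitList (dst : ℕ) : List ℕ → RamProg
  | [] => .skip
  | v :: l => .seq (.const 21 v) (.seq (.store dst 17 21) (.seq (.op .add 17 17 3) (emitList dst l)))

theorem runs_emitList {W dst : ℕ} (l : List ℕ) : ∀ {s : RamState}, (∀ v ∈ l, v < W) →
    s.reg 17 + l.length < W → s.reg 3 = 1 →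
    Runs W (emitList dst l) s (3 * l.length + 1) (Emits dst [21] l s) := by
  induction l with
  | nil => intro s _ _ _; exact (Runs.skip (.refl (fun _ _ _ => rfl) rfl rfl)).mono (by simp) fun _ h => h
  | cons v l ih =>
    intro s hl hp h3
    rw [List.length_cons] at hp
    refine Runs.mono (T := 1 + (1 + (1 + (3 * l.length + 1)))) ?_ (by simp; omega) fun _ h => h
    refine Runs.const_seq (hl v (by simp)) (Runs.store_seq ?_ ?_ (Runs.op_seq (v := s.reg 17 + 1)
      ?_ (by omega) ((ih (fun w hw => hl w (by simp [hw])) ?_ ?_).mono le_rfl ?_)))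
    · simp only [RamState.setReg_reg]; norm_num; omega
    · simp only [RamState.setReg_reg]; norm_num; exact hl v (by simp)
    · simp [RamState.setReg_reg, RamState.setMem_reg, h3, WordOp.eval]
    · simp only [RamState.setReg_reg]; norm_num; omega
    · simp [RamState.setReg_reg, RamState.setMem_reg, h3]
    · intro s' hs'
      refine Emits.trans (l := [v]) ?_ hs'
      refine ⟨by simp [RamState.setReg_reg], ?_, ?_⟩
      · intro x hx hx'
        simp at hx
        simp [RamState.setReg_reg, RamState.setMem_reg, hx, hx']
      · rw [RamState.setReg_mem, RamState.setMem_mem, RamState.setReg_mem]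
        simp [RamState.setReg_reg, writeList_singleton]

/-- Write the blocks of the bits that are stored in the array `src`, from the cell in register
`18` on; their number is in register `20`. -/
def emitBits (T : WalkGadget ℕ) (src dst : ℕ) : RamProg :=
  .loop 20 (.seq (.load 21 src 18) (.seq (.op .add 18 18 3)
    (.seq (.ite 21 (emitList dst (T.blk true)) (emitList dst (T.blk false))) (.op .sub 20 20 3))))

/-- All the vertices in the gadget are words. -/
structure WalkGadget.Below (T : WalkGadget ℕ) (W : ℕ) : Prop where
  init : ∀ v ∈ T.init, v < W
  pre : ∀ v ∈ T.pre, v < W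
  blk : ∀ x, ∀ v ∈ T.blk x, v < W
  post : ∀ v ∈ T.post, v < W
  fin : ∀ v ∈ T.fin, v < W
  pad : T.pad₀ + T.pad₁ < W

theorem runs_emitBits {W src dst : ℕ} {T : WalkGadget ℕ} (hT : T.Below W)
    (h6 : ∀ x, (T.blk x).length = 6) (hW : 1 < W) (hne : src ≠ dst) (l : List Bool) :
    ∀ {s : RamState}, s.reg 3 = 1 → s.reg 20 = l.length → s.reg 20 < W →
      s.reg 18 + l.length < W → s.reg 17 + 6 * l.length < W →
      (∀ j < l.length, s.mem src (s.reg 18 + j) = (l.getD j false).toNat) →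
      Runs W (emitBits T src dst) s (24 * l.length + 1) fun s' =>
        Emits dst [18, 20, 21] (l.flatMap T.blk) s s' ∧ s'.reg 18 = s.reg 18 + l.length := by
  induction l with
  | nil =>
    intro s _ h20 _ _ _ _
    exact Runs.loop_done h20 ⟨.refl (fun _ _ _ => rfl) rfl rfl, rfl⟩
  | cons x l ih =>
    intro s h3 h20 h20W h18 h17 hm
    rw [List.length_cons] at h20 h18 h17
    have hx := hm 0 (by simp)
    simp only [add_zero, List.getD_cons_zero] at hx
    have hxW : x.toNat < W := by cases x <;> simp <;> omega
    -- Six vertices at three steps each and the closing `skip` make 19 steps; with the load, two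
    -- arithmetic steps and two tests this is 24 for each bit.
    refine Runs.mono (T := (1 + (1 + ((19 + 1) + 1))) + 1 + (24 * l.length + 1)) ?_
      (by simp; omega) fun _ h => h
    refine Runs.loop_step (by omega) (Runs.load_seq hx hxW (Runs.op_seq (v := s.reg 18 + 1)
      ?_ (by omega) (Runs.seq (Runs.ite
        (fun h => (runs_emitList (T.blk true) (hT.blk true) ?_ ?_).mono
          (by rw [h6]) fun _ h' => ?_) fun h => (runs_emitList (T.blk false)
          (hT.blk false) ?_ ?_).mono (by rw [h6]) fun _ h' => ?_)
        fun s₁ (h₁ : Emits dst [21] (T.blk x)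
          ((s.setReg 21 x.toNat).setReg 18 (s.reg 18 + 1)) s₁) => Runs.op (Q := fun s₂ =>
          Emits dst [18, 20, 21] (T.blk x) s s₂ ∧ s₂.reg 18 = s.reg 18 + 1 ∧
            s₂.reg 20 = l.length) ?_ ?_))) ?_
    · simp [RamState.setReg_reg, h3, WordOp.eval]
    · simp only [RamState.setReg_reg, h6]; norm_num; omega
    · simp [RamState.setReg_reg, h3]
    · have : x = true := by
        simp [RamState.setReg_reg] at h; exact h
      rw [this] at h' ⊢; exact h'
    · simp only [RamState.setReg_reg, h6]; norm_num; omega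
    · simp [RamState.setReg_reg, h3]
    · have : x = false := by
        simp [RamState.setReg_reg] at h; exact h
      rw [this] at h' ⊢; exact h'
    · rw [h₁.reg 20 (by simp) (by simp), h₁.reg 3 (by simp) (by simp)]
      simp [RamState.setReg_reg, WordOp.eval]
      omega
    · rw [h₁.reg 20 (by simp) (by simp), h₁.reg 3 (by simp) (by simp)]
      refine ⟨⟨?_, ?_, ?_⟩, ?_, ?_⟩
      · rw [RamState.setReg_reg, if_neg (by omega), h₁.ptr]
        simp [RamState.setReg_reg]
      · intro y hy hy'
        simp at hy
        rw [RamState.setReg_reg, if_neg hy.2.1, h₁.reg y (by simpa using hy.2.2) hy']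
        simp [RamState.setReg_reg, hy]
      · rw [RamState.setReg_mem, h₁.mem]
        simp [RamState.setReg_mem, RamState.setReg_reg]
      · rw [RamState.setReg_reg, if_neg (by omega), h₁.reg 18 (by simp) (by simp)]
        simp [RamState.setReg_reg]
      · simp [RamState.setReg_reg, WordOp.eval, h3, h20]
    · rintro s₂ ⟨h₂, h₂', h₂''⟩
      refine (ih (s := s₂) ?_ h₂'' (by omega) (by omega) ?_ ?_).mono le_rfl ?_
      · rw [h₂.reg 3 (by simp) (by simp), h3]
      · rw [h₂.ptr, h6]; omega
      · intro j hj
        rw [h₂.mem_of_ne hne, h₂', add_assoc, add_comm 1 j]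
        exact hm (j + 1) (by simpa using hj)
      · rintro s₃ ⟨h₃, h₃'⟩
        refine ⟨h₂.trans h₃, ?_⟩
        rw [h₃', h₂', List.length_cons]; omega

/-- Write the part of the walk that belongs to one vector. -/
def emitVec (T : WalkGadget ℕ) (src dst : ℕ) : RamProg :=
  .seq (emitList dst T.pre) (.seq (.op .add 20 2 23) (.seq (emitBits T src dst) (emitList dst T.post)))

/-- The cells from `p` on contain the bits of the vectors, one after the other. -/
def HoldsBits (m : ℕ → ℕ) (p : ℕ) (A : List (List Bool)) : Prop :=
  ∀ j < A.flatten.length, m (p + j) = (A.flatten.getD j false).toNat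

theorem HoldsBits.head {m : ℕ → ℕ} {p : ℕ} {a : List Bool} {A : List (List Bool)}
    (h : HoldsBits m p (a :: A)) : ∀ j < a.length, m (p + j) = (a.getD j false).toNat := by
  intro j hj
  rw [h j (by simp; omega), List.flatten_cons, List.getD_append _ _ _ _ hj]

theorem HoldsBits.tail {m : ℕ → ℕ} {p : ℕ} {a : List Bool} {A : List (List Bool)}
    (h : HoldsBits m p (a :: A)) : HoldsBits m (p + a.length) A := by
  intro j hj
  rw [add_assoc, h (a.length + j) (by simpa using hj), List.flatten_cons,
    List.getD_append_right _ _ _ _ (by omega)]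
  simp

theorem HoldsBits.take {m : ℕ → ℕ} {p : ℕ} {A : List (List Bool)} (h : HoldsBits m p A) (k : ℕ) :
    HoldsBits m p (A.take k) := by
  induction k generalizing p A with
  | zero => intro j hj; simp at hj
  | succ k ih =>
    cases A with
    | nil => simpa using h
    | cons a A =>
      have := ih h.tail
      intro j hj
      rw [List.take_succ_cons, List.flatten_cons] at hj ⊢
      rcases lt_or_ge j a.length with h' | h'
      · rw [h.head j h', List.getD_append _ _ _ _ h']
      · rw [List.getD_append_right _ _ _ _ h', ← this (j - a.length)
          (by rw [List.length_append] at hj; omega)]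
        congr 1; omega

theorem HoldsBits.drop {m : ℕ → ℕ} {p d : ℕ} {A : List (List Bool)} (h : HoldsBits m p A)
    (hd : ∀ a ∈ A, a.length = d) (k : ℕ) (hk : k ≤ A.length) :
    HoldsBits m (p + k * d) (A.drop k) := by
  induction k generalizing p A with
  | zero => simpa using h
  | succ k ih =>
    cases A with
    | nil => simp at hk
    | cons a A =>
      have := ih h.tail (fun b hb => hd b (by simp [hb])) (by simpa using hk)
      rw [hd a (by simp)] at this
      rw [List.drop_succ_cons, show p + (k + 1) * d = p + d + k * d by ring]
      exact this

theorem runs_emitVec {W src dst d e : ℕ} {T : WalkGadget ℕ} (hT : T.Below W)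
    (h6 : ∀ x, (T.blk x).length = 6) (he : T.pre.length + T.post.length = e)
    (hW : 1 < W) (hne : src ≠ dst) {a : List Bool} (ha : a.length = d) {s : RamState}
    (h2 : s.reg 2 = d) (h23 : s.reg 23 = 0) (h3 : s.reg 3 = 1) (h18 : s.reg 18 + d < W)
    (h17 : s.reg 17 + (6 * d + e) < W)
    (hm : ∀ j < a.length, s.mem src (s.reg 18 + j) = (a.getD j false).toNat) :
    Runs W (emitVec T src dst) s (24 * d + 3 * e + 4) fun s' =>
        Emits dst [18, 20, 21] (T.vec a) s s' ∧ s'.reg 18 = s.reg 18 + d := by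
  refine Runs.mono (T := (3 * T.pre.length + 1) + (1 + ((24 * d + 1) + (3 * T.post.length + 1)))) ?_
    (by omega) fun _ h => h
  refine (runs_emitList (dst := dst) T.pre hT.pre (by omega) h3).seq fun s₁ h₁ => ?_
  have h₁d : (s₁.setReg 20 d).reg 20 = d := by simp [RamState.setReg_reg]
  have h₁18 : (s₁.setReg 20 d).reg 18 = s.reg 18 := by
    simp [RamState.setReg_reg, h₁.reg 18 (by simp) (by simp)]
  have h₁17 : (s₁.setReg 20 d).reg 17 = s.reg 17 + T.pre.length := by
    simp [RamState.setReg_reg, h₁.ptr]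
  have h₁3 : (s₁.setReg 20 d).reg 3 = 1 := by
    simp [RamState.setReg_reg, h₁.reg 3 (by simp) (by simp), h3]
  have h₁' : Emits dst [18, 20, 21] T.pre s (s₁.setReg 20 d) := by
    refine ⟨h₁17, fun x hx hx' => ?_, h₁.mem⟩
    simp at hx
    simp [RamState.setReg_reg, hx, h₁.reg x (by simp [hx]) hx']
  refine Runs.op_seq (v := d) ?_ (by omega) (Runs.seq (runs_emitBits hT h6 hW hne a h₁3
    (by rw [h₁d, ha]) (by omega) (by omega) (by omega) ?_ |>.mono (by rw [ha]) fun _ h => h) ?_)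
  -- Register 23 holds `0`; adding it copies a register.
  · rw [h₁.reg 2 (by simp) (by simp), h₁.reg 23 (by simp) (by simp), h2, h23]; rfl
  · rw [h₁18, h₁'.mem_of_ne hne]; exact hm
  rintro s₂ ⟨h₂, h₂18⟩
  have h₂' := h₁'.trans h₂
  refine (runs_emitList T.post hT.post ?_ ?_).mono le_rfl fun s₃ h₃ => ⟨?_, ?_⟩
  · rw [h₂'.ptr, List.length_append, List.length_flatMap]
    simp only [h6, List.map_const', List.sum_replicate, smul_eq_mul, ha]; omega
  · rw [h₂'.reg 3 (by simp) (by simp), h3]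
  · exact h₂'.trans (h₃.mono (by simp))
  · rw [h₃.reg 18 (by simp) (by simp), h₂18, h₁18, ha]

/-- Write the part of the walk that belongs to a list of vectors, whose number is in register
`19`. -/
def emitVecs (T : WalkGadget ℕ) (src dst : ℕ) : RamProg :=
  .loop 19 (.seq (emitVec T src dst) (.op .sub 19 19 3))

theorem WalkGadget.length_vec {α : Type*} {T : WalkGadget α} (h6 : ∀ x, (T.blk x).length = 6)
    {e d : ℕ} (he : T.pre.length + T.post.length = e) {a : List Bool} (ha : a.length = d) :
    (T.vec a).length = 6 * d + e := by
  simp only [WalkGadget.vec, List.length_append, List.length_flatMap, h6, List.map_const',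
    List.sum_replicate, smul_eq_mul, ha]
  omega

theorem runs_emitVecs {W src dst d e : ℕ} {T : WalkGadget ℕ} (hT : T.Below W)
    (h6 : ∀ x, (T.blk x).length = 6) (he : T.pre.length + T.post.length = e)
    (hW : 1 < W) (hne : src ≠ dst) (A : List (List Bool)) : ∀ {s : RamState},
    (∀ a ∈ A, a.length = d) → s.reg 2 = d → s.reg 23 = 0 → s.reg 3 = 1 → s.reg 19 = A.length →
    s.reg 19 < W → s.reg 18 + A.length * d < W → s.reg 17 + A.length * (6 * d + e) < W →
    HoldsBits (s.mem src) (s.reg 18) A →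
    Runs W (emitVecs T src dst) s (A.length * (24 * d + 3 * e + 6) + 1) fun s' =>
        Emits dst [18, 19, 20, 21] (A.flatMap T.vec) s s' ∧
          s'.reg 18 = s.reg 18 + A.length * d := by
  induction A with
  | nil =>
    intro s _ _ _ _ h19 _ _ _ _
    exact (Runs.loop_done h19 ⟨.refl (fun _ _ _ => rfl) rfl rfl, by simp⟩).mono (by simp) fun _ h => h
  | cons a A ih =>
    intro s hA h2 h23 h3 h19 h19W h18 h17 hm
    have ha := hA a (by simp)
    rw [List.length_cons, Nat.succ_mul A.length] at h18 h17
    rw [List.length_cons] at h19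
    refine Runs.mono (T := (24 * d + 3 * e + 4 + 1) + 1 + (A.length * (24 * d + 3 * e + 6) + 1)) ?_
      (by rw [List.length_cons, Nat.succ_mul A.length]; omega) fun _ h => h
    refine Runs.loop_step (by omega) (Runs.seq (T := 24 * d + 3 * e + 4) (T' := 1)
      (runs_emitVec hT h6 he hW hne ha h2 h23 h3
      (by omega) (by omega) hm.head) fun s₁ h₁ => Runs.op (Q := fun s₂ =>
        Emits dst [18, 19, 20, 21] (T.vec a) s s₂ ∧ s₂.reg 18 = s.reg 18 + d ∧
          s₂.reg 19 = A.length) ?_ ?_) ?_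
    · rw [h₁.1.reg 19 (by simp) (by simp), h₁.1.reg 3 (by simp) (by simp)]
      simp [WordOp.eval]; omega
    · rw [h₁.1.reg 19 (by simp) (by simp), h₁.1.reg 3 (by simp) (by simp), h19, h3]
      refine ⟨⟨?_, ?_, h₁.1.mem⟩, ?_, ?_⟩
      · simp [RamState.setReg_reg, h₁.1.ptr]
      · intro y hy hy'
        simp at hy
        simp [RamState.setReg_reg, hy, h₁.1.reg y (by simp [hy]) hy']
      · simp [RamState.setReg_reg, h₁.2]
      · simp [RamState.setReg_reg, WordOp.eval]
    · rintro s₂ ⟨h₂, h₂18, h₂19⟩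
      have hlen := WalkGadget.length_vec h6 he ha
      refine (ih (s := s₂) (fun b hb => hA b (by simp [hb])) ?_ ?_ ?_ h₂19 (by omega) (by omega)
        ?_ ?_).mono le_rfl ?_
      · rw [h₂.reg 2 (by simp) (by simp), h2]
      · rw [h₂.reg 23 (by simp) (by simp), h23]
      · rw [h₂.reg 3 (by simp) (by simp), h3]
      · rw [h₂.ptr, hlen]; omega
      · rw [h₂.mem_of_ne hne, h₂18, ← ha]; exact hm.tail
      · rintro s₃ ⟨h₃, h₃'⟩
        refine ⟨by simpa using h₂.trans h₃, ?_⟩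
        rw [h₃', h₂18, List.length_cons]; ring

/-- Write padding; the first vertex is in register `21`, and the number of vertices in register
`22`. -/
def emitPads (sum dst : ℕ) : RamProg :=
  .loop 22 (.seq (.store dst 17 21) (.seq (.op .add 17 17 3) (.seq (.const 20 sum)
    (.seq (.op .sub 21 20 21) (.op .sub 22 22 3)))))

theorem runs_emitPads {W dst : ℕ} (r : ℕ) : ∀ {s : RamState} {v w : ℕ}, v + w < W →
    s.reg 3 = 1 → s.reg 21 = v → s.reg 22 = r → s.reg 17 + r < W →
    Runs W (emitPads (v + w) dst) s (6 * r + 1)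
      (Emits dst [20, 21, 22] (alternating v w r) s) := by
  induction r with
  | zero =>
    intro s v w _ _ _ h22 _
    exact Runs.loop_done h22 (.refl (fun _ _ _ => rfl) rfl rfl)
  | succ r ih =>
    intro s v w hv h3 h21 h22 h17
    refine Runs.mono (T := (1 + (1 + (1 + (1 + 1)))) + 1 + (6 * r + 1)) ?_ (by omega) fun _ h => h
    refine Runs.loop_step (by omega) (Runs.store_seq (by omega) (by omega) (Runs.op_seq
      (v := s.reg 17 + 1) ?_ (by omega) (Runs.const_seq hv (Runs.op_seq (v := w) ?_ (by omega)
        (Runs.op (Q := fun s₂ => Emits dst [20, 21, 22] [v] s s₂ ∧ s₂.reg 21 = w ∧ s₂.reg 22 = r)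
          ?_ ?_))))) ?_
    · simp [RamState.setMem_reg, h3, WordOp.eval]
    · simp [RamState.setReg_reg, RamState.setMem_reg, h21, WordOp.eval]
    · simp [RamState.setReg_reg, RamState.setMem_reg, h22, h3, WordOp.eval]; omega
    · refine ⟨⟨?_, ?_, ?_⟩, ?_, ?_⟩
      · simp [RamState.setReg_reg]
      · intro y hy hy'
        simp at hy
        simp [RamState.setReg_reg, RamState.setMem_reg, hy, hy']
      · simp [RamState.setReg_mem, RamState.setMem_mem, h21, writeList_singleton]
      · simp [RamState.setReg_reg]
      · simp [RamState.setReg_reg, RamState.setMem_reg, h22, h3, WordOp.eval]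
    · rintro s₂ ⟨h₂, h₂1, h₂2⟩
      rw [add_comm v w]
      refine (ih (s := s₂) (by omega) (by rw [h₂.reg 3 (by simp) (by simp), h3]) h₂1 h₂2
        (by rw [h₂.ptr]; simp; omega)).mono le_rfl ?_
      intro s₃ h₃
      exact h₂.trans h₃

/-- Write the walk of the vectors whose number is in register `19` and whose bits start in the cell
in register `18` of the array `src`. The walk starts in the cell in register `9` of the array
`dst`, and it is padded to the length in the register `len`. -/
def emitWalk (T : WalkGadget ℕ) (src dst len : ℕ) : RamProg :=
  .seq (.op .add 17 9 23) (.seq (emitList dst T.init) (.seq (emitVecs T src dst)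
    (.seq (emitList dst T.fin) (.seq (.op .add 22 9 len) (.seq (.op .sub 22 22 17)
      (.seq (.const 21 T.pad₀) (emitPads (T.pad₀ + T.pad₁) dst)))))))

theorem runs_emitWalk {W src dst len d e c N off : ℕ} {T : WalkGadget ℕ} (hT : T.Below W)
    (h6 : ∀ x, (T.blk x).length = 6) (he : T.pre.length + T.post.length = e)
    (hc : T.init.length + T.fin.length = c) (hW : 1 < W) (hne : src ≠ dst)
    (hlen : len < 17) {A : List (List Bool)} {s : RamState}
    (hA : ∀ a ∈ A, a.length = d) (h2 : s.reg 2 = d) (h23 : s.reg 23 = 0) (h3 : s.reg 3 = 1)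
    (h9 : s.reg 9 = off) (hN : s.reg len = N) (hoff : off + N < W)
    (hfit : c + A.length * (6 * d + e) ≤ N)
    (h19 : s.reg 19 = A.length) (h19W : s.reg 19 < W) (h18 : s.reg 18 + A.length * d < W)
    (hm : HoldsBits (s.mem src) (s.reg 18) A) :
    Runs W (emitWalk T src dst len) s (4 * (A.length * (6 * d + e)) + 6 * A.length + 6 * N + 20)
      fun s' => s'.reg 18 = s.reg 18 + A.length * d ∧
        (∀ x, x < 17 ∨ 23 ≤ x → s'.reg x = s.reg x) ∧
        s'.mem = Function.update s.mem dst (writeList (s.mem dst) off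
          (T.walk A (N - (c + A.length * (6 * d + e))))) := by
  have hvecs : (A.flatMap T.vec).length = A.length * (6 * d + e) := by
    rw [List.length_flatMap, List.map_congr_left fun a ha => WalkGadget.length_vec h6 he (hA a ha),
      List.map_const', List.sum_replicate, smul_eq_mul]
  refine Runs.mono (T := 1 + ((3 * T.init.length + 1) + ((A.length * (24 * d + 3 * e + 6) + 1) +
    ((3 * T.fin.length + 1) + (1 + (1 + (1 + (6 * (N - (c + A.length * (6 * d + e))) + 1)))))))) ?_
    ?_ fun _ h => h
  · set r := N - (c + A.length * (6 * d + e))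
    have hstart : ∀ x ≠ 17, (s.setReg 17 off).reg x = s.reg x := by
      intro x hx; simp [RamState.setReg_reg, hx]
    have hstart17 : (s.setReg 17 off).reg 17 = off := by simp [RamState.setReg_reg]
    refine Runs.op_seq (v := off) (by rw [h9, h23]; rfl) (by omega) (Runs.seq
      (runs_emitList T.init hT.init (by omega) (by rw [hstart 3 (by omega), h3])) fun s₁ h₁ => ?_)
    have h₁r : ∀ x ∉ [17, 21], s₁.reg x = s.reg x := by
      intro x hx
      simp at hx
      rw [h₁.reg x (by simp [hx]) hx.1, hstart x hx.1]
    have h₁m : s₁.mem src = s.mem src := h₁.mem_of_ne hne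
    refine Runs.seq (runs_emitVecs hT h6 he hW hne A hA (by rw [h₁r 2 (by simp), h2])
      (by rw [h₁r 23 (by simp), h23]) (by rw [h₁r 3 (by simp), h3]) (by rw [h₁r 19 (by simp), h19])
      (by rw [h₁r 19 (by simp)]; exact h19W) (by rw [h₁r 18 (by simp)]; exact h18)
      (by rw [h₁.ptr, hstart17]; omega) (by rw [h₁r 18 (by simp), h₁m]; exact hm)) ?_
    rintro s₂ ⟨h₂, h₂18⟩
    have h₂' := (h₁.mono (C' := [18, 19, 20, 21]) (by simp)).trans h₂
    refine Runs.seq (runs_emitList T.fin hT.fin ?_ ?_) fun s₃ h₃ => ?_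
    · rw [h₂'.ptr, hstart17, List.length_append, hvecs]; omega
    · rw [h₂'.reg 3 (by simp) (by simp), hstart 3 (by omega), h3]
    have h₃' := h₂'.trans (h₃.mono (C' := [18, 19, 20, 21]) (by simp))
    have h₃18 : s₃.reg 18 = s.reg 18 + A.length * d := by
      rw [h₃.reg 18 (by simp) (by simp), h₂18, h₁r 18 (by simp)]
    have h₃r : ∀ x, x < 17 ∨ 22 ≤ x → s₃.reg x = s.reg x := by
      intro x hx
      rw [h₃'.reg x (by simp; omega) (by omega), hstart x (by omega)]
    have h₃17 : s₃.reg 17 + r = off + N := by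
      rw [h₃'.ptr, hstart17, List.length_append, List.length_append, hvecs]; omega
    refine Runs.op_seq (v := off + N) ?_ (by omega) (Runs.op_seq (v := r) ?_ (by omega)
      (Runs.const_seq (by have := hT.pad; omega) ((runs_emitPads r hT.pad ?_ ?_ ?_ ?_).mono
        le_rfl fun s₄ h₄ => ?_)))
    · rw [h₃r 9 (by omega), h₃r len (by omega), h9, hN]; rfl
    -- The amount of padding is the gap between the write pointer and the end of the space for the
    -- walk.
    · simp [RamState.setReg_reg, WordOp.eval]; omega
    · simp [RamState.setReg_reg, h₃r 3, h3]
    · simp [RamState.setReg_reg]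
    · simp [RamState.setReg_reg]
    · simp [RamState.setReg_reg]; omega
    · refine ⟨?_, ?_, ?_⟩
      · rw [h₄.reg 18 (by simp) (by simp)]; simpa [RamState.setReg_reg] using h₃18
      · intro x hx
        have hx' : x ≠ 21 ∧ x ≠ 22 ∧ x ≠ 20 ∧ x ≠ 17 := by omega
        rw [h₄.reg x (by simp [hx']) (by omega)]
        simp [RamState.setReg_reg, hx', h₃r x (by omega)]
      · have e1 : ((((s₃.setReg 22 (off + N)).setReg 22 r).setReg 21 T.pad₀)).reg 17 =
            off + (T.init ++ A.flatMap T.vec ++ T.fin).length := by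
          simp only [RamState.setReg_reg]
          norm_num
          rw [h₃'.ptr, hstart17]; simp
        rw [h₄.mem, e1]
        simp only [RamState.setReg_mem]
        rw [h₃'.mem, hstart17, Function.update_self, writeList_append, Function.update_idem]
        rfl
  · generalize hX : A.length * (6 * d + e) = X at *
    have : A.length * (24 * d + 3 * e + 6) ≤ 4 * X + 6 * A.length := by
      rw [← hX]; nlinarith
    omega

/-! ### The program for orthogonal vectors -/

def natGadget₁ : WalkGadget ℕ := gadget₁.map fun v : Fin 50 => (v : ℕ)

def natGadget₂ : WalkGadget ℕ := gadget₂.map fun v : Fin 50 => (v : ℕ)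

theorem natGadget_below {W : ℕ} (hW : 100 ≤ W) : natGadget₁.Below W ∧ natGadget₂.Below W := by
  have h : ∀ l : List (Fin 50), ∀ v ∈ l.map (fun v : Fin 50 => (v : ℕ)), v < W := by
    intro l v hv
    obtain ⟨w, -, rfl⟩ := List.mem_map.1 hv
    omega
  exact ⟨⟨h _, h _, fun x => h _, h _, h _, lt_of_lt_of_le (by decide) hW⟩,
    ⟨h _, h _, fun x => h _, h _, h _, lt_of_lt_of_le (by decide) hW⟩⟩

def clearRegs : ℕ → RamProg
  | 0 => .skip
  | k + 1 => .seq (.const (k + 25) 0) (clearRegs k)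

theorem runs_clearRegs {W : ℕ} (hW : 0 < W) (k : ℕ) : ∀ s : RamState,
    Runs W (clearRegs k) s (k + 1) fun s' => s'.mem = s.mem ∧
      (∀ x < 25, s'.reg x = s.reg x) ∧ ∀ x, (x < k → s'.reg (x + 25) = 0) ∧
        (s.reg (x + 25) = 0 → s'.reg (x + 25) = 0) := by
  induction k with
  | zero => intro s; exact Runs.skip ⟨rfl, fun _ _ => rfl, fun x => ⟨fun h => by omega, id⟩⟩
  | succ k ih =>
    intro s
    refine Runs.mono (T := 1 + (k + 1)) (Runs.const_seq hW ((ih _).mono le_rfl ?_)) (by omega)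
      fun _ h => h
    rintro s' ⟨h1, h2, h3⟩
    refine ⟨h1, fun x hx => ?_, fun x => ⟨fun hx => ?_, fun hx => (h3 x).2 ?_⟩⟩
    · rw [h2 x hx, RamState.setReg_reg, if_neg (by omega)]
    · rcases Nat.lt_or_ge x k with h | h
      · exact (h3 x).1 h
      · refine (h3 x).2 ?_
        rw [RamState.setReg_reg, if_pos (by omega)]
    · rw [RamState.setReg_reg, hx]; simp

/-- Run the relocated program on the walks that have been written, with fresh registers. -/
def callProg (p : RamProg) (b : ℕ) : RamProg :=
  .seq (clearRegs b) (.seq (.op .add 25 5 23) (.seq (.op .add 26 4 23) p.relocate))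

/-- Only registers are cleared. The memory window contains the two walks and is otherwise untouched,
so it looks like the initial state of the subroutine. -/
theorem runs_callProg {W W₀ b M N Tp : ℕ} {p : RamProg} (hp : p.RegsBelow b) (hb : 2 ≤ b)
    {P Q : List ℕ} {s₀ : RamState} {t : ℕ} (hex : RamExec W₀ p (ramInput [M, N] P Q) t s₀)
    (ht : t ≤ Tp) (hM : M < W₀) (hN : N < W₀) {s : RamState} (h4 : s.reg 4 = N) (h5 : s.reg 5 = M)
    (h23 : s.reg 23 = 0) (hW : s.reg 9 + W₀ < W)
    (hm : ∀ a, ∀ i < W₀, s.mem (a + 2) (s.reg 9 + i) = (ramInput [M, N] P Q).mem a i) :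
    Runs W (callProg p b) s (b + 3 + 2 * Tp) fun s' => s'.reg 25 = s₀.reg 0 ∧
      SameOutside W₀ s s' := by
  refine Runs.mono (T := (b + 1) + (1 + (1 + 2 * t))) ((runs_clearRegs (by omega) b s).seq ?_)
    (by omega) fun _ h => h
  rintro s₁ ⟨h1m, h1r, h1c⟩
  refine Runs.op_seq (v := M) (by rw [h1r 5 (by omega), h1r 23 (by omega), h5, h23]; rfl) (by omega)
    (Runs.op_seq (v := N) ?_ (by omega) ?_)
  · simp [RamState.setReg_reg, h1r 4, h1r 23, h4, h23, WordOp.eval]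
  set S := (s₁.setReg 25 M).setReg 26 N with hS
  have hSr : ∀ x < 25, S.reg x = s.reg x := by
    intro x hx
    rw [hS, RamState.setReg_reg, if_neg (by omega), RamState.setReg_reg, if_neg (by omega),
      h1r x hx]
  have hSm : S.mem = s.mem := h1m
  have hcont : Contains b W₀ (ramInput [M, N] P Q) S := by
    refine ⟨fun x hx => ?_, ?_⟩
    · rw [hS]
      rcases x with _ | _ | x
      · simp [RamState.setReg_reg, ramInput]
      · simp [RamState.setReg_reg, ramInput]
      · simp only [RamState.setReg_reg]
        rw [if_neg (by omega), if_neg (by omega), (h1c (x + 1 + 1)).1 hx]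
        simp [ramInput]
    · rw [hSm, hSr 9 (by omega)]; exact hm
  have hreg : ∀ x, (ramInput [M, N] P Q).reg x < W₀ := by
    intro x
    rcases x with _ | _ | x <;> simp [ramInput] <;> omega
  refine (runs_relocate hex hp hreg S hcont (by rw [hSr 9 (by omega)]; omega)).2.mono le_rfl ?_
  rintro s' ⟨k1, k2, k3, k4, k5⟩
  refine ⟨k1.1 0 (by omega), fun x hx => ?_, ?_, ?_, ?_⟩
  · rw [k2 x hx, hSr x (by omega)]
  · rw [k3, hSm]
  · rw [k4, hSm]
  · intro a i hi
    rw [k5 a i (by rwa [hSr 9 (by omega)]), hSm]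

/-- The sizes that the program works with, and the contents of the input arrays. -/
structure Sizes where
  n : ℕ
  m : ℕ
  d : ℕ
  N : ℕ
  M : ℕ
  qA : ℕ
  qB : ℕ
  W₀ : ℕ
  mA : ℕ → ℕ
  mB : ℕ → ℕ

/-- The registers that hold the sizes, the input arrays, and fresh memory from the offset on. -/
structure Ready (z : Sizes) (s : RamState) : Prop where
  r0 : s.reg 0 = z.n
  r1 : s.reg 1 = z.m
  r2 : s.reg 2 = z.d
  r3 : s.reg 3 = 1
  r4 : s.reg 4 = z.N
  r5 : s.reg 5 = z.M
  r6 : s.reg 6 = z.qA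
  r7 : s.reg 7 = z.qB
  r8 : s.reg 8 = z.W₀
  r23 : s.reg 23 = 0
  m0 : s.mem 0 = z.mA
  m1 : s.mem 1 = z.mB
  fresh : ∀ a i, s.reg 9 ≤ i → s.mem (a + 2) i = 0

/-- The relations between the sizes that the program needs. -/
structure Sizes.Good (z : Sizes) (W : ℕ) : Prop where
  hN : z.N < z.W₀
  hM : z.M < z.W₀
  hA : 31 + z.qA * (6 * z.d + 10) ≤ z.N
  hB : 1 + z.qB * (6 * z.d + 18) ≤ z.M
  qA : 0 < z.qA
  qB : 0 < z.qB
  hW : 100 ≤ W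

/-- The program `p` computes the distance of all pairs of walks of the right lengths. -/
def ComputesFrechet (p : RamProg) (W₀ M N Tp : ℕ) : Prop :=
  ∀ P Q : List (Fin 50), IsVertexWalk gadgetGraph P → IsVertexWalk gadgetGraph Q →
    P.length = M → Q.length = N → ∃ t s,
      RamExec W₀ p (ramInput [M, N] (P.map fun v : Fin 50 => (v : ℕ)) (Q.map fun v : Fin 50 => (v : ℕ))) t s ∧
        t ≤ Tp ∧ (s.reg 0 : ℝ) = discreteFrechet gadgetGraph 1 P Q

/-- Some vector of `A` is orthogonal to some vector of `B`. -/
def HasPair (A B : List (List Bool)) : Prop := ∃ a ∈ A, ∃ b ∈ B, ListOrthogonal a b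

/-- Handle a group of vectors of the second list, given a group of vectors of the first list. -/
def pairStep (p : RamProg) (b : ℕ) : RamProg :=
  .seq (.op .sub 16 7 15) (.seq (.op .sub 16 7 16)
  (.seq (.op .add 18 11 23) (.seq (.op .add 19 13 23) (.seq (emitWalk natGadget₂ 0 3 4)
  (.seq (.op .add 18 14 23) (.seq (.op .add 19 16 23) (.seq (emitWalk natGadget₁ 1 2 5)
  (.seq (.op .add 14 18 23) (.seq (callProg p b)
  (.seq (.const 21 20) (.seq (.op .sub 21 21 25) (.seq (.ite 21 (.const 10 1) .skip)
  (.seq (.op .add 9 9 8) (.op .sub 15 15 16))))))))))))))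

/-- A bound for the time of `pairStep`. -/
def pairTime (z : Sizes) (b Tp : ℕ) : ℕ := 16 * z.N + 16 * z.M + 2 * Tp + b + 70

theorem writeList_fresh {m : ℕ → ℕ} {off : ℕ} (h : ∀ i, off ≤ i → m i = 0) (l : List ℕ) (i : ℕ) :
    writeList m off l (off + i) = l.getD i 0 := by
  rw [writeList, if_pos (by omega), h _ (by omega), Nat.add_sub_cancel_left,
    List.getD_eq_getElem?_getD]

-- In the relation between the sizes the roles are exchanged: the group from `A` becomes the second
-- walk and the group from `B` the first one. Moving the offset by `W₀` leaves the used window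
-- behind, and the next call finds zeros only.
open Classical in
theorem runs_pairStep {W b Tp : ℕ} {p : RamProg} {z : Sizes} (hz : z.Good W) (hp : p.RegsBelow b)
    (hb : 2 ≤ b) (hF : ComputesFrechet p z.W₀ z.M z.N Tp) {A B : List (List Bool)}
    (hA : ∀ a ∈ A, a.length = z.d) (hB : ∀ b ∈ B, b.length = z.d) (hA₀ : A ≠ []) (hB₀ : B ≠ [])
    (hAq : A.length ≤ z.qA) {s : RamState} (hs : Ready z s)
    (hmA : HoldsBits z.mA (s.reg 11) A) (hmB : HoldsBits z.mB (s.reg 14) B)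
    (h13 : s.reg 13 = A.length) (h15 : s.reg 15 = B.length) (h9 : s.reg 9 + 2 * z.W₀ < W)
    (h11 : s.reg 11 + A.length * z.d < W) (h14 : s.reg 14 + B.length * z.d < W)
    (hBW : B.length < W) :
    Runs W (pairStep p b) s (pairTime z b Tp) fun s' => Ready z s' ∧
      s'.reg 9 = s.reg 9 + z.W₀ ∧ (∀ x, x = 11 ∨ x = 12 ∨ x = 13 → s'.reg x = s.reg x) ∧
      s'.reg 14 = s.reg 14 + min z.qB B.length * z.d ∧
      s'.reg 15 = B.length - min z.qB B.length ∧
      s'.reg 10 = if HasPair (B.take z.qB) A then 1 else s.reg 10 := by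
  obtain ⟨hN, hM, hAN, hBM, hqA, hqB, hW⟩ := hz
  obtain ⟨hG1, hG2⟩ := natGadget_below hW
  set B' := B.take z.qB with hB'
  have hBlen : B'.length = min z.qB B.length := List.length_take
  have hBd : ∀ b ∈ B', b.length = z.d := fun b hb => hB b (List.mem_of_mem_take hb)
  have hB'₀ : B' ≠ [] := by
    intro h
    have h1 := List.length_pos_iff.2 hB₀
    rw [h, List.length_nil] at hBlen
    omega
  have hAX : A.length * (6 * z.d + 10) ≤ z.qA * (6 * z.d + 10) := Nat.mul_le_mul_right _ hAq
  have hBX : B'.length * (6 * z.d + 18) ≤ z.qB * (6 * z.d + 18) :=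
    Nat.mul_le_mul_right _ (by omega)
  have hAle : A.length ≤ A.length * (6 * z.d + 10) := Nat.le_mul_of_pos_right _ (by omega)
  have hBle : B'.length ≤ B'.length * (6 * z.d + 18) := Nat.le_mul_of_pos_right _ (by omega)
  have hqAle : z.qA ≤ z.qA * (6 * z.d + 10) := Nat.le_mul_of_pos_right _ (by omega)
  have hqBle : z.qB ≤ z.qB * (6 * z.d + 18) := Nat.le_mul_of_pos_right _ (by omega)
  have hBd' : B'.length * z.d ≤ B.length * z.d := Nat.mul_le_mul_right _ (by omega)
  set P := gadget₁.walk B' (z.M - (1 + B'.length * (6 * z.d + 18))) with hP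
  set Q := gadget₂.walk A (z.N - (31 + A.length * (6 * z.d + 10))) with hQ
  have hPlen : P.length = z.M := by rw [hP, length_walk_gadget₁ hBd]; omega
  have hQlen : Q.length = z.N := by rw [hQ, length_walk_gadget₂ hA]; omega
  obtain ⟨t, s₀, hex, ht, hres⟩ := hF P Q (isVertexWalk_gadget₁ _ _) (isVertexWalk_gadget₂ _ _)
    hPlen hQlen
  -- With unit weights the distance is an integer and the threshold is 19; the program tests `20 -
  -- dist ≠ 0`.
  have hres' : s₀.reg 0 ≤ 19 ↔ HasPair B' A := by
    have := discreteFrechet_gadget_le_iff hBd hA hB'₀ hA₀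
      (z.M - (1 + B'.length * (6 * z.d + 18))) (z.N - (31 + A.length * (6 * z.d + 10))) one_pos
    rw [← hP, ← hQ, ← hres, one_mul] at this
    rw [HasPair, ← this]
    norm_cast
  refine Runs.mono (T := 1 + (1 + (1 + (1 + ((16 * z.N + 20) + (1 + (1 + ((16 * z.M + 20) +
    (1 + ((b + 3 + 2 * Tp) + (1 + (1 + ((1 + 1) + (1 + 1)))))))))))))) ?_
    (by unfold pairTime; omega) fun _ h => h
  -- Truncated subtraction twice computes a minimum: `q - (q - l) = min q l`.
  refine Runs.op_seq (v := z.qB - B.length) (by rw [hs.r7, h15]; rfl) (by omega)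
    (Runs.op_seq (v := B'.length) ?_ (by omega) (Runs.op_seq (v := s.reg 11) ?_ (by omega)
      (Runs.op_seq (v := A.length) ?_ (by omega) ?_)))
  · simp [RamState.setReg_reg, hs.r7, WordOp.eval]; omega
  · simp [RamState.setReg_reg, hs.r23, WordOp.eval]
  · simp [RamState.setReg_reg, hs.r23, h13, WordOp.eval]
  set s₁ := (((s.setReg 16 (z.qB - B.length)).setReg 16 B'.length).setReg 18 (s.reg 11)).setReg 19
    A.length with hs₁
  have h₁r : ∀ x < 16, s₁.reg x = s.reg x := by
    intro x hx
    simp only [hs₁, RamState.setReg_reg]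
    rw [if_neg (by omega), if_neg (by omega), if_neg (by omega), if_neg (by omega)]
  have h₁m : s₁.mem = s.mem := rfl
  have h₁23 : s₁.reg 23 = 0 := by simp [hs₁, RamState.setReg_reg, hs.r23]
  have h₁16 : s₁.reg 16 = B'.length := by simp [hs₁, RamState.setReg_reg]
  have h₁18 : s₁.reg 18 = s.reg 11 := by simp [hs₁, RamState.setReg_reg]
  have h₁19 : s₁.reg 19 = A.length := by simp [hs₁, RamState.setReg_reg]
  refine Runs.seq ((runs_emitWalk (src := 0) (dst := 3) (len := 4) (c := 31) (e := 10)
    (N := z.N) (off := s.reg 9) hG2 (by decide) rfl rfl (by omega)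
    (by omega) (by omega) (s := s₁) hA (by rw [h₁r 2 (by omega), hs.r2]) h₁23
    (by rw [h₁r 3 (by omega), hs.r3]) (h₁r 9 (by omega)) (by rw [h₁r 4 (by omega), hs.r4])
    (by omega) (by omega) h₁19 (by omega) (by omega)
    (by rw [h₁m, hs.m0, h₁18]; exact hmA)).mono (by omega) fun _ h => h) ?_
  rintro s₂ ⟨-, h₂r, h₂m⟩
  clear_value s₁
  refine Runs.op_seq (v := s.reg 14) ?_ (by omega) (Runs.op_seq (v := B'.length) ?_ (by omega) ?_)
  · rw [h₂r 14 (by omega), h₂r 23 (by omega), h₁r 14 (by omega), h₁23]; rfl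
  · simp [RamState.setReg_reg, h₂r 16, h₂r 23, h₁16, h₁23, WordOp.eval]
  set s₃ := (s₂.setReg 18 (s.reg 14)).setReg 19 B'.length with hs₃
  have h₃r : ∀ x < 16, s₃.reg x = s.reg x := by
    intro x hx
    rw [hs₃, RamState.setReg_reg, if_neg (by omega), RamState.setReg_reg, if_neg (by omega),
      h₂r x (by omega), h₁r x hx]
  have h₃16 : s₃.reg 16 = B'.length := by simp [hs₃, RamState.setReg_reg, h₂r 16, h₁16]
  have h₃18 : s₃.reg 18 = s.reg 14 := by simp [hs₃, RamState.setReg_reg]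
  have h₃19 : s₃.reg 19 = B'.length := by simp [hs₃, RamState.setReg_reg]
  have h₃23 : s₃.reg 23 = 0 := by simp [hs₃, RamState.setReg_reg, h₂r 23, h₁23]
  have h₃m : s₃.mem = s₂.mem := rfl
  clear_value s₃
  refine Runs.seq ((runs_emitWalk (src := 1) (dst := 2) (len := 5) (c := 1) (e := 18)
    (N := z.M) (off := s.reg 9) hG1 (by decide) rfl rfl (by omega)
    (by omega) (by omega) (s := s₃) hBd (by rw [h₃r 2 (by omega), hs.r2]) h₃23
    (by rw [h₃r 3 (by omega), hs.r3]) (h₃r 9 (by omega)) (by rw [h₃r 5 (by omega), hs.r5])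
    (by omega) (by omega) h₃19 (by omega) (by omega) ?_).mono (by omega) fun _ h => h) ?_
  · rw [h₃m, h₂m, Function.update_of_ne (by omega), h₁m, hs.m1, h₃18]; exact hmB.take _
  rintro s₄ ⟨h₄18, h₄r, h₄m⟩
  refine Runs.op_seq (v := s.reg 14 + B'.length * z.d) ?_ (by omega) ?_
  · rw [h₄18, h₄r 23 (by omega), h₃18, h₃23]; rfl
  set s₅ := s₄.setReg 14 (s.reg 14 + B'.length * z.d) with hs₅
  have h₅r : ∀ x < 16, x ≠ 14 → s₅.reg x = s.reg x := by
    intro x hx hx'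
    rw [hs₅, RamState.setReg_reg, if_neg hx', h₄r x (by omega), h₃r x hx]
  have h₅14 : s₅.reg 14 = s.reg 14 + B'.length * z.d := by simp [hs₅, RamState.setReg_reg]
  have h₅16 : s₅.reg 16 = B'.length := by simp [hs₅, RamState.setReg_reg, h₄r 16, h₃16]
  have h₅23 : s₅.reg 23 = 0 := by simp [hs₅, RamState.setReg_reg, h₄r 23, h₃23]
  have h₅m : s₅.mem = Function.update (Function.update s.mem 3 (writeList (s.mem 3) (s.reg 9)
      (Q.map fun v : Fin 50 => (v : ℕ)))) 2 (writeList (s.mem 2) (s.reg 9) (P.map fun v : Fin 50 => (v : ℕ))) := by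
    have : s₅.mem = s₄.mem := rfl
    rw [this, h₄m, h₃m, h₂m, h₁m, Function.update_of_ne (by omega : (2 : ℕ) ≠ 3), hP, hQ,
      WalkGadget.map_walk, WalkGadget.map_walk]; rfl
  clear_value s₅
  refine Runs.seq (runs_callProg hp hb hex ht hM hN (by rw [h₅r 4 (by omega) (by omega), hs.r4])
    (by rw [h₅r 5 (by omega) (by omega), hs.r5]) h₅23
    (by rw [h₅r 9 (by omega) (by omega)]; omega) ?_) ?_
  · intro a i hi
    rw [h₅r 9 (by omega) (by omega), h₅m]
    rcases a with _ | _ | a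
    · rw [Function.update_self, writeList_fresh (hs.fresh 0)]; simp [ramInput]
    · rw [Function.update_of_ne (by omega), Function.update_self, writeList_fresh (hs.fresh 1)]
      simp [ramInput]
    · rw [Function.update_of_ne (by omega), Function.update_of_ne (by omega),
        hs.fresh _ _ (by omega)]
      simp [ramInput]
  rintro s₆ ⟨h₆25, h₆r, h₆0, h₆1, h₆f⟩
  have h₆r' : ∀ x < 16, x ≠ 14 → s₆.reg x = s.reg x := fun x hx hx' => by
    rw [h₆r x (by omega), h₅r x hx hx']
  refine Runs.const_seq (by omega) (Runs.op_seq (v := 20 - s₀.reg 0) ?_ (by omega) (Runs.seq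
    (Q := fun s₇ => (∀ x < 24, x ≠ 10 → x ≠ 21 → s₇.reg x = s₆.reg x) ∧ s₇.mem = s₆.mem ∧
      s₇.reg 10 = if HasPair B' A then 1 else s.reg 10) (Runs.ite ?_ ?_) ?_))
  · simp [RamState.setReg_reg, h₆25, WordOp.eval]
  · intro h
    have h' : HasPair B' A := by
      rw [← hres']
      simp [RamState.setReg_reg] at h; omega
    refine Runs.const (by omega) ⟨fun x hx hx1 hx2 => ?_, rfl, ?_⟩
    · simp [RamState.setReg_reg, hx1, hx2]
    · simp [RamState.setReg_reg, h']
  · intro h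
    have h' : ¬ HasPair B' A := by
      rw [← hres']
      simp [RamState.setReg_reg] at h; omega
    refine Runs.skip ⟨fun x hx hx1 hx2 => ?_, rfl, ?_⟩
    · simp [RamState.setReg_reg, hx2]
    · simp [RamState.setReg_reg, h', h₆r' 10]
  rintro s₇ ⟨h₇r, h₇m, h₇10⟩
  have h₇r' : ∀ x < 16, x ≠ 10 → x ≠ 14 → s₇.reg x = s.reg x := fun x hx h1 h2 => by
    rw [h₇r x (by omega) h1 (by omega), h₆r' x hx h2]
  have h₇14 : s₇.reg 14 = s.reg 14 + B'.length * z.d := by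
    rw [h₇r 14 (by omega) (by omega) (by omega), h₆r 14 (by omega), h₅14]
  have h₇16 : s₇.reg 16 = B'.length := by
    rw [h₇r 16 (by omega) (by omega) (by omega), h₆r 16 (by omega), h₅16]
  have h₇23 : s₇.reg 23 = 0 := by
    rw [h₇r 23 (by omega) (by omega) (by omega), h₆r 23 (by omega), h₅23]
  refine Runs.op_seq (v := s.reg 9 + z.W₀) ?_ (by omega) (Runs.op ?_ ?_)
  · rw [h₇r' 9 (by omega) (by omega) (by omega), h₇r' 8 (by omega) (by omega) (by omega), hs.r8]
    rfl
  · simp [RamState.setReg_reg, h₇r' 15, h15, h₇16, WordOp.eval]; omega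
  have e15 : WordOp.eval .sub ((s₇.setReg 9 (s.reg 9 + z.W₀)).reg 15)
      ((s₇.setReg 9 (s.reg 9 + z.W₀)).reg 16) = B.length - min z.qB B.length := by
    simp [RamState.setReg_reg, h₇r' 15, h15, h₇16, hBlen, WordOp.eval]
  rw [e15]
  have hfin : ∀ x < 16, x ≠ 9 → x ≠ 10 → x ≠ 14 → x ≠ 15 →
      ((s₇.setReg 9 (s.reg 9 + z.W₀)).setReg 15 (B.length - min z.qB B.length)).reg x =
        s.reg x := by
    intro x h1 h2 h3 h4 h5
    simp [RamState.setReg_reg, h2, h5, h₇r' x h1 h3 h4]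
  refine ⟨⟨?_, ?_, ?_, ?_, ?_, ?_, ?_, ?_, ?_, ?_, ?_, ?_, ?_⟩, ?_, ?_, ?_, ?_, ?_⟩
  · rw [hfin 0 (by omega) (by omega) (by omega) (by omega) (by omega), hs.r0]
  · rw [hfin 1 (by omega) (by omega) (by omega) (by omega) (by omega), hs.r1]
  · rw [hfin 2 (by omega) (by omega) (by omega) (by omega) (by omega), hs.r2]
  · rw [hfin 3 (by omega) (by omega) (by omega) (by omega) (by omega), hs.r3]
  · rw [hfin 4 (by omega) (by omega) (by omega) (by omega) (by omega), hs.r4]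
  · rw [hfin 5 (by omega) (by omega) (by omega) (by omega) (by omega), hs.r5]
  · rw [hfin 6 (by omega) (by omega) (by omega) (by omega) (by omega), hs.r6]
  · rw [hfin 7 (by omega) (by omega) (by omega) (by omega) (by omega), hs.r7]
  · rw [hfin 8 (by omega) (by omega) (by omega) (by omega) (by omega), hs.r8]
  · simp [RamState.setReg_reg, h₇23]
  · simp only [RamState.setReg_mem]
    rw [h₇m, h₆0, h₅m, Function.update_of_ne (by omega), Function.update_of_ne (by omega), hs.m0]
  · simp only [RamState.setReg_mem]
    rw [h₇m, h₆1, h₅m, Function.update_of_ne (by omega), Function.update_of_ne (by omega), hs.m1]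
  -- Both walks are shorter than `W₀`, and the subroutine stays in its window, so everything beyond
  -- it is still zero.
  · intro a i hi
    simp only [RamState.setReg_reg] at hi
    norm_num at hi
    simp only [RamState.setReg_mem]
    rw [h₇m, h₆f a i (by rw [h₅r 9 (by omega) (by omega)]; exact hi), h₅m]
    obtain ⟨j, rfl⟩ := Nat.exists_eq_add_of_le hi
    rcases a with _ | _ | a
    · rw [Function.update_self, add_assoc, writeList_fresh (hs.fresh 0),
        List.getD_eq_default _ _ (by rw [List.length_map, hPlen]; omega)]
    · rw [Function.update_of_ne (by omega), Function.update_self, add_assoc,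
        writeList_fresh (hs.fresh 1),
        List.getD_eq_default _ _ (by rw [List.length_map, hQlen]; omega)]
    · rw [Function.update_of_ne (by omega), Function.update_of_ne (by omega),
        hs.fresh _ _ (by omega)]
  · simp [RamState.setReg_reg]
  · rintro x (rfl | rfl | rfl) <;>
      exact hfin _ (by omega) (by omega) (by omega) (by omega) (by omega)
  · simp [RamState.setReg_reg, h₇14, hBlen]
  · simp [RamState.setReg_reg]
  · simp [RamState.setReg_reg, h₇10]

/-! ### All pairs of groups -/

theorem HasPair.append_left_iff {A A' B : List (List Bool)} :
    HasPair (A ++ A') B ↔ HasPair A B ∨ HasPair A' B := by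
  simp only [HasPair, List.mem_append, or_and_right, exists_or]

theorem HasPair.append_right_iff {A B B' : List (List Bool)} :
    HasPair A (B ++ B') ↔ HasPair A B ∨ HasPair A B' := by
  simp only [HasPair, List.mem_append, or_and_right, exists_or, and_or_left]

theorem HasPair.comm {A B : List (List Bool)} : HasPair A B ↔ HasPair B A := by
  have h : ∀ {A B : List (List Bool)}, HasPair A B → HasPair B A := by
    rintro A B ⟨a, ha, b, hb, h⟩
    exact ⟨b, hb, a, ha, fun i hi => h i hi.symm⟩
  exact ⟨h, h⟩

/-- The number of groups of at most `q` elements that `l` elements are split into. -/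
def groups (l q : ℕ) : ℕ := (l + q - 1) / q

/-- Each pass of a loop uses up one group, possibly a shorter last one; this drives the recursion
for the time. -/
theorem groups_step {l q : ℕ} (hq : 0 < q) (hl : 0 < l) : groups (l - q) q + 1 ≤ groups l q := by
  unfold groups
  rcases Nat.lt_or_ge l q with h | h
  · rw [Nat.sub_eq_zero_of_le h.le, Nat.div_eq_of_lt (by omega), zero_add, Nat.one_le_div_iff hq]
    omega
  · rw [show l + q - 1 = l - q + q - 1 + q by omega, Nat.add_div_right _ hq]

theorem groups_le {l q : ℕ} (hq : 0 < q) : groups l q ≤ l / q + 1 := by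
  unfold groups
  rw [← Nat.add_div_right _ hq]
  exact Nat.div_le_div_right (by omega)

/-- Handle all groups of the second list. -/
def groupStep (p : RamProg) (b : ℕ) : RamProg := .loop 15 (pairStep p b)

/-- A bound for the time of `groupStep`. -/
def groupTime (z : Sizes) (b Tp l : ℕ) : ℕ := groups l z.qB * (pairTime z b Tp + 1) + 1

-- A pass removes a whole group, hence strong induction. It handles at least one vector, so at most
-- `l` windows are used up.
open Classical in
theorem runs_groupStep {W b Tp : ℕ} {p : RamProg} {z : Sizes} (hz : z.Good W) (hp : p.RegsBelow b)
    (hb : 2 ≤ b) (hF : ComputesFrechet p z.W₀ z.M z.N Tp) {A : List (List Bool)}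
    (hA : ∀ a ∈ A, a.length = z.d) (hA₀ : A ≠ []) (hAq : A.length ≤ z.qA) (l : ℕ) :
    ∀ (B : List (List Bool)) (s : RamState), B.length = l → (∀ b ∈ B, b.length = z.d) →
    Ready z s → HoldsBits z.mA (s.reg 11) A → HoldsBits z.mB (s.reg 14) B →
    s.reg 13 = A.length → s.reg 15 = B.length → s.reg 9 + (l + 1) * z.W₀ < W →
    s.reg 11 + A.length * z.d < W → s.reg 14 + l * z.d < W → l < W →
    Runs W (groupStep p b) s (groupTime z b Tp l) fun s' => Ready z s' ∧
      s'.reg 9 ≤ s.reg 9 + l * z.W₀ ∧ (∀ x, x = 11 ∨ x = 12 ∨ x = 13 → s'.reg x = s.reg x) ∧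
      s'.reg 10 = if HasPair B A then 1 else s.reg 10 := by
  induction l using Nat.strong_induction_on with
  | _ l ih =>
    intro B s hl hB hs hmA hmB h13 h15 h9 h11 h14 hlW
    by_cases hB₀ : B = []
    · subst hB₀
      refine (Runs.loop_done h15 ⟨hs, by omega, fun _ _ => rfl, ?_⟩).mono
        (by unfold groupTime; omega) fun _ h => h
      simp [HasPair]
    have hl₀ : 0 < l := hl ▸ List.length_pos_iff.2 hB₀
    have hqB := hz.qB
    have hstep := groups_step hqB hl₀
    have h9' : 2 * z.W₀ ≤ (l + 1) * z.W₀ := Nat.mul_le_mul_right _ (by omega)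
    refine Runs.mono (T := pairTime z b Tp + 1 + groupTime z b Tp (l - z.qB)) ?_ ?_ fun _ h => h
    · refine Runs.loop_step (by omega) (runs_pairStep hz hp hb hF hA hB hA₀ hB₀ hAq hs hmA hmB h13
        h15 (by omega) h11 (by rw [hl]; exact h14) (by omega)) ?_
      rintro s₁ ⟨h₁, h₁9, h₁r, h₁14, h₁15, h₁10⟩
      have hl' : (l - z.qB + 1 + 1) * z.W₀ ≤ (l + 1) * z.W₀ := Nat.mul_le_mul_right _ (by omega)
      have hl'' : (min z.qB l + (l - z.qB)) * z.d = l * z.d := by congr 1; omega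
      rw [add_mul] at hl''
      rw [add_mul, one_mul] at hl'
      refine (ih (l - z.qB) (by omega) (B.drop z.qB) s₁ (by simp [hl])
        (fun b hb => hB b (List.mem_of_mem_drop hb)) h₁ (by rwa [h₁r 11 (by omega)]) ?_
        (by rw [h₁r 13 (by omega), h13]) (by rw [h₁15, List.length_drop]; omega)
        (by rw [h₁9]; omega) (by rwa [h₁r 11 (by omega)])
        (by rw [h₁14, hl]; omega) (by omega)).mono le_rfl ?_
      -- The last group may have fewer than `qB` vectors; dropping the minimum leaves the same list.
      · have := hmB.drop hB (min z.qB B.length) (by omega)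
        rw [h₁14]
        convert this using 1
        rcases le_total z.qB B.length with h | h
        · rw [min_eq_left h]
        · rw [min_eq_right h, List.drop_eq_nil_of_le h, List.drop_length]
      · rintro s₂ ⟨h₂, h₂9, h₂r, h₂10⟩
        have hl3 : (l - z.qB + 1) * z.W₀ ≤ l * z.W₀ := Nat.mul_le_mul_right _ (by omega)
        rw [add_mul, one_mul] at hl3
        refine ⟨h₂, by omega, fun x hx => by rw [h₂r x hx, h₁r x hx], ?_⟩
        rw [h₂10, h₁10]
        have := HasPair.append_left_iff (A := B.take z.qB) (A' := B.drop z.qB) (B := A)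
        rw [List.take_append_drop] at this
        by_cases h1 : HasPair (B.take z.qB) A <;> by_cases h2 : HasPair (B.drop z.qB) A <;>
          simp [this, h1, h2]
    · unfold groupTime
      calc _ = (groups (l - z.qB) z.qB + 1) * (pairTime z b Tp + 1) + 1 := by ring
        _ ≤ _ := by gcongr

/-- Handle all pairs of groups. -/
def allPairs (p : RamProg) (b : ℕ) : RamProg :=
  .loop 12 (.seq (.op .sub 13 6 12) (.seq (.op .sub 13 6 13) (.seq (.const 14 0)
    (.seq (.op .add 15 1 23) (.seq (groupStep p b) (.seq (.op .mul 21 13 2)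
      (.seq (.op .add 11 11 21) (.op .sub 12 12 13))))))))

/-- A bound for the time of `allPairs`. -/
def allPairsTime (z : Sizes) (b Tp l : ℕ) : ℕ :=
  groups l z.qA * (groupTime z b Tp z.m + 8) + 1

theorem Ready.congr {z : Sizes} {s s' : RamState} (h : Ready z s)
    (hr : ∀ x, x < 10 ∨ x = 23 → s'.reg x = s.reg x) (hm : s'.mem = s.mem) : Ready z s' := by
  obtain ⟨h0, h1, h2, h3, h4, h5, h6, h7, h8, h23, hm0, hm1, hf⟩ := h
  refine ⟨?_, ?_, ?_, ?_, ?_, ?_, ?_, ?_, ?_, ?_, ?_, ?_, ?_⟩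
  all_goals first | rwa [hr _ (by omega)] | rwa [hm] | skip
  intro a i hi
  rw [hr 9 (by omega)] at hi
  rw [hm, hf a i hi]

-- Every group is nonempty, so `l * m` windows suffice for all pairs of groups; this fixes the
-- number of cells that words must address.
open Classical in
theorem runs_allPairs {W b Tp : ℕ} {p : RamProg} {z : Sizes} (hz : z.Good W) (hp : p.RegsBelow b)
    (hb : 2 ≤ b) (hF : ComputesFrechet p z.W₀ z.M z.N Tp) {B : List (List Bool)}
    (hB : ∀ b ∈ B, b.length = z.d) (hBm : B.length = z.m) (hmB : HoldsBits z.mB 0 B)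
    (hmd : z.m * z.d < W) (hmW : z.m < W) (hq : z.qA * z.d < W) (l : ℕ) :
    ∀ (A : List (List Bool)) (s : RamState), A.length = l → (∀ a ∈ A, a.length = z.d) →
    Ready z s → HoldsBits z.mA (s.reg 11) A → s.reg 12 = A.length →
    s.reg 9 + (l * z.m + 1) * z.W₀ < W → s.reg 11 + l * z.d < W → l < W →
    Runs W (allPairs p b) s (allPairsTime z b Tp l) fun s' =>
      s'.reg 23 = 0 ∧ s'.reg 10 = if HasPair B A then 1 else s.reg 10 := by
  induction l using Nat.strong_induction_on with
  | _ l ih =>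
    intro A s hl hA hs hmA h12 h9 h11 hlW
    by_cases hA₀ : A = []
    · subst hA₀
      refine (Runs.loop_done h12 ⟨hs.r23, ?_⟩).mono (by unfold allPairsTime; omega) fun _ h => h
      simp [HasPair]
    have hl₀ : 0 < l := hl ▸ List.length_pos_iff.2 hA₀
    have hqA := hz.qA
    have hqAW : z.qA < W := by
      have := hz.hA; have := hz.hN
      have : z.qA ≤ z.qA * (6 * z.d + 10) := Nat.le_mul_of_pos_right _ (by omega)
      have : z.W₀ ≤ (l * z.m + 1) * z.W₀ := Nat.le_mul_of_pos_left _ (by omega)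
      omega
    have hstep := groups_step hqA hl₀
    set A' := A.take z.qA with hA'
    have hA'len : A'.length = min z.qA l := by rw [hA', List.length_take, hl]
    have hA'₀ : A' ≠ [] := by
      rw [← List.length_pos_iff, hA'len]; omega
    have hlen : (min z.qA l + (l - z.qA)) * z.d = l * z.d := by congr 1; omega
    rw [add_mul] at hlen
    have hmin : min z.qA l * z.d ≤ z.qA * z.d := Nat.mul_le_mul_right _ (by omega)
    have hlm : ((l - z.qA) * z.m + z.m + 1) * z.W₀ ≤ (l * z.m + 1) * z.W₀ := by
      refine Nat.mul_le_mul_right _ ?_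
      have : (l - z.qA + 1) * z.m ≤ l * z.m := Nat.mul_le_mul_right _ (by omega)
      rw [add_mul, one_mul] at this
      omega
    have hlm' : (z.m + 1) * z.W₀ ≤ ((l - z.qA) * z.m + z.m + 1) * z.W₀ :=
      Nat.mul_le_mul_right _ (by omega)
    have e : ((l - z.qA) * z.m + z.m + 1) * z.W₀ =
      z.m * z.W₀ + ((l - z.qA) * z.m + 1) * z.W₀ := by ring
    refine Runs.mono (T := (1 + (1 + (1 + (1 + (groupTime z b Tp z.m + (1 + (1 + 1))))))) + 1 +
      allPairsTime z b Tp (l - z.qA)) ?_ ?_ fun _ h => h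
    · refine Runs.loop_step (Q := fun s₁ => Ready z s₁ ∧ s₁.reg 9 ≤ s.reg 9 + z.m * z.W₀ ∧
        s₁.reg 11 = s.reg 11 + min z.qA l * z.d ∧ s₁.reg 12 = l - z.qA ∧
        s₁.reg 10 = if HasPair B A' then 1 else s.reg 10) (by omega) ?_ ?_
      · refine Runs.op_seq (v := z.qA - l) (by rw [hs.r6, h12, hl]; rfl) (by omega)
          (Runs.op_seq (v := A'.length) ?_ (by omega) (Runs.const_seq (by omega)
            (Runs.op_seq (v := z.m) ?_ (by omega) ?_)))
        · simp [RamState.setReg_reg, hs.r6, WordOp.eval]; omega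
        · simp [RamState.setReg_reg, hs.r1, hs.r23, WordOp.eval]
        set s₁ := (((s.setReg 13 (z.qA - l)).setReg 13 A'.length).setReg 14 0).setReg 15 z.m with hs₁
        have h₁r : ∀ x, x < 13 ∨ x = 23 → s₁.reg x = s.reg x := by
          intro x hx
          rw [hs₁]
          simp only [RamState.setReg_reg]
          rw [if_neg (by omega), if_neg (by omega), if_neg (by omega), if_neg (by omega)]
        have h₁13 : s₁.reg 13 = A'.length := by simp [hs₁, RamState.setReg_reg]
        have h₁14 : s₁.reg 14 = 0 := by simp [hs₁, RamState.setReg_reg]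
        have h₁15 : s₁.reg 15 = z.m := by simp [hs₁, RamState.setReg_reg]
        have h₁m : s₁.mem = s.mem := rfl
        clear_value s₁
        have h₁ : Ready z s₁ := hs.congr (fun x hx => h₁r x (by omega)) h₁m
        refine Runs.seq (runs_groupStep hz hp hb hF (A := A')
          (fun a ha => hA a (List.mem_of_mem_take ha)) hA'₀ (by omega) z.m B s₁ hBm hB h₁
          (by rw [h₁r 11 (by omega)]; exact hmA.take _) (by rwa [h₁14]) h₁13 (by rw [h₁15, hBm])
          (by rw [h₁r 9 (by omega)]; omega) (by rw [h₁r 11 (by omega), hA'len]; omega)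
          (by rw [h₁14]; omega) hmW) ?_
        rintro s₂ ⟨h₂, h₂9, h₂r, h₂10⟩
        have h₂13 : s₂.reg 13 = min z.qA l := by rw [h₂r 13 (by omega), h₁13, hA'len]
        have h₂11 : s₂.reg 11 = s.reg 11 := by rw [h₂r 11 (by omega), h₁r 11 (by omega)]
        have h₂12 : s₂.reg 12 = l := by rw [h₂r 12 (by omega), h₁r 12 (by omega), h12, hl]
        rw [h₁r 9 (by omega)] at h₂9
        rw [h₁r 10 (by omega)] at h₂10
        refine Runs.op_seq (v := min z.qA l * z.d) (by rw [h₂13, h₂.r2]; rfl) (by omega)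
          (Runs.op_seq (v := s.reg 11 + min z.qA l * z.d) ?_ (by omega) (Runs.op ?_ ?_))
        · simp [RamState.setReg_reg, h₂11, WordOp.eval]
        · simp [RamState.setReg_reg, h₂12, h₂13, WordOp.eval]; omega
        refine ⟨h₂.congr (fun x hx => ?_) rfl, ?_, ?_, ?_, ?_⟩
        · simp only [RamState.setReg_reg]
          rw [if_neg (by omega), if_neg (by omega), if_neg (by omega)]
        · simpa [RamState.setReg_reg] using h₂9
        · simp [RamState.setReg_reg]
        · simp [RamState.setReg_reg, h₂12, h₂13, WordOp.eval]; omega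
        · simpa [RamState.setReg_reg] using h₂10
      · rintro s₁ ⟨h₁, h₁9, h₁11, h₁12, h₁10⟩
        refine (ih (l - z.qA) (by omega) (A.drop z.qA) s₁ (by simp [hl])
          (fun a ha => hA a (List.mem_of_mem_drop ha)) h₁ ?_
          (by rw [h₁12, List.length_drop, hl]) (by omega) (by omega) (by omega)).mono le_rfl ?_
        · have := hmA.drop hA (min z.qA A.length) (by omega)
          rw [h₁11, ← hl]
          convert this using 1
          rcases le_total z.qA A.length with h | h
          · rw [min_eq_left h]
          · rw [min_eq_right h, List.drop_eq_nil_of_le h, List.drop_length]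
        · rintro s₂ ⟨h₂, h₂10⟩
          refine ⟨h₂, ?_⟩
          rw [h₂10, h₁10]
          have := HasPair.append_right_iff (A := B) (B := A.take z.qA) (B' := A.drop z.qA)
          rw [List.take_append_drop] at this
          by_cases h1 : HasPair B (A.take z.qA) <;> by_cases h2 : HasPair B (A.drop z.qA) <;>
            simp [this, h1, h2, hA']
    · unfold allPairsTime
      calc _ = (groups (l - z.qA) z.qA + 1) * (groupTime z b Tp z.m + 8) + 1 := by ring
        _ ≤ _ := by gcongr

/-! ### Computing the sizes, and the complete program -/

/-- Multiply register `8` by the `k`-th power of register `21`. -/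
def powProg : ℕ → RamProg
  | 0 => .skip
  | k + 1 => .seq (.op .mul 8 8 21) (powProg k)

theorem runs_powProg {W c : ℕ} (hc : 0 < c) (k : ℕ) : ∀ {s : RamState} {v : ℕ}, s.reg 8 = v →
    s.reg 21 = c → v * c ^ k < W →
    Runs W (powProg k) s (k + 1) fun s' => s'.mem = s.mem ∧ s'.reg 8 = v * c ^ k ∧
      ∀ x ≠ 8, s'.reg x = s.reg x := by
  induction k with
  | zero => intro s v h8 _ _; exact Runs.skip ⟨rfl, by simpa using h8, fun _ _ => rfl⟩
  | succ k ih =>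
    intro s v h8 h21 hW
    rw [pow_succ', ← mul_assoc] at hW
    have h1 : v * c ≤ v * c * c ^ k := Nat.le_mul_of_pos_right _ (Nat.pow_pos hc)
    refine Runs.mono (T := 1 + (k + 1)) (Runs.op_seq (v := v * c) (by rw [h8, h21]; rfl) (by omega)
      ((ih (v := v * c) (by simp [RamState.setReg_reg]) (by simp [RamState.setReg_reg, h21])
        hW).mono le_rfl ?_)) (by omega) fun _ h => h
    rintro s' ⟨h1, h2, h3⟩
    refine ⟨h1, by rw [h2, pow_succ', mul_assoc], fun x hx => ?_⟩
    rw [h3 x hx, RamState.setReg_reg, if_neg hx]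

/-- Put the lengths of the walks into the registers `4` and `5`: those of the two lists if the first
one has at least `n₀` elements, and `n₀` and `m₀` otherwise. -/
def sizesProg (n₀ m₀ : ℕ) : RamProg :=
  .seq (.const 3 1) (.seq (.const 21 n₀) (.seq (.op .sub 21 21 0)
    (.ite 21 (.seq (.const 4 n₀) (.const 5 m₀)) (.seq (.op .add 4 0 23) (.op .add 5 1 23)))))

theorem runs_sizesProg {W n₀ m₀ n m N M : ℕ} (h : n < n₀ → N = n₀ ∧ M = m₀)
    (h' : n₀ ≤ n → N = n ∧ M = m) (hW : 1 < W) (hn₀ : n₀ < W) (hm₀ : m₀ < W) (hN : N < W)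
    (hM : M < W) {s : RamState} (h0 : s.reg 0 = n) (h1 : s.reg 1 = m) (h23 : s.reg 23 = 0) :
    Runs W (sizesProg n₀ m₀) s 6 fun s' => s'.mem = s.mem ∧ s'.reg 3 = 1 ∧ s'.reg 4 = N ∧
      s'.reg 5 = M ∧ ∀ x, x < 3 ∨ 5 < x → x ≠ 21 → s'.reg x = s.reg x := by
  refine Runs.mono (T := 1 + (1 + (1 + (2 + 1)))) (Runs.const_seq hW (Runs.const_seq hn₀
    (Runs.op_seq (v := n₀ - n) ?_ (by omega) (Runs.ite ?_ ?_)))) (by omega) fun _ h => h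
  · simp [RamState.setReg_reg, h0, WordOp.eval]
  · intro hx
    simp only [RamState.setReg_reg, if_true] at hx
    obtain ⟨rfl, rfl⟩ := h (by omega)
    refine Runs.const_seq (T := 1) hN (Runs.const hM ⟨rfl, ?_, ?_, ?_, fun x hx hx' => ?_⟩)
    · simp [RamState.setReg_reg]
    · simp [RamState.setReg_reg]
    · simp [RamState.setReg_reg]
    · simp only [RamState.setReg_reg]
      rw [if_neg (by omega), if_neg (by omega), if_neg (by omega), if_neg (by omega),
        if_neg (by omega)]
  · intro hx
    simp only [RamState.setReg_reg, if_true] at hx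
    obtain ⟨rfl, rfl⟩ := h' (by omega)
    refine Runs.op_seq (T := 1) (v := N) ?_ hN (Runs.op ?_ ⟨rfl, ?_, ?_, ?_, fun x hx hx' => ?_⟩)
    · simp [RamState.setReg_reg, h0, h23, WordOp.eval]
    · simpa [RamState.setReg_reg, h1, h23, WordOp.eval] using hM
    · simp [RamState.setReg_reg]
    · simp [RamState.setReg_reg]
    · simp [RamState.setReg_reg, h1, h23, WordOp.eval]
    · simp only [RamState.setReg_reg]
      rw [if_neg (by omega), if_neg (by omega), if_neg (by omega), if_neg (by omega),
        if_neg (by omega)]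

/-- Compute the sizes of the groups. -/
def quotProg : RamProg :=
  .seq (.const 20 6) (.seq (.op .mul 20 20 2) (.seq (.const 21 31) (.seq (.op .sub 6 4 21)
  (.seq (.const 21 10) (.seq (.op .add 21 20 21) (.seq (.op .div 6 6 21) (.seq (.op .sub 7 5 3)
  (.seq (.const 21 18) (.seq (.op .add 21 20 21) (.op .div 7 7 21))))))))))

theorem runs_quotProg {W d N M : ℕ} (hN : 31 + (6 * d + 10) ≤ N) (hM : 1 + (6 * d + 18) ≤ M)
    (hNW : N < W) (hMW : M < W) {s : RamState} (h2 : s.reg 2 = d) (h3 : s.reg 3 = 1)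
    (h4 : s.reg 4 = N) (h5 : s.reg 5 = M) :
    Runs W quotProg s 11 fun s' => s'.mem = s.mem ∧ s'.reg 6 = (N - 31) / (6 * d + 10) ∧
      s'.reg 7 = (M - 1) / (6 * d + 18) ∧
      ∀ x, x < 6 ∨ 7 < x → x ≠ 20 → x ≠ 21 → s'.reg x = s.reg x := by
  have hA := Nat.div_le_self (N - 31) (6 * d + 10)
  have hB := Nat.div_le_self (M - 1) (6 * d + 18)
  refine Runs.mono (T := 1 + (1 + (1 + (1 + (1 + (1 + (1 + (1 + (1 + (1 + 1)))))))))) ?_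
    (by omega) fun _ h => h
  refine Runs.const_seq (by omega) (Runs.op_seq (v := 6 * d) ?_ (by omega)
    (Runs.const_seq (by omega) (Runs.op_seq (v := N - 31) ?_ (by omega)
    (Runs.const_seq (by omega) (Runs.op_seq (v := 6 * d + 10) ?_ (by omega)
    (Runs.op_seq (v := (N - 31) / (6 * d + 10)) ?_ (by omega)
    (Runs.op_seq (v := M - 1) ?_ (by omega)
    (Runs.const_seq (by omega) (Runs.op_seq (v := 6 * d + 18) ?_ (by omega)
    (Runs.op ?_ ⟨rfl, ?_, ?_, fun x hx hx1 hx2 => ?_⟩))))))))))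
  · simp [RamState.setReg_reg, h2, WordOp.eval]
  · simp [RamState.setReg_reg, h4, WordOp.eval]
  · simp [RamState.setReg_reg, WordOp.eval]
  · simp [RamState.setReg_reg, WordOp.eval]
  · simp [RamState.setReg_reg, h5, h3, WordOp.eval]
  · simp [RamState.setReg_reg, WordOp.eval]
  · simp [RamState.setReg_reg, WordOp.eval]; omega
  · simp [RamState.setReg_reg]
  · simp [RamState.setReg_reg, WordOp.eval]
  · have h6 : x ≠ 6 := by omega
    have h7 : x ≠ 7 := by omega
    simp [RamState.setReg_reg, hx1, hx2, h6, h7]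

/-- Compute the sizes of the groups, the word size, and the number of vectors to handle. -/
def setupProg (k : ℕ) : RamProg :=
  .seq quotProg (.seq (.op .add 12 0 23) (.seq (.const 20 2) (.seq (.op .add 21 4 5)
  (.seq (.op .add 21 21 20) (.seq (.const 8 1) (powProg k))))))

/-- A group is as large as a walk permits: 31 or 1 vertices are fixed, and each vector takes `6 * d
+ 10` or `6 * d + 18` more. -/
def sizes (n m d N M k : ℕ) (mA mB : ℕ → ℕ) : Sizes where
  n := n
  m := m
  d := d
  N := N
  M := M
  qA := (N - 31) / (6 * d + 10)
  qB := (M - 1) / (6 * d + 18)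
  W₀ := (N + M + 2) ^ k
  mA := mA
  mB := mB

theorem sizes_good {W n m d N M k : ℕ} (mA mB : ℕ → ℕ) (hk : 1 ≤ k) (hN : 31 + (6 * d + 10) ≤ N)
    (hM : 1 + (6 * d + 18) ≤ M) (hW : 100 ≤ W) : (sizes n m d N M k mA mB).Good W := by
  have h : N + M + 2 ≤ (N + M + 2) ^ k := Nat.le_self_pow (by omega) _
  have hA := Nat.div_mul_le_self (N - 31) (6 * d + 10)
  have hB := Nat.div_mul_le_self (M - 1) (6 * d + 18)
  refine ⟨?_, ?_, ?_, ?_, ?_, ?_, hW⟩ <;> simp only [sizes]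
  · omega
  · omega
  · omega
  · omega
  · exact Nat.div_pos (by omega) (by omega)
  · exact Nat.div_pos (by omega) (by omega)

theorem runs_setupProg {W n m d N M k : ℕ} {mA mB : ℕ → ℕ} (hk : 1 ≤ k)
    (hN : 31 + (6 * d + 10) ≤ N) (hM : 1 + (6 * d + 18) ≤ M) (hW : 100 ≤ W)
    (hW₀ : (N + M + 2) ^ k < W) (hn : n < W) {s : RamState} (h0 : s.reg 0 = n) (h1 : s.reg 1 = m)
    (h2 : s.reg 2 = d) (h3 : s.reg 3 = 1) (h4 : s.reg 4 = N) (h5 : s.reg 5 = M)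
    (h9 : s.reg 9 = 0) (h10 : s.reg 10 = 0) (h11 : s.reg 11 = 0) (h23 : s.reg 23 = 0)
    (hm0 : s.mem 0 = mA) (hm1 : s.mem 1 = mB) (hm : ∀ a i, s.mem (a + 2) i = 0) :
    Runs W (setupProg k) s (k + 17) fun s' => Ready (sizes n m d N M k mA mB) s' ∧
      s'.reg 9 = 0 ∧ s'.reg 10 = 0 ∧ s'.reg 11 = 0 ∧ s'.reg 12 = n := by
  have h : N + M + 2 ≤ (N + M + 2) ^ k := Nat.le_self_pow (by omega) _
  refine Runs.mono (T := 11 + (1 + (1 + (1 + (1 + (1 + (k + 1))))))) (Runs.seq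
    (runs_quotProg hN hM (by omega) (by omega) h2 h3 h4 h5) ?_) (by omega) fun _ h => h
  rintro s₁ ⟨h₁m, h₁6, h₁7, h₁r⟩
  refine Runs.op_seq (v := n) ?_ (by omega)
    (Runs.const_seq (by omega) (Runs.op_seq (v := N + M) ?_ (by omega)
    (Runs.op_seq (v := N + M + 2) ?_ (by omega)
    (Runs.const_seq (by omega) ((runs_powProg (c := N + M + 2) (by omega) k (v := 1) ?_ ?_
      (by omega)).mono le_rfl ?_)))))
  · simp [h₁r, h0, h23, WordOp.eval]
  · simp [RamState.setReg_reg, h₁r, h4, h5, WordOp.eval]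
  · simp [RamState.setReg_reg, WordOp.eval]
  · simp [RamState.setReg_reg]
  · simp [RamState.setReg_reg]
  rintro s' ⟨km, k8, kr⟩
  have hr : ∀ x, x < 12 ∨ x = 23 → x ≠ 8 → s'.reg x = s₁.reg x := by
    intro x hx hx'
    rw [kr x hx']
    simp only [RamState.setReg_reg]
    rw [if_neg hx', if_neg (by omega), if_neg (by omega), if_neg (by omega), if_neg (by omega)]
  have hr' : ∀ x, x < 12 ∨ x = 23 → x < 6 ∨ 8 < x → s'.reg x = s.reg x := fun x hx hx' => by
    rw [hr x hx (by omega), h₁r x (by omega) (by omega) (by omega)]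
  have hmem : s'.mem = s.mem := km.trans h₁m
  refine ⟨⟨?_, ?_, ?_, ?_, ?_, ?_, ?_, ?_, ?_, ?_, ?_, ?_, ?_⟩, ?_, ?_, ?_, ?_⟩
  · rw [hr' 0 (by omega) (by omega)]; exact h0
  · rw [hr' 1 (by omega) (by omega)]; exact h1
  · rw [hr' 2 (by omega) (by omega)]; exact h2
  · rw [hr' 3 (by omega) (by omega)]; exact h3
  · rw [hr' 4 (by omega) (by omega)]; exact h4
  · rw [hr' 5 (by omega) (by omega)]; exact h5
  · rw [hr 6 (by omega) (by omega)]; exact h₁6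
  · rw [hr 7 (by omega) (by omega)]; exact h₁7
  · rw [k8]; exact one_mul _
  · rw [hr' 23 (by omega) (by omega)]; exact h23
  · rw [hmem]; exact hm0
  · rw [hmem]; exact hm1
  · intro a i _; rw [hmem]; exact hm a i
  · rw [hr' 9 (by omega) (by omega)]; exact h9
  · rw [hr' 10 (by omega) (by omega)]; exact h10
  · rw [hr' 11 (by omega) (by omega)]; exact h11
  · rw [kr 12 (by omega)]; simp [RamState.setReg_reg]

theorem holdsBits_vectorCells {d : ℕ} (A : List (Fin d → Bool)) :
    HoldsBits (fun i => (vectorCells A).getD i 0) 0 (bitLists A) := by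
  have h : vectorCells A = (bitLists A).flatten.map Bool.toNat := by
    simp [vectorCells, bitLists, List.flatMap, List.map_flatten, Function.comp_def, List.map_ofFn]
  intro j hj
  simp only [h, zero_add]
  rw [List.getD_eq_getElem _ _ (by rw [List.length_map]; exact hj), List.getElem_map, List.getD_eq_getElem _ _ hj]

/-- Decide whether there is an orthogonal pair of vectors, with `p` as a subroutine. -/
def ovProg (p : RamProg) (b k n₀ m₀ : ℕ) : RamProg :=
  .seq (sizesProg n₀ m₀) (.seq (setupProg k) (.seq (allPairs p b) (.op .add 0 10 23)))

open Classical in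
theorem runs_ovProg {W b Tp n₀ m₀ n m d N M k : ℕ} {p : RamProg} (hp : p.RegsBelow b) (hb : 2 ≤ b)
    (hF : ComputesFrechet p ((N + M + 2) ^ k) M N Tp) (h : n < n₀ → N = n₀ ∧ M = m₀)
    (h' : n₀ ≤ n → N = n ∧ M = m) (hk : 1 ≤ k) (hN : 31 + (6 * d + 10) ≤ N)
    (hM : 1 + (6 * d + 18) ≤ M)
    (hW : n₀ + m₀ + 100 + n + m + n * d + m * d + (n * m + 1) * (N + M + 2) ^ k < W)
    {A B : List (Fin d → Bool)} (hA : A.length = n) (hB : B.length = m) :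
    Runs W (ovProg p b k n₀ m₀) (ramInput [n, m, d] (vectorCells A) (vectorCells B))
      (k + 24 + allPairsTime (sizes n m d N M k (fun i => (vectorCells A).getD i 0)
        fun i => (vectorCells B).getD i 0) b Tp n)
      fun s => s.reg 0 = if HasOrthogonalPair A B then 1 else 0 := by
  set mA := fun i => (vectorCells A).getD i 0
  set mB := fun i => (vectorCells B).getD i 0
  have hNM : N + M + 2 ≤ (N + M + 2) ^ k := Nat.le_self_pow (by omega) _
  have hW₀ : (N + M + 2) ^ k ≤ (n * m + 1) * (N + M + 2) ^ k :=
    Nat.le_mul_of_pos_left _ (by omega)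
  set s := ramInput [n, m, d] (vectorCells A) (vectorCells B) with hs
  have hsr : ∀ x, 2 < x → s.reg x = 0 := by
    intro x hx
    simp only [hs, ramInput]
    exact List.getD_eq_default _ _ (by simp; omega)
  have hlA : (bitLists A).length = n := by simp [bitLists, hA]
  have hlB : (bitLists B).length = m := by simp [bitLists, hB]
  refine Runs.mono (T := 6 + ((k + 17) + (allPairsTime (sizes n m d N M k mA mB) b Tp n + 1)))
    (Runs.seq (runs_sizesProg h h' (by omega) (by omega) (by omega) (by omega) (by omega)
      (n := n) (m := m) (by simp [hs, ramInput]) (by simp [hs, ramInput]) (hsr 23 (by omega))) ?_)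
    (by omega) fun _ h => h
  rintro s₁ ⟨h₁m, h₁3, h₁4, h₁5, h₁r⟩
  refine Runs.seq (runs_setupProg (n := n) (m := m) (mA := mA) (mB := mB) hk hN hM (by omega)
    (by omega) (by omega)
    (by rw [h₁r 0 (by omega) (by omega)]; simp [hs, ramInput])
    (by rw [h₁r 1 (by omega) (by omega)]; simp [hs, ramInput])
    (by rw [h₁r 2 (by omega) (by omega)]; simp [hs, ramInput]) h₁3 h₁4 h₁5
    (by rw [h₁r 9 (by omega) (by omega), hsr 9 (by omega)])
    (by rw [h₁r 10 (by omega) (by omega), hsr 10 (by omega)])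
    (by rw [h₁r 11 (by omega) (by omega), hsr 11 (by omega)])
    (by rw [h₁r 23 (by omega) (by omega), hsr 23 (by omega)])
    (by rw [h₁m]; funext i; simp [hs, ramInput, mA]) (by rw [h₁m]; funext i; simp [hs, ramInput, mB])
    (by rw [h₁m]; intro a i; simp [hs, ramInput])) ?_
  rintro s₂ ⟨h₂, h₂9, h₂10, h₂11, h₂12⟩
  have hqd : (N - 31) / (6 * d + 10) * d ≤ N := by
    have := Nat.div_mul_le_self (N - 31) (6 * d + 10)
    have h2 : (N - 31) / (6 * d + 10) * d ≤ (N - 31) / (6 * d + 10) * (6 * d + 10) :=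
      Nat.mul_le_mul_left _ (by omega)
    omega
  refine Runs.seq (runs_allPairs (sizes_good mA mB hk hN hM (by omega)) hp hb hF
    (B := bitLists B) length_of_mem_bitLists hlB (holdsBits_vectorCells B) (by simp only [sizes]; omega)
    (by simp only [sizes]; omega) (by simp only [sizes]; omega) n (bitLists A) s₂ hlA
    length_of_mem_bitLists h₂ (by rw [h₂11]; exact holdsBits_vectorCells A) (by rw [h₂12, hlA])
    (by rw [h₂9]; simp only [sizes]; omega) (by rw [h₂11]; simp only [sizes]; omega) (by omega)) ?_
  rintro s₃ ⟨h₃23, h₃10⟩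
  have hv : WordOp.eval .add (s₃.reg 10) (s₃.reg 23) = if HasOrthogonalPair A B then 1 else 0 := by
    have : HasPair (bitLists B) (bitLists A) ↔ HasOrthogonalPair A B :=
      HasPair.comm.trans hasOrthogonalPair_iff.symm
    rw [h₃10, h₃23, h₂10]
    by_cases hAB : HasOrthogonalPair A B <;> simp [this, hAB, WordOp.eval]
  refine Runs.op ?_ ?_
  · rw [hv]; split_ifs <;> omega
  · rw [hv, RamState.setReg_reg, if_pos rfl]

/-! ### Estimates and the running time -/

/-! ### Solving orthogonal vectors with the discrete Fréchet distance -/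

-- Powers outgrow logarithms. From `n₀` on, a walk with only as many vertices as there are vectors
-- has room for an encoded vector.
open Filter in
theorem exists_le_ceil_rpow {γ ω : ℝ} (hγ : 0 < γ) (hω : 0 < ω) :
    ∃ n₀ : ℕ, 1 ≤ n₀ ∧ ∀ n : ℕ, n₀ ≤ n →
      6 * ⌈ω * Real.logb 2 n⌉₊ + 100 ≤ ⌈(n : ℝ) ^ γ⌉₊ := by
  have hlog : 0 < Real.log 2 := Real.log_pos one_lt_two
  have h1 := (isLittleO_log_rpow_atTop hγ).bound
    (show (0 : ℝ) < Real.log 2 / (12 * ω) by positivity)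
  -- From `x = 212` on, `6 * (x / 12 + 1) + 100 ≤ x`.
  have h2 : ∀ᶠ x : ℝ in atTop, 212 ≤ x ^ γ := (tendsto_rpow_atTop hγ).eventually_ge_atTop _
  obtain ⟨n₀, h⟩ := eventually_atTop.1 ((tendsto_natCast_atTop_atTop (R := ℝ)).eventually
    (h1.and h2))
  refine ⟨n₀ + 1, by omega, fun n hn => ?_⟩
  obtain ⟨h3, h4⟩ := h n (by omega)
  have hn1 : (1 : ℝ) ≤ n := by exact_mod_cast (by omega : 1 ≤ n)
  rw [Real.norm_of_nonneg (Real.log_nonneg hn1), Real.norm_of_nonneg (by positivity)] at h3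
  have h5 : ω * Real.logb 2 n ≤ (n : ℝ) ^ γ / 12 := by
    rw [Real.logb, mul_div_assoc', div_le_iff₀ hlog]
    calc ω * Real.log n ≤ ω * (Real.log 2 / (12 * ω) * (n : ℝ) ^ γ) := by gcongr
      _ = _ := by field_simp
  have h6 : (⌈ω * Real.logb 2 n⌉₊ : ℝ) < ω * Real.logb 2 n + 1 :=
    Nat.ceil_lt_add_one (mul_nonneg hω.le (Real.logb_nonneg one_lt_two hn1))
  have h7 := Nat.le_ceil ((n : ℝ) ^ γ)
  have : ((6 * ⌈ω * Real.logb 2 n⌉₊ + 100 : ℕ) : ℝ) ≤ ⌈(n : ℝ) ^ γ⌉₊ := by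
    push_cast; linarith
  exact_mod_cast this

/-- The `n * m + 1` windows of `W₀` cells must be addressable by words of logarithmic length. Every
summand is at most the same power of `n + m + d + 2`, where `c ≤ S ^ c` takes care of the constant.
-/
theorem word_size_lt {n m d N M k c : ℕ} (hn : 1 ≤ n) (hm : 1 ≤ m) (hN : N + M + 2 ≤ n + m + c) :
    c + n + m + n * d + m * d + (n * m + 1) * (N + M + 2) ^ k <
      (n + m + d + 2) ^ ((c + 1) * k + c + 4) := by
  set S := n + m + d + 2 with hS
  have hS4 : 4 ≤ S := by omega
  have hc : c ≤ S ^ c := (Nat.lt_pow_self (by omega)).le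
  have hNM : N + M + 2 ≤ S ^ (c + 1) := by
    rw [pow_succ]
    have h1 : 1 ≤ S ^ c := Nat.one_le_pow _ _ (by omega)
    nlinarith
  have hX : ∀ i ≤ (c + 1) * k + c + 2, S ^ i ≤ S ^ ((c + 1) * k + c + 2) := fun i hi =>
    Nat.pow_le_pow_right (by omega) hi
  have h1 : c ≤ S ^ ((c + 1) * k + c + 2) := hc.trans (hX _ (by omega))
  have h2 : n + m ≤ S ^ ((c + 1) * k + c + 2) := le_trans (by rw [pow_one]; omega) (hX 1 (by omega))
  have h3 : n * d + m * d ≤ S ^ ((c + 1) * k + c + 2) :=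
    le_trans (by nlinarith) (hX 2 (by omega))
  have h4 : (n * m + 1) * (N + M + 2) ^ k ≤ S ^ ((c + 1) * k + c + 2) := by
    calc (n * m + 1) * (N + M + 2) ^ k ≤ S ^ 2 * (S ^ (c + 1)) ^ k :=
          Nat.mul_le_mul (by nlinarith) (Nat.pow_le_pow_left hNM k)
      _ = S ^ (2 + (c + 1) * k) := by rw [← pow_mul, ← pow_add]
      _ ≤ _ := hX _ (by omega)
  have h5 : 1 ≤ S ^ ((c + 1) * k + c + 2) := Nat.one_le_pow _ _ (by omega)
  rw [show (c + 1) * k + c + 4 = (c + 1) * k + c + 2 + 2 by ring, pow_add]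
  have h6 := Nat.mul_le_mul_left (S ^ ((c + 1) * k + c + 2)) (show 16 ≤ S ^ 2 by nlinarith)
  linarith

/-- For the group size `q = (n - c) / L` one has `n ≤ 2 * (n - c)` and `n - c < (q + 1) * L ≤ 2 * q
* L`. The bound is independent of `n`, hence `O(d)` in the application. -/
theorem groups_div_le {n c L : ℕ} (hL : 0 < L) (h : c + L ≤ n) (hc : 2 * c ≤ n) :
    groups n ((n - c) / L) ≤ 4 * L + 1 := by
  have hq : 0 < (n - c) / L := Nat.div_pos (by omega) hL
  refine (groups_le hq).trans (Nat.add_le_add_right ?_ 1)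
  have h1 := Nat.lt_div_mul_add (a := n - c) hL
  have h2 : L ≤ (n - c) / L * L := Nat.le_mul_of_pos_left _ hq
  refine Nat.div_le_of_le_mul ?_
  rw [mul_left_comm]
  omega

theorem one_le_groups {l q : ℕ} (hq : 0 < q) (hl : 0 < l) : 1 ≤ groups l q :=
  (Nat.le_add_left _ _).trans (groups_step hq hl)

theorem allPairsTime_le {z : Sizes} {W b Tp l gA gB : ℕ} (hz : z.Good W) (hl : 0 < l)
    (hm : 0 < z.m) (hA : groups l z.qA ≤ gA) (hB : groups z.m z.qB ≤ gB) :
    allPairsTime z b Tp l ≤ gA * gB * (16 * (z.N + z.M) + 2 * Tp + b + 81) := by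
  have h1 := (one_le_groups hz.qA hl).trans hA
  have h2 := (one_le_groups hz.qB hm).trans hB
  have h3 : groupTime z b Tp z.m ≤ gB * (pairTime z b Tp + 1) + 1 := by
    unfold groupTime; gcongr
  calc allPairsTime z b Tp l ≤ gA * (gB * (pairTime z b Tp + 1) + 1 + 8) + 1 := by
        unfold allPairsTime; gcongr
    _ ≤ gA * (gB * (pairTime z b Tp + 1) + gB * 9) + gA * gB := by
        have : 1 ≤ gA * gB := Nat.mul_pos h1 h2
        exact Nat.add_le_add (Nat.mul_le_mul_left _ (by omega)) this
    _ = gA * gB * (16 * (z.N + z.M) + 2 * Tp + b + 81) := by unfold pairTime; ring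

theorem ceil_rpow_le {γ : ℝ} (hγ₁ : γ ≤ 1) {n : ℕ} (hn : 1 ≤ n) : ⌈(n : ℝ) ^ γ⌉₊ ≤ n := by
  rw [Nat.ceil_le]
  calc (n : ℝ) ^ γ ≤ (n : ℝ) ^ (1 : ℝ) :=
        Real.rpow_le_rpow_of_exponent_le (by exact_mod_cast hn) hγ₁
    _ = n := Real.rpow_one _

theorem one_le_ceil_rpow {γ : ℝ} {n : ℕ} (hn : 1 ≤ n) : 1 ≤ ⌈(n : ℝ) ^ γ⌉₊ :=
  Nat.one_le_ceil_iff.2 (Real.rpow_pos_of_pos (by exact_mod_cast hn) γ)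

/-- This absorbs the linear cost of writing the walks, and it is where `1 ≤ (1 + γ) * (1 - δ)`
enters. -/
theorem le_mul_ceil_rpow {γ δ : ℝ} (hγ : 0 < γ) (h : 1 ≤ (1 + γ) * (1 - δ)) {n : ℕ} (hn : 1 ≤ n) :
    (n : ℝ) ≤ ((n : ℝ) * ⌈(n : ℝ) ^ γ⌉₊) ^ (1 - δ) := by
  have hn1 : (1 : ℝ) ≤ n := by exact_mod_cast hn
  have hδ : 0 ≤ 1 - δ := by by_contra hδ; nlinarith
  calc (n : ℝ) = (n : ℝ) ^ (1 : ℝ) := (Real.rpow_one _).symm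
    _ ≤ (n : ℝ) ^ ((1 + γ) * (1 - δ)) := Real.rpow_le_rpow_of_exponent_le hn1 h
    _ = ((n : ℝ) * (n : ℝ) ^ γ) ^ (1 - δ) := by
      rw [Real.rpow_mul (by positivity), Real.rpow_add (by positivity), Real.rpow_one]
    _ ≤ _ := by
      gcongr
      exact Nat.le_ceil _

/-- The logarithm of `n` is at most a constant times `n ^ (ε / 2)`; this absorbs the quadratic
number of calls. -/
theorem exists_dim_sq_le {ω ε : ℝ} (hω : 0 < ω) (hε : 0 < ε) : ∃ c : ℝ, 0 ≤ c ∧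
    ∀ n m : ℕ, 1 ≤ n → 1 ≤ m →
      ((⌈ω * Real.logb 2 n⌉₊ : ℝ) + 3) ^ 2 ≤ c * ((n : ℝ) * m) ^ ε := by
  have hlog : 0 < Real.log 2 := Real.log_pos one_lt_two
  refine ⟨(4 + ω / Real.log 2 / (ε / 2)) ^ 2, by positivity, fun n m hn hm => ?_⟩
  have hn1 : (1 : ℝ) ≤ n := by exact_mod_cast hn
  have hm1 : (1 : ℝ) ≤ m := by exact_mod_cast hm
  have h6 : (⌈ω * Real.logb 2 n⌉₊ : ℝ) < ω * Real.logb 2 n + 1 :=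
    Nat.ceil_lt_add_one (mul_nonneg hω.le (Real.logb_nonneg one_lt_two hn1))
  have h7 := Real.log_le_rpow_div (x := n) (by positivity) (half_pos hε)
  have h8 : 1 ≤ (n : ℝ) ^ (ε / 2) := Real.one_le_rpow hn1 (by positivity)
  have h9 : (⌈ω * Real.logb 2 n⌉₊ : ℝ) + 3 ≤
      (4 + ω / Real.log 2 / (ε / 2)) * (n : ℝ) ^ (ε / 2) := by
    have : ω * Real.logb 2 n ≤ ω / Real.log 2 / (ε / 2) * (n : ℝ) ^ (ε / 2) := by
      rw [Real.logb]
      calc ω * (Real.log n / Real.log 2) = ω / Real.log 2 * Real.log n := by ring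
        _ ≤ ω / Real.log 2 * ((n : ℝ) ^ (ε / 2) / (ε / 2)) := by gcongr
        _ = _ := by ring
    nlinarith
  calc _ ≤ ((4 + ω / Real.log 2 / (ε / 2)) * (n : ℝ) ^ (ε / 2)) ^ 2 := by gcongr
    _ = (4 + ω / Real.log 2 / (ε / 2)) ^ 2 * (n : ℝ) ^ ε := by
      rw [mul_pow, ← Real.rpow_natCast ((n : ℝ) ^ (ε / 2)), ← Real.rpow_mul (by positivity)]
      norm_num
    _ ≤ _ := by
      gcongr
      exact le_mul_of_one_le_right (by positivity) hm1

theorem computesFrechet_of_solves {γ δ C : ℝ} {p : RamProg} {k : ℕ}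
    (h : ∀ n m : ℕ, 1 ≤ m → n = ⌈(m : ℝ) ^ γ⌉₊ →
      ∀ P Q : List (Fin 50), IsVertexWalk gadgetGraph P → IsVertexWalk gadgetGraph Q →
      P.length = n → Q.length = m → ∃ (t : ℕ) (s : RamState),
        RamExec ((n + m + 2) ^ k) p
          (ramInput [n, m] (P.map fun v => (v : ℕ)) (Q.map fun v => (v : ℕ))) t s ∧
        (t : ℝ) ≤ C * ((n : ℝ) * m) ^ (1 - δ) ∧
        (s.reg 0 : ℝ) = discreteFrechet gadgetGraph 1 P Q) {M N : ℕ} (hN : 1 ≤ N)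
    (hM : M = ⌈(N : ℝ) ^ γ⌉₊) :
    ComputesFrechet p ((N + M + 2) ^ (k + 1)) M N ⌊|C| * ((N : ℝ) * M) ^ (1 - δ)⌋₊ := by
  intro P Q hP hQ hPl hQl
  obtain ⟨t, s, h1, h2, h3⟩ := h M N hN hM P Q hP hQ hPl hQl
  refine ⟨t, s, ?_, Nat.le_floor ?_, h3⟩
  -- The coerced list of vertices is brought from its monadic form to a `map`.
  · simp only [List.pure_def, List.bind_eq_flatMap, List.map_id',
      ← List.map_eq_flatMap] at h1
    refine h1.mono ?_
    rw [add_comm N M]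
    exact Nat.pow_le_pow_right (by omega) (by omega)
  · rw [mul_comm (N : ℝ)]
    exact h2.trans (by gcongr; exact le_abs_self C)

/-- The walks have `n` and `m` vertices, so their lengths satisfy the relation that the algorithm
needs. There are `O(d ^ 2)` pairs of groups, each costing a call and linear work, and `d ^ 2` costs
only a factor `(n * m) ^ (δ / 2)`. For `n < n₀` such walks may be too short for a single vector; the
fixed lengths `n₀` and `m₀` are used instead, at bounded cost. -/
theorem orthogonalVectorsSolvable_of_frechetSolvable {γ δ ω : ℝ} (hγ : 0 < γ) (hγ₁ : γ ≤ 1)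
    (hδ : 0 < δ) (hω : 0 < ω) (h : 1 ≤ (1 + γ) * (1 - δ))
    (hF : FrechetSolvable gadgetGraph γ δ) : OrthogonalVectorsSolvable γ ω (δ / 2) := by
  classical
  obtain ⟨p, k, C, hp⟩ := hF
  obtain ⟨b, hb⟩ := p.exists_regsBelow
  replace hb : p.RegsBelow (b + 2) := hb.mono (by omega)
  obtain ⟨n₀, hn₀, hlarge⟩ := exists_le_ceil_rpow hγ hω
  obtain ⟨cd, hcd₀, hcd⟩ := exists_dim_sq_le hω (half_pos hδ)
  set m₀ := ⌈(n₀ : ℝ) ^ γ⌉₊ with hm₀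
  have hδ₁ : 0 ≤ 1 - δ := by by_contra hδ; nlinarith
  set T := ⌊|C| * ((n₀ : ℝ) * m₀) ^ (1 - δ)⌋₊ with hT
  -- `K` bounds the time for `n < n₀`, where there are at most `n₀ + 1` and `m₀ + 1` groups.
  set K := (k + 25) + (n₀ + 1) * (m₀ + 1) * (16 * (n₀ + m₀) + 2 * T + (b + 2) + 81) with hK
  -- Here `900 = 30 ^ 2` comes from `4 * (6 * d + 18) + 1 ≤ 30 * (d + 3)`, and `115 = 2 * 16 + 83`
  -- from `N + M ≤ 2 * N`.
  set D := 900 * cd * (2 * |C| + b + 115) + k + 25 with hD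
  have hD₀ : 0 ≤ D := by positivity
  refine ⟨ovProg p (b + 2) (k + 1) n₀ m₀, (n₀ + m₀ + 100 + 1) * (k + 1) + (n₀ + m₀ + 100) + 4,
    D + K, ?_⟩
  intro n m d hn hm hd A B hA hB
  have hm1 : 1 ≤ m := hm ▸ one_le_ceil_rpow hn
  have hn1' : (1 : ℝ) ≤ n := by exact_mod_cast hn
  have hm1' : (1 : ℝ) ≤ m := by exact_mod_cast hm1
  have hmn : m ≤ n := hm ▸ ceil_rpow_le hγ₁ hn
  have hnm : (1 : ℝ) ≤ (n : ℝ) * m := one_le_mul_of_one_le_of_one_le hn1' hm1'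
  have hpos : 1 ≤ ((n : ℝ) * m) ^ (1 - δ / 2) := Real.one_le_rpow hnm (by linarith)
  obtain ⟨N, M, h₁, h₂, hN1, hM, hNd⟩ : ∃ N M : ℕ, (n < n₀ → N = n₀ ∧ M = m₀) ∧
      (n₀ ≤ n → N = n ∧ M = m) ∧ 1 ≤ N ∧ M = ⌈(N : ℝ) ^ γ⌉₊ ∧ 6 * d + 100 ≤ M := by
    rcases Nat.lt_or_ge n n₀ with hlt | hge
    · refine ⟨n₀, m₀, fun _ => ⟨rfl, rfl⟩, fun _ => by omega, hn₀, rfl, ?_⟩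
      refine le_trans ?_ (hlarge n₀ le_rfl)
      have : d ≤ ⌈ω * Real.logb 2 n₀⌉₊ := by
        rw [hd]
        refine Nat.ceil_le_ceil ?_
        gcongr
        · norm_num
      omega
    · exact ⟨n, m, fun _ => by omega, fun _ => ⟨rfl, rfl⟩, hn, hm, by rw [hm, hd]; exact hlarge n hge⟩
  have hMN : M ≤ N := hM ▸ ceil_rpow_le hγ₁ hN1
  have hcomp := computesFrechet_of_solves hp hN1 hM
  have hgood := sizes_good (W := 100) (n := n) (m := m) (d := d) (N := N) (M := M) (k := k + 1)
    (fun i => (vectorCells A).getD i 0) (fun i => (vectorCells B).getD i 0) (by omega) (by omega)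
    (by omega) le_rfl
  obtain ⟨t, s, hex, ht, hs⟩ := runs_ovProg hb (by omega) hcomp h₁ h₂ (by omega) (by omega)
    (by omega) (word_size_lt (c := n₀ + m₀ + 100) hn hm1
      (by rcases Nat.lt_or_ge n n₀ with h | h
          · have := h₁ h; omega
          · have := h₂ h; omega)) hA hB
  refine ⟨t, s, hex, ?_, fun h => by rw [hs, if_pos h], fun h => by rw [hs, if_neg h]⟩
  rcases Nat.lt_or_ge n n₀ with hlt | hge
  · obtain ⟨hN₀, hM₀⟩ := h₁ hlt
    have hmM : m ≤ M := by
      rw [hm, hM]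
      refine Nat.ceil_le_ceil ?_
      gcongr
      omega
    have := allPairsTime_le (b := b + 2) (Tp := T) (l := n) (gA := N + 1) (gB := M + 1) hgood hn hm1
      ((groups_le hgood.qA).trans (Nat.add_le_add_right ((Nat.div_le_self _ _).trans (by omega)) 1))
      ((groups_le hgood.qB).trans (Nat.add_le_add_right ((Nat.div_le_self _ _).trans hmM) 1))
    have htK : t ≤ K := by
      refine ht.trans ?_
      rw [← hN₀, ← hM₀] at hT hK
      rw [hK, ← hT]
      simp only [sizes] at this ⊢
      omega
    calc (t : ℝ) ≤ K := by exact_mod_cast htK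
      _ ≤ (D + K) * 1 := by linarith
      _ ≤ _ := by gcongr
  · obtain ⟨rfl, rfl⟩ := h₂ hge
    set T' := ⌊|C| * ((N : ℝ) * M) ^ (1 - δ)⌋₊ with hT'
    have hT'le : (T' : ℝ) ≤ |C| * ((N : ℝ) * M) ^ (1 - δ) := Nat.floor_le (by positivity)
    have := allPairsTime_le (b := b + 2) (Tp := T') (l := N) hgood hn hm1
      (groups_div_le (L := 6 * d + 10) (c := 31) (by omega) (by omega) (by omega))
      (groups_div_le (n := M) (L := 6 * d + 18) (c := 1) (by omega) (by omega) (by omega))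
    have ht' : t ≤ (k + 25) + 900 * (d + 3) ^ 2 * (16 * (N + M) + 2 * T' + b + 83) := by
      have h1 : (4 * (6 * d + 10) + 1) * (4 * (6 * d + 18) + 1) ≤ 900 * (d + 3) ^ 2 :=
        (Nat.mul_le_mul (show _ ≤ 30 * (d + 3) by omega) (show _ ≤ 30 * (d + 3) by omega)).trans_eq
          (by ring)
      have h2 := this.trans (Nat.mul_le_mul_right _ h1)
      have h3 : 16 * (N + M) + 2 * T' + (b + 2) + 81 = 16 * (N + M) + 2 * T' + b + 83 := by ring
      change _ ≤ _ * (16 * (N + M) + 2 * T' + (b + 2) + 81) at h2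
      rw [h3] at h2
      refine ht.trans ?_
      omega
    have hX := le_mul_ceil_rpow hγ h hn
    rw [← hm] at hX
    have hX1 : 1 ≤ ((N : ℝ) * M) ^ (1 - δ) := Real.one_le_rpow hnm hδ₁
    set X := ((N : ℝ) * M) ^ (1 - δ) with hXdef
    have hcdn := hcd N M hn hm1
    rw [← hd] at hcdn
    have hmn' : (M : ℝ) ≤ N := by exact_mod_cast hmn
    have hin : 16 * ((N : ℝ) + M) + 2 * T' + b + 83 ≤ (2 * |C| + b + 115) * X := by
      have : (b : ℝ) ≤ b * X := le_mul_of_one_le_right (by positivity) hX1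
      nlinarith
    have hsplit : ((N : ℝ) * M) ^ (δ / 2) * X = ((N : ℝ) * M) ^ (1 - δ / 2) := by
      rw [hXdef, ← Real.rpow_add (by linarith)]; ring_nf
    calc (t : ℝ) ≤ (k + 25) + 900 * ((d : ℝ) + 3) ^ 2 * (16 * (N + M) + 2 * T' + b + 83) := by
          exact_mod_cast ht'
      _ ≤ (k + 25) + 900 * (cd * ((N : ℝ) * M) ^ (δ / 2)) * ((2 * |C| + b + 115) * X) := by gcongr
      _ = (k + 25) * 1 + 900 * cd * (2 * |C| + b + 115) * ((N : ℝ) * M) ^ (1 - δ / 2) := by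
          rw [← hsplit]; ring
      _ ≤ (k + 25) * ((N : ℝ) * M) ^ (1 - δ / 2) +
          900 * cd * (2 * |C| + b + 115) * ((N : ℝ) * M) ^ (1 - δ / 2) := by gcongr
      _ = D * ((N : ℝ) * M) ^ (1 - δ / 2) := by rw [hD]; ring
      _ ≤ (D + K) * ((N : ℝ) * M) ^ (1 - δ / 2) := by
          gcongr
          exact le_add_of_nonneg_right (Nat.cast_nonneg _)

/-! ### Sublinear time does not suffice to read a walk -/

theorem RamExec.deterministic {W : ℕ} {p : RamProg} {s s₁ : RamState} {t₁ : ℕ}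
    (h₁ : RamExec W p s t₁ s₁) : ∀ {t₂ : ℕ} {s₂ : RamState}, RamExec W p s t₂ s₂ → s₁ = s₂ := by
  induction h₁ with
  | skip s => rintro _ _ ⟨⟩; rfl
  | const s x c h => rintro _ _ ⟨⟩; rfl
  | op s o x y z h => rintro _ _ ⟨⟩; rfl
  | load s x a y h => rintro _ _ ⟨⟩; rfl
  | store s a y x hy hx => rintro _ _ ⟨⟩; rfl
  | seq _ _ ih ih' =>
    rintro _ _ h
    cases h with
    | seq h h' =>
      obtain rfl := ih h
      exact ih' h'
  | iteTrue q hx _ ih =>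
    rintro _ _ h
    cases h with
    | iteTrue _ _ h => exact ih h
    | iteFalse _ hx' _ => exact absurd hx' hx
  | iteFalse p hx _ ih =>
    rintro _ _ h
    cases h with
    | iteTrue _ hx' _ => exact absurd hx hx'
    | iteFalse _ _ h => exact ih h
  | loopDone p hx =>
    rintro _ _ h
    cases h with
    | loopDone => rfl
    | loopStep hx' _ _ => exact absurd hx hx'
  | loopStep hx _ _ ih ih' =>
    rintro _ _ h
    cases h with
    | loopDone _ hx' => exact absurd hx' hx
    | loopStep _ h h' =>
      obtain rfl := ih h
      exact ih' h'

/-- An execution of `t` steps reads at most `t` cells, and does the same if other cells change. -/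
theorem RamExec.exists_reads {W : ℕ} {p : RamProg} {s s' : RamState} {t : ℕ}
    (h : RamExec W p s t s') : ∃ R : Finset (ℕ × ℕ), R.card ≤ t ∧
      ∀ S : RamState, S.reg = s.reg → (∀ c ∈ R, S.mem c.1 c.2 = s.mem c.1 c.2) →
        ∃ S', RamExec W p S t S' ∧ S'.reg = s'.reg ∧
          ∀ a i, S.mem a i = s.mem a i → S'.mem a i = s'.mem a i := by
  induction h with
  | skip s => exact ⟨∅, by simp, fun S hS _ => ⟨S, .skip S, hS, fun _ _ h => h⟩⟩
  | const s x c h =>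
    refine ⟨∅, by simp, fun S hS _ => ⟨_, .const S x c h, ?_, fun _ _ h => h⟩⟩
    simp only [RamState.setReg, hS]
  | op s o x y z h =>
    refine ⟨∅, by simp, fun S hS _ => ⟨_, .op S o x y z (by rwa [hS]), ?_, fun _ _ h => h⟩⟩
    simp only [RamState.setReg, hS]
  | load s x a y h =>
    refine ⟨{(a, s.reg y)}, by simp, fun S hS hm => ?_⟩
    have e : S.mem a (S.reg y) = s.mem a (s.reg y) := by
      rw [hS]; exact hm (a, s.reg y) (by simp)
    refine ⟨_, .load S x a y (by rwa [e]), ?_, fun _ _ h => h⟩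
    simp only [RamState.setReg]
    rw [e, hS]
  | store s a y x hy hx =>
    refine ⟨∅, by simp, fun S hS _ => ⟨_, .store S a y x (by rwa [hS]) (by rwa [hS]), hS, ?_⟩⟩
    intro a' i h
    simp only [RamState.setMem, hS, Function.update_apply]
    split_ifs with h1
    · subst h1
      simp only [Function.update_apply, h]
    · exact h
  | seq _ _ ih ih' =>
    obtain ⟨R, hR, hr⟩ := ih
    obtain ⟨R', hR', hr'⟩ := ih'
    refine ⟨R ∪ R', (Finset.card_union_le _ _).trans (by omega), fun S hS hm => ?_⟩
    obtain ⟨S', h1, h2, h3⟩ := hr S hS fun c hc => hm c (by simp [hc])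
    obtain ⟨S'', h4, h5, h6⟩ := hr' S' h2 fun c hc => h3 _ _ (hm c (by simp [hc]))
    exact ⟨S'', h1.seq h4, h5, fun a i h => h6 a i (h3 a i h)⟩
  | iteTrue q hx _ ih =>
    obtain ⟨R, hR, hr⟩ := ih
    refine ⟨R, by omega, fun S hS hm => ?_⟩
    obtain ⟨S', h1, h2, h3⟩ := hr S hS hm
    exact ⟨S', h1.iteTrue q (by rwa [hS]), h2, h3⟩
  | iteFalse p hx _ ih =>
    obtain ⟨R, hR, hr⟩ := ih
    refine ⟨R, by omega, fun S hS hm => ?_⟩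
    obtain ⟨S', h1, h2, h3⟩ := hr S hS hm
    exact ⟨S', h1.iteFalse p (by rwa [hS]), h2, h3⟩
  | loopDone p hx =>
    exact ⟨∅, by simp, fun S hS _ => ⟨S, .loopDone p (by rwa [hS]), hS, fun _ _ h => h⟩⟩
  | loopStep hx _ _ ih ih' =>
    obtain ⟨R, hR, hr⟩ := ih
    obtain ⟨R', hR', hr'⟩ := ih'
    refine ⟨R ∪ R', (Finset.card_union_le _ _).trans (by omega), fun S hS hm => ?_⟩
    obtain ⟨S', h1, h2, h3⟩ := hr S hS fun c hc => hm c (by simp [hc])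
    obtain ⟨S'', h4, h5, h6⟩ := hr' S' h2 fun c hc => h3 _ _ (hm c (by simp [hc]))
    exact ⟨S'', h1.loopStep (by rwa [hS]) h4, h5, fun a i h => h6 a i (h3 a i h)⟩

/-! ### Walks with a hidden vertex -/

theorem isVertexWalk_map_range {f : ℕ → Fin 50} {n : ℕ} (hn : 0 < n)
    (h : ∀ i, i + 1 < n → gadgetGraph.Adj (f i) (f (i + 1))) :
    IsVertexWalk gadgetGraph ((List.range n).map f) := by
  refine ⟨by simp; omega, ?_⟩
  rw [List.isChain_map, List.isChain_range]
  intro m hm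
  exact h m (by omega)

/-- A walk between the vertices `0` and `1` that ends at the vertex `1`. -/
def shuttle (n : ℕ) : List (Fin 50) := (List.range n).map fun i => if Even (n - 1 - i) then 1 else 0

/-- A walk between the vertices `3` and `4`; it visits the vertex `5` in the position `j`. -/
def detour (j n : ℕ) : List (Fin 50) :=
  (List.range n).map fun i => if i = j then 5 else if Even i then 3 else 4

theorem isVertexWalk_shuttle {n : ℕ} (hn : 0 < n) : IsVertexWalk gadgetGraph (shuttle n) := by
  refine isVertexWalk_map_range hn fun i hi => ?_
  have h : n - 1 - i = n - 1 - (i + 1) + 1 := by omega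
  by_cases h' : Even (n - 1 - (i + 1))
  · rw [if_neg (by rw [h, Nat.even_add_one]; simpa using h'), if_pos h']; decide
  · rw [if_pos (by rw [h, Nat.even_add_one]; exact h'), if_neg h']; decide

theorem isVertexWalk_detour {j n : ℕ} (hj : Even j) (hn : 0 < n) :
    IsVertexWalk gadgetGraph (detour j n) := by
  refine isVertexWalk_map_range hn fun i hi => ?_
  by_cases h : Even i
  · have h' : ¬ Even (i + 1) := by rwa [Nat.even_add_one, not_not]
    have h1 : i + 1 ≠ j := fun e => h' (e ▸ hj)
    rw [if_neg h1, if_neg h', if_pos h]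
    split_ifs <;> decide
  · have h' : Even (i + 1) := by rwa [Nat.even_add_one]
    have h1 : i ≠ j := fun e => h (e ▸ hj)
    rw [if_neg h1, if_neg h, if_pos h']
    split_ifs <;> decide

theorem length_shuttle (n : ℕ) : (shuttle n).length = n := by simp [shuttle]

theorem length_detour (j n : ℕ) : (detour j n).length = n := by simp [detour]

theorem Coupling.exists_left {α β : Type*} {R : α → β → Prop} {P : List α} {Q : List β}
    (h : Coupling R P Q) : ∀ v ∈ Q, ∃ u ∈ P, R u v := by
  induction h with
  | single h => simpa using h
  | left h _ ih =>
    intro v hv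
    obtain ⟨u, hu, huv⟩ := ih v hv
    exact ⟨u, by simp [hu], huv⟩
  | @right a b P Q h _ ih =>
    intro v hv
    rcases List.mem_cons.1 hv with rfl | hv
    · exact ⟨a, by simp, h⟩
    · exact ih v hv
  | @both a b P Q h _ ih =>
    intro v hv
    rcases List.mem_cons.1 hv with rfl | hv
    · exact ⟨a, by simp, h⟩
    · obtain ⟨u, hu, huv⟩ := ih v hv
      exact ⟨u, by simp [hu], huv⟩

/-- The vertex 5 is at distance more than 3 from both 0 and 1. If it is not visited, the second walk
waits at 3 until the first has reached its end 1, which is within distance 3 of both 3 and 4. -/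
theorem discreteFrechet_detour_le_iff {j n m : ℕ} (hj : Even j) (hn : 0 < n) (hm : 0 < m) :
    discreteFrechet gadgetGraph 1 (shuttle n) (detour j m) ≤ 3 ↔ m ≤ j := by
  have key := discreteFrechet_gadgetGraph_le_iff one_pos (isVertexWalk_shuttle hn).1
    (isVertexWalk_detour hj hm).1 3
  rw [one_mul, Nat.cast_ofNat] at key
  rw [key]
  have h01 : ∀ u ∈ shuttle n, u = 0 ∨ u = 1 := by
    intro u hu
    obtain ⟨i, -, rfl⟩ := List.mem_map.1 hu
    split_ifs <;> simp
  constructor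
  · intro h
    by_contra! hjm
    obtain ⟨u, hu, huv⟩ := h.exists_left 5 (List.mem_map.2 ⟨j, by simpa using hjm, by simp⟩)
    rcases h01 u hu with rfl | rfl
    · exact absurd huv (by decide)
    · exact absurd huv (by decide)
  · intro h
    have h34 : ∀ v ∈ detour j m, v = 3 ∨ v = 4 := by
      intro v hv
      obtain ⟨i, hi, rfl⟩ := List.mem_map.1 hv
      rw [List.mem_range] at hi
      rw [if_neg (by omega)]
      split_ifs <;> simp
    have hlast : ∀ e ∈ (shuttle n).getLast?, e = 1 := by
      intro e he
      simpa [shuttle, List.getLast?_range, hn.ne', eq_comm] using he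
    have hhead : ∀ e ∈ (detour j m).head?, e = 3 := by
      intro e he
      have : j ≠ 0 := by omega
      simpa [detour, List.head?_range, hm.ne', this, eq_comm] using he
    obtain ⟨a, P, hP⟩ := List.exists_cons_of_ne_nil (isVertexWalk_shuttle hn).1
    obtain ⟨b, Q, hQ⟩ := List.exists_cons_of_ne_nil (isVertexWalk_detour hj hm).1
    obtain rfl : b = 3 := hhead b (by simp [hQ])
    rw [hP] at h01 hlast ⊢
    rw [hQ] at h34 ⊢
    refine Coupling.of_elbow (Q := []) (by simp) (fun c hc => ?_) fun e he c hc => ?_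
    · rcases h01 c hc with rfl | rfl <;> decide
    · obtain rfl := hlast e he
      rcases h34 c (by simp [hc]) with rfl | rfl <;> decide

open Filter Topology in
theorem exists_sublinear {γ δ C : ℝ} (hγ : 0 < γ) (h : (1 + γ) * (1 - δ) < 1) :
    ∃ m : ℕ, 1 ≤ m ∧ 2 * (C * ((⌈(m : ℝ) ^ γ⌉₊ : ℝ) * m) ^ (1 - δ)) < m := by
  -- A negative `1 - δ` is replaced by `0`, so that raising to the power `s` is monotone.
  obtain ⟨s, hs₀, hs, hs₁⟩ : ∃ s : ℝ, 0 ≤ s ∧ 1 - δ ≤ s ∧ (1 + γ) * s < 1 := by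
    refine ⟨max (1 - δ) 0, le_max_right _ _, le_max_left _ _, ?_⟩
    rcases max_cases (1 - δ) 0 with ⟨e, -⟩ | ⟨e, -⟩ <;> rw [e]
    · exact h
    · simp
  have htend : Tendsto (fun m : ℕ => (m : ℝ) ^ (1 - (1 + γ) * s)) atTop atTop :=
    (tendsto_rpow_atTop (by linarith)).comp tendsto_natCast_atTop_atTop
  obtain ⟨m, hm, hm1⟩ := ((htend.eventually_gt_atTop (2 * (|C| * 2 ^ s))).and
    (eventually_ge_atTop 1)).exists
  refine ⟨m, hm1, ?_⟩
  have hm1' : (1 : ℝ) ≤ m := by exact_mod_cast hm1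
  have hpow : 1 ≤ (m : ℝ) ^ γ := Real.one_le_rpow hm1' hγ.le
  have hceil : (⌈(m : ℝ) ^ γ⌉₊ : ℝ) ≤ 2 * (m : ℝ) ^ γ := by
    have := Nat.ceil_lt_add_one (a := (m : ℝ) ^ γ) (by positivity)
    linarith
  have hceil1 : (1 : ℝ) ≤ ⌈(m : ℝ) ^ γ⌉₊ := hpow.trans (Nat.le_ceil _)
  have hmm : (m : ℝ) ^ ((1 + γ) * s) * (m : ℝ) ^ (1 - (1 + γ) * s) = m := by
    rw [← Real.rpow_add (by positivity)]; simp
  have hle : ((⌈(m : ℝ) ^ γ⌉₊ : ℝ) * m) ^ (1 - δ) ≤ 2 ^ s * (m : ℝ) ^ ((1 + γ) * s) := by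
    calc _ ≤ ((⌈(m : ℝ) ^ γ⌉₊ : ℝ) * m) ^ s :=
          Real.rpow_le_rpow_of_exponent_le (one_le_mul_of_one_le_of_one_le hceil1 hm1') hs
      _ ≤ (2 * ((m : ℝ) * (m : ℝ) ^ γ)) ^ s := by
          refine Real.rpow_le_rpow (by positivity) ?_ hs₀
          nlinarith
      _ = _ := by
          rw [Real.mul_rpow (by positivity) (by positivity), Real.rpow_mul (by positivity),
            Real.rpow_add (by positivity), Real.rpow_one]
  calc 2 * (C * ((⌈(m : ℝ) ^ γ⌉₊ : ℝ) * m) ^ (1 - δ))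
      ≤ 2 * (|C| * (2 ^ s * (m : ℝ) ^ ((1 + γ) * s))) := by
        gcongr
        exact le_abs_self C
    _ = (m : ℝ) ^ ((1 + γ) * s) * (2 * (|C| * 2 ^ s)) := by ring
    _ < (m : ℝ) ^ ((1 + γ) * s) * (m : ℝ) ^ (1 - (1 + γ) * s) := by gcongr
    _ = m := hmm

/-- On a walk without the vertex 5, a run of `t < m / 2` steps misses one of `t + 1` even positions.
Putting 5 there changes the distance but not the run. -/
theorem not_frechetSolvable {γ δ : ℝ} (hγ : 0 < γ) (h : (1 + γ) * (1 - δ) < 1) :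
    ¬ FrechetSolvable gadgetGraph γ δ := by
  rintro ⟨p, k, C, hp⟩
  obtain ⟨m, hm, hlt⟩ := exists_sublinear (C := C) hγ h
  set n := ⌈(m : ℝ) ^ γ⌉₊ with hn
  have hn₀ : 0 < n := one_le_ceil_rpow hm
  have run : ∀ j, Even j → _ := fun j hj => hp n m hm hn (shuttle n) (detour j m)
    (isVertexWalk_shuttle hn₀) (isVertexWalk_detour hj hm) (length_shuttle n) (length_detour j m)
  simp only [List.pure_def, List.bind_eq_flatMap, List.map_id', ← List.map_eq_flatMap] at run
  -- The position `2 * m` lies beyond the end, so this walk does not visit 5.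
  obtain ⟨t, s, hex, ht, hs⟩ := run (2 * m) (even_two_mul m)
  have htm : 2 * t < m := by
    have : (2 * t : ℝ) < m := by linarith
    exact_mod_cast this
  obtain ⟨R, hR, hr⟩ := hex.exists_reads
  obtain ⟨c, hc, hcR⟩ := Finset.exists_mem_notMem_of_card_lt_card
    (s := R) (t := (Finset.range (t + 1)).image fun i => (1, 2 * i)) (by
      rw [Finset.card_image_of_injective _ fun i j h => by simpa using h, Finset.card_range]
      omega)
  obtain ⟨i, hi, rfl⟩ := Finset.mem_image.1 hc
  rw [Finset.mem_range] at hi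
  obtain ⟨t', s', hex', -, hs'⟩ := run (2 * i) (even_two_mul i)
  obtain ⟨S, hS, hSr, -⟩ := hr (ramInput [n, m] ((shuttle n).map Fin.val)
    ((detour (2 * i) m).map Fin.val)) rfl (by
    rintro ⟨a, l⟩ hal
    by_cases h1 : a = 1 ∧ l < m
    · obtain ⟨rfl, hl⟩ := h1
      have hne : l ≠ 2 * i := fun e => hcR (e ▸ hal)
      have hne' : l ≠ 2 * m := by omega
      simp [ramInput, detour, hne, hne', hl]
    · by_cases ha : a = 1
      · subst ha
        have hl : m ≤ l := by omega
        simp [ramInput, detour, hl]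
      · simp [ramInput, ha])
  obtain rfl := hS.deterministic hex'
  rw [hSr, hs] at hs'
  have h1 := (discreteFrechet_detour_le_iff (even_two_mul m) hn₀ hm).2 (by omega)
  rw [hs', discreteFrechet_detour_le_iff (even_two_mul i) hn₀ hm] at h1
  omega

/-! ### From the hypotheses to hardness -/

theorem FrechetSolvable.mono {N : ℕ} {G : SimpleGraph (Fin N)} {γ δ δ' : ℝ} (h : δ' ≤ δ)
    (hF : FrechetSolvable G γ δ) : FrechetSolvable G γ δ' := by
  obtain ⟨p, k, C, hp⟩ := hF
  refine ⟨p, k, |C|, fun n m hm hn P Q hP hQ hPn hQm => ?_⟩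
  obtain ⟨t, s, h1, h2, h3⟩ := hp n m hm hn P Q hP hQ hPn hQm
  refine ⟨t, s, h1, h2.trans ?_, h3⟩
  have hn1 : 1 ≤ n := hn ▸ one_le_ceil_rpow hm
  have : (1 : ℝ) ≤ (n : ℝ) * m := one_le_mul_of_one_le_of_one_le (by exact_mod_cast hn1)
    (by exact_mod_cast hm)
  gcongr
  exact le_abs_self C

/-- With `γ` fixed, `δ` may be decreased to at most `γ / (1 + γ)`, the value at which `(1 + γ) * (1
- δ) = 1`. -/
theorem not_frechetSolvable_of_ovhAt {γ : ℝ} (hγ : 0 < γ) (hγ₁ : γ ≤ 1) (h : OVHAt γ) {δ : ℝ}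
    (hδ : 0 < δ) : ¬ FrechetSolvable gadgetGraph γ δ := by
  intro hF
  have hpos : 0 < min δ (γ / (1 + γ)) := lt_min hδ (by positivity)
  obtain ⟨ω, hω, hov⟩ := h _ (half_pos hpos)
  refine hov (orthogonalVectorsSolvable_of_frechetSolvable hγ hγ₁ hpos hω ?_
    (hF.mono (min_le_left _ _)))
  calc 1 = (1 + γ) * (1 - γ / (1 + γ)) := by field_simp; ring
    _ ≤ (1 + γ) * (1 - min δ (γ / (1 + γ))) := by gcongr; exact min_le_right _ _

/-- Here `γ` is supplied only after `δ`, so `δ` cannot be decreased in terms of `γ`; a sublinear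
running time is refuted directly instead. -/
theorem exists_not_frechetSolvable_of_ovh (h : OVH) {δ : ℝ} (hδ : 0 < δ) :
    ∃ γ : ℝ, 0 < γ ∧ γ < 1 ∧ ¬ FrechetSolvable gadgetGraph γ δ := by
  obtain ⟨ω, γ, hω, hγ, hγ₁, hov⟩ := h _ (half_pos hδ)
  refine ⟨γ, hγ, hγ₁, fun hF => ?_⟩
  rcases le_or_gt 1 ((1 + γ) * (1 - δ)) with h1 | h1
  · exact hov (orthogonalVectorsSolvable_of_frechetSolvable hγ hγ₁.le hδ hω h1 hF)
  · exact not_frechetSolvable hγ h1 hF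

theorem mainTheorem6 :
    ∃ (N : ℕ) (G : SimpleGraph (Fin N)), IsPlanarGraph G ∧ G.Connected ∧
      -- the reduction: all edges of `G` have weight `1 / 10`
      (∃ (f g : (d : ℕ) → List (Fin d → Bool) → List (Fin N)) (C : ℕ),
        ∀ d : ℕ, 1 ≤ d → ∀ A B : List (Fin d → Bool), A ≠ [] → B ≠ [] →
          IsVertexWalk G (f d A) ∧ IsVertexWalk G (g d B) ∧
          (f d A).length ≤ C * (A.length * d) ∧ (g d B).length ≤ C * (B.length * d) ∧
          (HasOrthogonalPair A B ↔ discreteFrechet G (1 / 10) (f d A) (g d B) ≤ 1.9)) ∧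
      -- hardness, for every fixed size relation `n = m ^ γ`
      (∀ γ : ℝ, 0 < γ → γ ≤ 1 → OVHAt γ → ∀ δ : ℝ, 0 < δ → ¬ FrechetSolvable G γ δ) ∧
      -- hardness, if the exponent in the hypothesis may depend on `δ`
      (OVH → ∀ δ : ℝ, 0 < δ → ∃ γ : ℝ, 0 < γ ∧ γ < 1 ∧ ¬ FrechetSolvable G γ δ) := by
  exact ⟨50, gadgetGraph, gadgetGraph_planar, gadgetGraph_connected, exists_reduction,
    fun _ hγ hγ₁ h _ hδ => not_frechetSolvable_of_ovhAt hγ hγ₁ h hδ,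
    fun h _ hδ => exists_not_frechetSolvable_of_ovh h hδ⟩
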